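/- Activated random walks on $\mathbb{Z}$ with totally asymmetric jumps and sleeping rate $0<\lambda\le\infty$. Each site is either occupied by $n\ge 0$ active particles or by exactly one passive particle. Each active particle jumps one unit to the right at rate $1$ and, independently, tries to fall asleep (become passive) at rate $\lambda$; the attempt succeeds if it is alone at its site and has no effect otherwise. A passive particle does not move, and becomes active as soon as another particle arrives at its site. If $\lambda=\infty$, an active particle that is alone at its site falls asleep instantaneously. Equivalently, for $\lambda<\infty$ the clock of each site rings at rate $1+\lambda$ times the number of active particles there, and each ring independently triggers a jump with probability $\frac1{1+\lambda}$ and an attempt to sleep with probability $\frac{\lambda}{1+\lambda}$; for $\lambda=\infty$ the clock rings at rate equal to the number of active particles, and each ring triggers a jump. Initially all particles are active, and their numbers at the sites are i.i.d. Poisson with parameter $\mu\ge 0$. The infinite system $(\eta_t)_{t\ge0}$ is the limit, as the finite set $V$ increases to $\mathbb{Z}$, of the systems that contain only the particles starting in $V$, all these systems being driven by the same unit-rate exponential clock times and the same jump/sleep instructions attached to the sites. The system \emph{locally fixates} if for every $x\in\mathbb{Z}$ the state $\eta_t(x)$ is eventually constant in $t$. The critical density $\mu_c=\mu_c(\lambda)\in[0,\infty]$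 is the supremum of the $\mu$ for which the system locally fixates almost surely. Theorem. Let $0<\lambda\le\infty$. For every $\mu\ge0$ the infinite system is almost surely well defined: for each site $x$ and each $T$ there is a finite $V_0$ such that the systems started from any finite $V\supseteq V_0$ have the same state at $x$ at all times $t\le T$. The critical density is $$\mu_c=\frac{\lambda}{1+\lambda}\qquad(\text{with } \mu_c=1 \text{ if } \lambda=\infty).$$ If $\mu<\mu_c$, the system locally fixates almost surely; if $\mu>\mu_c$, then almost surely it does not locally fixate; and if $\mu=\mu_c$, then almost surely it does not locally fixate. -/

import Mathlib

open MeasureTheory ProbabilityTheory Filter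
open scoped ENNReal NNReal

namespace ARW

noncomputable section

/-- The state of one site: `active n` stands for `n` active particles (so `active 0` is an
empty site), and `asleep` for exactly one particle, which is passive. -/
inductive SiteState
  | active (n : ℕ)
  | asleep

namespace SiteState

/-- The number of active particles at a site. -/
def numActive : SiteState → ℕ
  | active n => n
  | asleep => 0

/-- A particle arrives; a passive particle is woken up (`A + S → 2A`). -/
def addParticle : SiteState → SiteState
  | active n => active (n + 1)
  | asleep => active 2

/-- An active particle leaves (only used at sites with at least one active particle). -/
def removeParticle : SiteState → SiteState
  | active n => active (n - 1)
  | asleep => active 0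

/-- A particle tries to sleep: this succeeds if it is alone and otherwise has no effect. -/
def trySleep : SiteState → SiteState
  | active 1 => asleep
  | s => s

end SiteState

/-- A configuration of particles on `ℤ`. -/
abbrev Config := ℤ → SiteState

/-- When the sleeping rate is infinite, a lone active particle falls asleep instantaneously;
when it is finite, nothing happens instantaneously. -/
def settle (lam : ℝ≥0∞) (s : SiteState) : SiteState :=
  open scoped Classical in if lam = ⊤ then s.trySleep else s

/-- The rate, per active particle, at which the clock of a site rings: `1 + λ` (jump attempts at
rate `1`, sleep attempts at rate `λ`). If `λ = ∞`, sleeping is instantaneous and not governed by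
the clock, which then only triggers jumps, at rate `1` per active particle. -/
def ringRate (lam : ℝ≥0∞) : ℝ :=
  open scoped Classical in if lam = ⊤ then 1 else 1 + lam.toReal

/-- The probability that a ring triggers a jump: `1 / (1 + λ)`, or `1` if `λ = ∞`. -/
def jumpProb (lam : ℝ≥0∞) : ℝ≥0∞ :=
  open scoped Classical in if lam = ⊤ then 1 else (1 + lam)⁻¹

theorem jumpProb_le_one (lam : ℝ≥0∞) : jumpProb lam ≤ 1 := by
  unfold jumpProb
  split_ifs
  · exact le_rfl
  · simp

/-- The law of one instruction: `true` (jump to the right neighbour) with probability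
`jumpProb lam`, and `false` (try to sleep) otherwise. -/
def instructionLaw (lam : ℝ≥0∞) : Measure Bool :=
  jumpProb lam • Measure.dirac true + (1 - jumpProb lam) • Measure.dirac false

instance (lam : ℝ≥0∞) : IsProbabilityMeasure (instructionLaw lam) :=
  ⟨by simp [instructionLaw, add_tsub_cancel_of_le (jumpProb_le_one lam)]⟩

instance : IsProbabilityMeasure (expMeasure 1) := isProbabilityMeasure_expMeasure one_pos

/-- The randomness that drives the system: the initial numbers of particles, the unit-rate
exponential times of the clocks, and the instructions. The `j`-th ring of the clock at site `x`
(`j = 0, 1, 2, …`) uses the exponential time and the instruction with index `(x, j)`. -/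
abbrev Noise := (ℤ → ℕ) × (ℤ × ℕ → ℝ) × (ℤ × ℕ → Bool)

/-- The initial numbers of particles are i.i.d. Poisson with parameter `μ`, the exponential times
are i.i.d. with rate `1`, the instructions are i.i.d. with law `instructionLaw lam`, and the three
families are independent of each other. -/
def noiseLaw (lam : ℝ≥0∞) (μ : ℝ≥0) : Measure Noise :=
  (Measure.infinitePi fun _ : ℤ => poissonMeasure μ).prod
    ((Measure.infinitePi fun _ : ℤ × ℕ => expMeasure 1).prod
      (Measure.infinitePi fun _ : ℤ × ℕ => instructionLaw lam))

/-- The effect on the configuration `η` of a ring at the site `x`: a jump `x → x + 1` if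
`b = true`, and an attempt to sleep at `x` if `b = false`. -/
def topple (lam : ℝ≥0∞) (x : ℤ) (b : Bool) (η : Config) : Config := fun z =>
  match b with
  | true =>
    if z = x then settle lam (η x).removeParticle
    else if z = x + 1 then settle lam (η (x + 1)).addParticle
    else η z
  | false => if z = x then (η x).trySleep else η z

/-- A snapshot of the system just after a ring. -/
structure Snapshot where
  /-- the current configuration -/
  config : Config
  /-- the number of rings so far at each site -/
  rings : ℤ → ℕ
  /-- what is left, at each site, of the exponential time of the next ring there; it is used up at
  speed `ringRate` times the number of active particles at the site -/
  residual : ℤ → ℝ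
  /-- the current time; it is set to `∞` once no particle is active -/
  time : ℝ≥0∞

namespace Snapshot

/-- The time that remains until the clock at `x` rings, provided that nothing else happens before
(meaningful if there is an active particle at `x`). -/
def wait (lam : ℝ≥0∞) (s : Snapshot) (x : ℤ) : ℝ :=
  s.residual x / (ringRate lam * (s.config x).numActive)

/-- The clock at `x` is the next one to ring. -/
def IsNext (lam : ℝ≥0∞) (s : Snapshot) (x : ℤ) : Prop :=
  0 < (s.config x).numActive ∧
    ∀ y, 0 < (s.config y).numActive → s.wait lam x ≤ s.wait lam y

/-- The snapshot after the next ring, which takes place at the site `x`. -/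
def ringAt (lam : ℝ≥0∞) (ω : Noise) (s : Snapshot) (x : ℤ) : Snapshot where
  config := topple lam x (ω.2.2 (x, s.rings x)) s.config
  rings := Function.update s.rings x (s.rings x + 1)
  residual := Function.update
    (fun y => s.residual y - ringRate lam * (s.config y).numActive * s.wait lam x)
    x (ω.2.1 (x, s.rings x + 1))
  time := s.time + ENNReal.ofReal (s.wait lam x)

/-- The snapshot after the next ring; if there is none, the configuration stays as it is forever.
(Almost surely no two clocks ring simultaneously, so the choice of the site is immaterial.) -/
def next (lam : ℝ≥0∞) (ω : Noise) (s : Snapshot) : Snapshot :=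
  open scoped Classical in
  if h : ∃ x, s.IsNext lam x then s.ringAt lam ω h.choose else { s with time := ⊤ }

end Snapshot

/-- The initial snapshot of the system in which only the particles that start in the finite set
`V` are present, all of them active. -/
def initial (lam : ℝ≥0∞) (ω : Noise) (V : Finset ℤ) : Snapshot where
  config := fun x => if x ∈ V then settle lam (.active (ω.1 x)) else .active 0
  rings := fun _ => 0
  residual := fun x => ω.2.1 (x, 0)
  time := 0

/-- The snapshot of the finite system after `k` rings. -/
def snapshot (lam : ℝ≥0∞) (ω : Noise) (V : Finset ℤ) (k : ℕ) : Snapshot :=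
  (Snapshot.next lam ω)^[k] (initial lam ω V)

/-- The number of rings up to time `t` in the finite system (almost surely finite). -/
def numRings (lam : ℝ≥0∞) (ω : Noise) (V : Finset ℤ) (t : ℝ≥0) : ℕ :=
  sSup {k | (snapshot lam ω V k).time ≤ t}

/-- The configuration at time `t` of the continuous-time activated random walk on `ℤ` in which
only the particles that start in the finite set `V` are present. -/
def finiteProcess (lam : ℝ≥0∞) (ω : Noise) (V : Finset ℤ) (t : ℝ≥0) : Config :=
  (snapshot lam ω V (numRings lam ω V t)).config

/-- The infinite system is well defined: at each site and on each bounded time interval, the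
finite systems agree as soon as `V` is large enough. -/
def WellDefined (lam : ℝ≥0∞) (ω : Noise) : Prop :=
  ∀ (x : ℤ) (T : ℝ≥0), ∃ V₀ : Finset ℤ, ∀ V : Finset ℤ, V₀ ⊆ V →
    ∀ t ≤ T, finiteProcess lam ω V t x = finiteProcess lam ω V₀ t x

/-- The infinite system `(η_t)`, the limit of the finite systems as `V ↑ ℤ` (the value
`active 0` is a default where the limit does not exist, which has probability zero). -/
def process (lam : ℝ≥0∞) (ω : Noise) (t : ℝ≥0) : Config := fun x =>
  open scoped Classical in
  if h : ∃ s : SiteState, ∀ᶠ V : Finset ℤ in atTop, finiteProcess lam ω V t x = s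
  then h.choose else .active 0

/-- The state of each site is eventually constant in time. -/
def LocallyFixates (η : ℝ≥0 → Config) : Prop :=
  ∀ x : ℤ, ∃ s : SiteState, ∀ᶠ t : ℝ≥0 in atTop, η t x = s

/-- The critical density `μ_c(λ) ∈ [0, ∞]`: the supremum of the densities for which the system
locally fixates almost surely. -/
def criticalDensity (lam : ℝ≥0∞) : ℝ≥0∞ :=
  ⨆ (μ : ℝ≥0) (_ : ∀ᵐ ω ∂noiseLaw lam μ, LocallyFixates (process lam ω)), (μ : ℝ≥0∞)

end

end ARW

namespace ARW

/-! ### One site: rings as a function of the internal time, state as a function of the counts -/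

/-! Since jumps go only to the right, the system can be solved from left to right. If `k + 1`
particles reach a site in total, `k` of them must leave, because two particles at one site are never
stable. One instruction decides about the last: it stays with probability `z = sleepProb lam`, that
is `λ / (1 + λ)`, or `1` if `λ = ∞` (`outflow_succ`, `lintegral_outflow_succ`). So the number `W n`
of particles sent out by an interval of `n` sites, stabilized on its own, is a Markov chain: add a
Poisson(`μ`) number, then remove one particle with probability `z` if there is any. For a fixed
right end `W n` increases with `n`, and fixation is decided by whether it stays bounded.

To connect this chain with the dynamics, each site is described by the internal time of its clock.
At equal internal times, more arrivals never mean fewer active particles (`activeAt_mono`). A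
comparison principle for piecewise linear functions (`le_of_right_slopes`) then gives monotonicity
in the set of initial particles (`IsFlow.mono_initial`), and shows that the eventual numbers of
rings are those of the stabilization (`ringsUpTo_le_settleRings`, `exists_chain_le_jumps`). The
finite systems are such flows (`isFlow_internalTime`): rational independence of the waiting times
excludes simultaneous rings, and a site with a long first waiting time excludes explosion.

The infinite system exists because there are sites arbitrarily far to the left that do not ring
before `T`, whatever particles are present; only finitely many particles matter to the right of such
a block. Crude bounds on the numbers of rings in short time slices have means that are bounded along
the line, so a block has probability bounded below, and a zero-one law yields infinitely many
(`ae_exists_isBlock`).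

If `μ < z`, the mean of `s ^ W n` obeys a contraction for some `s > 1` (`exists_contraction`), so `W
n` stays bounded. If `μ ≥ z`, let `G n r` be the mean of `r ^ W n` and `r = 1 / (1 + h)`. The exact
recursion `genFun_succ` gives in the limit `z h exp(-μ) G 0 = (c - 1) G r` with `c = (1 + z h) exp(μ
(r - 1))`. As `h → 0`, `c - 1` is at most of order `h ^ 2`, also at `μ = z`, so `G 0 = 0`. For one
large `h` the factor `c - 1` is positive, so `G r = 0` and `W n` is almost surely unbounded. Every
jump changes the state of its site, so this rules out fixation. -/

/-- The number of jumps among the first `r` instructions. -/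
def jumps (b : ℕ → Bool) (r : ℕ) : ℕ := Nat.count (fun j => b j = true) r

/-- The internal time of the `n`-th ring of a clock with waiting times `e`. -/
def clockSum (e : ℕ → ℝ) (n : ℕ) : ℝ := ∑ j ∈ Finset.range n, e j

/-- The number of rings up to the internal time `u` of a clock with waiting times `e`. -/
noncomputable def ringCount (e : ℕ → ℝ) (u : ℝ) : ℕ := sInf {j | u < clockSum e (j + 1)}

/-- The state of a site after a total of `a` arrivals and `r` rings. -/
noncomputable def siteState (lam : ℝ≥0∞) (b : ℕ → Bool) (a r : ℕ) : SiteState :=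
  open scoped Classical in
  -- If the last ring was a sleep attempt, some particle was active at that moment; an arrival since
  -- then would make at least two. So a lone particle is the one that fell asleep.
  if a - jumps b r = 1 ∧ (lam = ⊤ ∨ (0 < r ∧ b (r - 1) = false)) then .asleep
  else .active (a - jumps b r)

/-- The number of active particles at a site after `a` arrivals and `r` rings. -/
noncomputable def activeAt (lam : ℝ≥0∞) (b : ℕ → Bool) (a r : ℕ) : ℕ :=
  (siteState lam b a r).numActive

/-- The waiting times of a clock are positive and have infinite sum. -/
structure IsClock (e : ℕ → ℝ) : Prop where
  pos : ∀ j, 0 < e j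
  unbounded : ∀ M : ℝ, ∃ n, M < clockSum e n

theorem jumps_zero (b : ℕ → Bool) : jumps b 0 = 0 := Nat.count_zero _

theorem jumps_succ (b : ℕ → Bool) (r : ℕ) :
    jumps b (r + 1) = jumps b r + if b r = true then 1 else 0 := Nat.count_succ _ _

theorem jumps_mono (b : ℕ → Bool) : Monotone (jumps b) := Nat.count_monotone _

theorem jumps_le (b : ℕ → Bool) (r : ℕ) : jumps b r ≤ r := Nat.count_le _

theorem clockSum_zero (e : ℕ → ℝ) : clockSum e 0 = 0 := Finset.sum_range_zero _

theorem clockSum_succ (e : ℕ → ℝ) (n : ℕ) : clockSum e (n + 1) = clockSum e n + e n :=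
  Finset.sum_range_succ _ _

theorem ringRate_pos (lam : ℝ≥0∞) : 0 < ringRate lam := by
  unfold ringRate
  split_ifs <;> positivity

namespace IsClock

variable {e : ℕ → ℝ}

theorem strictMono (he : IsClock e) : StrictMono (clockSum e) :=
  strictMono_nat_of_lt_succ fun n => by
    rw [clockSum_succ]
    linarith [he.pos n]

theorem lt_clockSum_succ (he : IsClock e) (u : ℝ) : u < clockSum e (ringCount e u + 1) := by
  have hne : {j | u < clockSum e (j + 1)}.Nonempty := by
    obtain ⟨n, hn⟩ := he.unbounded u
    exact ⟨n, hn.trans (he.strictMono n.lt_succ_self)⟩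
  exact Nat.sInf_mem hne

theorem clockSum_le (_ : IsClock e) {u : ℝ} (hu : 0 ≤ u) : clockSum e (ringCount e u) ≤ u := by
  rcases Nat.eq_zero_or_eq_succ_pred (ringCount e u) with h | h
  · rw [h, clockSum_zero]
    exact hu
  · have hlt : (ringCount e u).pred < sInf {j | u < clockSum e (j + 1)} := by
      change _ < ringCount e u
      omega
    have := Nat.notMem_of_lt_sInf hlt
    rw [h]
    exact not_lt.1 this

theorem le_ringCount_iff (he : IsClock e) {u : ℝ} (hu : 0 ≤ u) {n : ℕ} :
    n ≤ ringCount e u ↔ clockSum e n ≤ u := by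
  constructor
  · exact fun h => (he.strictMono.monotone h).trans (he.clockSum_le hu)
  · intro h
    exact Nat.lt_succ_iff.1 (he.strictMono.lt_iff_lt.1 (h.trans_lt (he.lt_clockSum_succ u)))

theorem ringCount_eq (he : IsClock e) {u : ℝ} {n : ℕ} (h₁ : clockSum e n ≤ u)
    (h₂ : u < clockSum e (n + 1)) : ringCount e u = n := by
  have hu : 0 ≤ u := by
    have := he.strictMono.monotone (Nat.zero_le n)
    rw [clockSum_zero] at this
    linarith
  refine le_antisymm ?_ ((he.le_ringCount_iff hu).2 h₁)
  by_contra! h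
  have := (he.le_ringCount_iff hu).1 (Nat.succ_le_of_lt h)
  exact absurd h₂ (not_lt.2 this)

theorem ringCount_mono (he : IsClock e) {u v : ℝ} (hu : 0 ≤ u) (h : u ≤ v) :
    ringCount e u ≤ ringCount e v :=
  (he.le_ringCount_iff (hu.trans h)).2 ((he.clockSum_le hu).trans h)

end IsClock

theorem activeAt_le (lam : ℝ≥0∞) (b : ℕ → Bool) (a r : ℕ) :
    activeAt lam b a r ≤ a - jumps b r := by
  unfold activeAt siteState
  split_ifs <;> simp [SiteState.numActive]

theorem activeAt_le_arrivals (lam : ℝ≥0∞) (b : ℕ → Bool) (a r : ℕ) : activeAt lam b a r ≤ a :=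
  (activeAt_le lam b a r).trans (Nat.sub_le _ _)

/-- Extra particles could lower the count only if the site with more arrivals is asleep; it then
holds exactly one particle, and the other site none. All monotonicity of the dynamics rests on this.
-/
theorem activeAt_mono (lam : ℝ≥0∞) (b : ℕ → Bool) {a a' : ℕ} (h : a ≤ a') (r : ℕ) :
    activeAt lam b a r ≤ activeAt lam b a' r := by
  rcases h.eq_or_lt with rfl | h
  · exact le_rfl
  · have hle := activeAt_le lam b a r
    unfold activeAt at hle ⊢
    generalize (siteState lam b a r).numActive = m at hle
    unfold siteState
    split_ifs with h' <;> simp only [SiteState.numActive] <;> omega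

theorem activeAt_eq_zero_of_le (lam : ℝ≥0∞) (b : ℕ → Bool) {a r : ℕ} (h : a ≤ jumps b r) :
    activeAt lam b a r = 0 := by
  have := activeAt_le lam b a r
  omega

/-- The number of rings that stabilize a site which receives `k` particles in total. -/
noncomputable def settleRings (lam : ℝ≥0∞) (b : ℕ → Bool) (k : ℕ) : ℕ :=
  sInf {r | activeAt lam b k r = 0}

/-- The number of particles that leave a site which receives `k` particles in total. -/
noncomputable def outflow (lam : ℝ≥0∞) (b : ℕ → Bool) (k : ℕ) : ℕ :=
  jumps b (settleRings lam b k)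

/-- Infinitely many of the instructions are jumps. -/
def JumpsOften (b : ℕ → Bool) : Prop := ∀ k, ∃ r, k ≤ jumps b r

theorem activeAt_settleRings {lam : ℝ≥0∞} {b : ℕ → Bool} (hb : JumpsOften b) (k : ℕ) :
    activeAt lam b k (settleRings lam b k) = 0 := by
  have hne : {r | activeAt lam b k r = 0}.Nonempty := by
    obtain ⟨r, hr⟩ := hb k
    exact ⟨r, activeAt_eq_zero_of_le lam b hr⟩
  exact Nat.sInf_mem hne

theorem activeAt_pos_of_lt {lam : ℝ≥0∞} {b : ℕ → Bool} {k r : ℕ} (h : r < settleRings lam b k) :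
    0 < activeAt lam b k r :=
  Nat.pos_of_ne_zero (Nat.notMem_of_lt_sInf (s := {r | activeAt lam b k r = 0}) h)

/-- The rings that stabilize `k'` arrivals leave no active particle if only `k ≤ k'` arrive. -/
theorem settleRings_mono {lam : ℝ≥0∞} {b : ℕ → Bool} (hb : JumpsOften b) :
    Monotone (settleRings lam b) := fun k k' h => by
  refine Nat.sInf_le ?_
  have := activeAt_mono lam b h (settleRings lam b k')
  rw [activeAt_settleRings hb] at this
  exact Nat.le_zero.1 this

theorem outflow_mono {lam : ℝ≥0∞} {b : ℕ → Bool} (hb : JumpsOften b) :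
    Monotone (outflow lam b) :=
  (jumps_mono b).comp (settleRings_mono hb)

/-! ### Flows: the internal times of all sites as functions of time -/

/-- A crossing can begin only where the functions touch, and there the slopes order the linear
pieces to the right. Non-strict inequality of the slopes suffices because the functions are exactly
linear for a short while. -/
theorem le_of_right_slopes {f g p q : ℝ → ℝ} {a b : ℝ}
    (hf : ContinuousOn f (Set.Icc a b)) (hg : ContinuousOn g (Set.Icc a b))
    (hfs : ∀ t ∈ Set.Ico a b, ∃ ε > 0, ∀ u ∈ Set.Icc t (t + ε), f u = f t + p t * (u - t))
    (hgs : ∀ t ∈ Set.Ico a b, ∃ ε > 0, ∀ u ∈ Set.Icc t (t + ε), g u = g t + q t * (u - t))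
    (h₀ : f a ≤ g a) (h : ∀ t ∈ Set.Ico a b, f t = g t → p t ≤ q t) :
    ∀ t ∈ Set.Icc a b, f t ≤ g t := by
  refine IsClosed.Icc_subset_of_forall_exists_gt (s := {t | f t ≤ g t}) ?_ h₀ ?_
  · have : {t | f t ≤ g t} ∩ Set.Icc a b = {t ∈ Set.Icc a b | f t ≤ g t} := by
      ext t
      simp [and_comm]
    rw [this]
    exact isClosed_Icc.isClosed_le hf hg
  · rintro t ⟨hle, ht⟩ y hy
    have hle : f t ≤ g t := hle
    have hy : t < y := hy
    obtain ⟨ε, hε, hfε⟩ := hfs t ht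
    obtain ⟨δ, hδ, hgδ⟩ := hgs t ht
    rcases hle.eq_or_lt with heq | hlt
    · have hpq := h t ht heq
      refine ⟨t + min (y - t) (min ε δ), ?_, ?_, ?_⟩
      · have h0 : 0 < min (y - t) (min ε δ) := by
          simp [hε, hδ, hy]
        have h1 : min (y - t) (min ε δ) ≤ ε := (min_le_right _ _).trans (min_le_left _ _)
        have h2 : min (y - t) (min ε δ) ≤ δ := (min_le_right _ _).trans (min_le_right _ _)
        change f _ ≤ g _
        rw [hfε _ ⟨by linarith, by linarith⟩, hgδ _ ⟨by linarith, by linarith⟩, heq]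
        have : p t * (t + min (y - t) (min ε δ) - t) ≤ q t * (t + min (y - t) (min ε δ) - t) :=
          mul_le_mul_of_nonneg_right hpq (by linarith)
        linarith
      · have : 0 < min (y - t) (min ε δ) := by
          simp [hε, hδ, hy]
        linarith
      · linarith [min_le_left (y - t) (min ε δ)]
    -- The gap closes at speed at most `|p t - q t|`; the `+ 1` avoids a division by zero.
    · set m := min (y - t) (min ε (min δ ((g t - f t) / (|p t - q t| + 1)))) with hm
      have hd : 0 < |p t - q t| + 1 := by positivity
      have h0 : 0 < m := by
        have : 0 < (g t - f t) / (|p t - q t| + 1) := div_pos (by linarith) hd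
        simp [hm, hε, hδ, hy, this]
      have h1 : m ≤ ε := (min_le_right _ _).trans (min_le_left _ _)
      have h2 : m ≤ δ := (min_le_right _ _).trans ((min_le_right _ _).trans (min_le_left _ _))
      have h3 : m ≤ (g t - f t) / (|p t - q t| + 1) :=
        (min_le_right _ _).trans ((min_le_right _ _).trans (min_le_right _ _))
      have h5 : m ≤ y - t := min_le_left _ _
      refine ⟨t + m, ?_, by linarith, by linarith⟩
      change f _ ≤ g _
      rw [hfε _ ⟨by linarith, by linarith⟩, hgδ _ ⟨by linarith, by linarith⟩]
      rw [le_div_iff₀ hd] at h3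
      have h4 : (p t - q t) * m ≤ |p t - q t| * m :=
        mul_le_mul_of_nonneg_right (le_abs_self _) h0.le
      nlinarith

/-- The total number of arrivals at `x` up to time `t`, including the particles that start there,
if `L` are the internal times. -/
noncomputable def arrivals (e : ℤ → ℕ → ℝ) (b : ℤ → ℕ → Bool) (c : ℤ → ℕ) (L : ℤ → ℝ → ℝ)
    (x : ℤ) (t : ℝ) : ℕ :=
  c x + jumps (b (x - 1)) (ringCount (e (x - 1)) (L (x - 1) t))

/-- The number of active particles at `x` at time `t`, if `L` are the internal times. -/
noncomputable def activeCount (lam : ℝ≥0∞) (e : ℤ → ℕ → ℝ) (b : ℤ → ℕ → Bool) (c : ℤ → ℕ)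
    (L : ℤ → ℝ → ℝ) (x : ℤ) (t : ℝ) : ℕ :=
  activeAt lam (b x) (arrivals e b c L x t) (ringCount (e x) (L x t))

/-- The functions `L` describe, for the system with clocks `e`, instructions `b` and initial
numbers of particles `c`, how the internal time of the clock at each site, which runs at speed
`ringRate` times the number of active particles, depends on time. -/
structure IsFlow (lam : ℝ≥0∞) (e : ℤ → ℕ → ℝ) (b : ℤ → ℕ → Bool) (c : ℤ → ℕ)
    (L : ℤ → ℝ → ℝ) : Prop where
  zero : ∀ x, L x 0 = 0
  cont : ∀ x, ContinuousOn (L x) (Set.Ici 0)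
  slope : ∀ x t, 0 ≤ t → ∃ ε > 0, ∀ u ∈ Set.Icc t (t + ε),
    L x u = L x t + ringRate lam * activeCount lam e b c L x t * (u - t)
  left : ∃ x₀, ∀ x < x₀, ∀ t, 0 ≤ t → L x t = 0

/-! ### Comparison principles for flows -/

namespace IsFlow

variable {lam : ℝ≥0∞} {e : ℤ → ℕ → ℝ} {b : ℤ → ℕ → Bool} {c c' : ℤ → ℕ} {L L' : ℤ → ℝ → ℝ}

theorem contOn (h : IsFlow lam e b c L) (x : ℤ) {s t : ℝ} (hs : 0 ≤ s) :
    ContinuousOn (L x) (Set.Icc s t) :=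
  (h.cont x).mono fun _ hu => hs.trans hu.1

theorem mono (h : IsFlow lam e b c L) (x : ℤ) {s t : ℝ} (hs : 0 ≤ s) (hst : s ≤ t) :
    L x s ≤ L x t := by
  refine le_of_right_slopes (f := fun _ => L x s) (p := fun _ => 0) (b := t)
    continuousOn_const (h.contOn x hs) (fun u _ => ⟨1, one_pos, fun _ _ => by simp⟩)
    (fun u hu => h.slope x u (hs.trans hu.1)) le_rfl (fun u _ _ => ?_) t ⟨hst, le_rfl⟩
  exact mul_nonneg (ringRate_pos lam).le (Nat.cast_nonneg _)

theorem nonneg (h : IsFlow lam e b c L) (x : ℤ) {t : ℝ} (ht : 0 ≤ t) : 0 ≤ L x t := by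
  rw [← h.zero x]
  exact h.mono x le_rfl ht

theorem ringCount_mono (h : IsFlow lam e b c L) (he : ∀ x, IsClock (e x)) (x : ℤ) {s t : ℝ}
    (hs : 0 ≤ s) (hst : s ≤ t) : ringCount (e x) (L x s) ≤ ringCount (e x) (L x t) :=
  (he x).ringCount_mono (h.nonneg x hs) (h.mono x hs hst)

theorem arrivals_mono (h : IsFlow lam e b c L) (he : ∀ x, IsClock (e x)) (x : ℤ) {s t : ℝ}
    (hs : 0 ≤ s) (hst : s ≤ t) : arrivals e b c L x s ≤ arrivals e b c L x t :=
  Nat.add_le_add_left (jumps_mono _ (h.ringCount_mono he _ hs hst)) _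

/-- Where the two internal times touch, the ring counts agree, so the clock of the site with more
arrivals runs at least as fast. -/
theorem le_of_arrivals_le (h : IsFlow lam e b c L) (h' : IsFlow lam e b c' L') {x : ℤ} {T : ℝ}
    (ha : ∀ t, 0 ≤ t → t ≤ T → arrivals e b c L x t ≤ arrivals e b c' L' x t)
    {t : ℝ} (ht : 0 ≤ t) (htT : t ≤ T) : L x t ≤ L' x t := by
  refine le_of_right_slopes (a := 0) (b := T) (h.contOn x le_rfl) (h'.contOn x le_rfl)
    (fun u hu => h.slope x u hu.1) (fun u hu => h'.slope x u hu.1) (by rw [h.zero, h'.zero])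
    (fun u hu heq => ?_) t ⟨ht, htT⟩
  refine mul_le_mul_of_nonneg_left ?_ (ringRate_pos lam).le
  unfold activeCount
  rw [heq]
  exact_mod_cast activeAt_mono lam (b x) (ha u hu.1 hu.2.le) _

/-- Induction over the sites, starting where `L` vanishes: more rings at one site mean more arrivals
at the next. -/
theorem mono_initial (h : IsFlow lam e b c L) (h' : IsFlow lam e b c' L')
    (he : ∀ x, IsClock (e x)) (hc : ∀ x, c x ≤ c' x) (x : ℤ) {t : ℝ} (ht : 0 ≤ t) :
    L x t ≤ L' x t := by
  obtain ⟨x₀, hx₀⟩ := h.left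
  have hleft : ∀ x < x₀, ∀ t, 0 ≤ t → L x t ≤ L' x t := fun x hx t ht => by
    rw [hx₀ x hx t ht]
    exact h'.nonneg x ht
  rcases lt_or_ge x (x₀ - 1) with hx | hx
  · exact hleft x (by omega) t ht
  · revert t
    induction x, hx using Int.leInduction with
    | base => exact fun {t} ht => hleft _ (by omega) t ht
    | succ x _ ih =>
      intro t ht
      refine h.le_of_arrivals_le h' (T := t) (fun u hu _ => ?_) ht le_rfl
      unfold arrivals
      rw [add_sub_cancel_right]
      exact Nat.add_le_add (hc _) (jumps_mono _ ((he x).ringCount_mono (h.nonneg x hu) (ih hu)))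

/-- If the clock at `y` does not ring up to time `T`, what happens to the right of `y` does not
depend on the particles that start at `y` or to the left of it. -/
theorem eq_of_no_rings (h : IsFlow lam e b c L) (h' : IsFlow lam e b c' L') (he : ∀ x, IsClock (e x))
    {y z : ℤ} {T : ℝ} (hy : ringCount (e y) (L y T) = 0)
    (hy' : ringCount (e y) (L' y T) = 0)
    (hc : ∀ x, y < x → x ≤ z → c x = c' x) {x : ℤ} (hyx : y < x) (hxz : x ≤ z) :
    (∀ t, 0 ≤ t → t ≤ T → L x t = L' x t) ∧
      ∀ t, 0 ≤ t → t ≤ T → arrivals e b c L x t = arrivals e b c' L' x t := by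
  have key : ∀ x, y < x → x ≤ z →
      (∀ t, 0 ≤ t → t ≤ T → arrivals e b c L x t = arrivals e b c' L' x t) →
      ∀ t, 0 ≤ t → t ≤ T → L x t = L' x t := fun x _ _ ha t ht htT =>
    le_antisymm (h.le_of_arrivals_le h' (fun u hu huT => (ha u hu huT).le) ht htT)
      (h'.le_of_arrivals_le h (fun u hu huT => (ha u hu huT).ge) ht htT)
  suffices ∀ t, 0 ≤ t → t ≤ T → arrivals e b c L x t = arrivals e b c' L' x t from
    ⟨key x hyx hxz this, this⟩
  revert hxz
  induction x, (show y + 1 ≤ x by omega) using Int.leInduction with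
  | base =>
    intro hxz t ht htT
    unfold arrivals
    rw [add_sub_cancel_right, hc _ hyx hxz]
    have h1 := h.ringCount_mono he y ht htT
    have h2 := h'.ringCount_mono he y ht htT
    rw [hy] at h1
    rw [hy'] at h2
    rw [Nat.le_zero.1 h1, Nat.le_zero.1 h2]
  | succ x hx ih =>
    intro hxz t ht htT
    have hi := key x (by omega) (by omega) (ih (by omega) (by omega)) t ht htT
    unfold arrivals
    rw [add_sub_cancel_right, hi, hc _ hyx hxz]

/-- A site that receives at most `k` particles rings at most as often as is needed to stabilize
`k` particles. -/
theorem ringCount_le_settleRings (h : IsFlow lam e b c L) (he : ∀ x, IsClock (e x)) {x : ℤ}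
    (hb : JumpsOften (b x)) {k : ℕ} {T : ℝ} (hT : 0 ≤ T) (ha : arrivals e b c L x T ≤ k) :
    ringCount (e x) (L x T) ≤ settleRings lam (b x) k := by
  -- The internal time cannot pass the instant of the stabilizing ring: once there, the site has no
  -- active particle and its clock stands still.
  have hle : L x T ≤ clockSum (e x) (settleRings lam (b x) k) := by
    refine le_of_right_slopes (a := 0) (b := T) (g := fun _ => clockSum (e x) _)
      (q := fun _ => 0) (h.contOn x le_rfl) continuousOn_const
      (fun u hu => h.slope x u hu.1) (fun u _ => ⟨1, one_pos, fun _ _ => by simp⟩) ?_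
      (fun u hu heq => ?_) T ⟨hT, le_rfl⟩
    · rw [h.zero, ← clockSum_zero (e x)]
      exact (he x).strictMono.monotone (Nat.zero_le _)
    · have hr : ringCount (e x) (L x u) = settleRings lam (b x) k :=
        (he x).ringCount_eq heq.ge (heq.trans_lt ((he x).strictMono (Nat.lt_succ_self _)))
      have h0 : activeCount lam e b c L x u = 0 := by
        unfold activeCount
        rw [hr]
        have := activeAt_mono lam (b x) ((h.arrivals_mono he x hu.1 hu.2.le).trans ha)
          (settleRings lam (b x) k)
        rw [activeAt_settleRings hb] at this
        exact Nat.le_zero.1 this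
      rw [h0]
      simp
  have := (he x).ringCount_mono (h.nonneg x hT) hle
  rwa [(he x).ringCount_eq le_rfl ((he x).strictMono (Nat.lt_succ_self _))] at this

/-- The internal time runs at most at the speed given by the total number of arrivals. -/
theorem le_add_of_arrivals_le (h : IsFlow lam e b c L) (he : ∀ x, IsClock (e x)) {x : ℤ} {k : ℕ}
    {s t : ℝ} (hs : 0 ≤ s) (hst : s ≤ t) (ha : arrivals e b c L x t ≤ k) :
    L x t ≤ L x s + ringRate lam * k * (t - s) := by
  refine le_of_right_slopes (a := s) (b := t)
      (g := fun u => L x s + ringRate lam * k * (u - s)) (q := fun _ => ringRate lam * k)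
      (h.contOn x hs) (by fun_prop)
      (fun u hu => h.slope x u (hs.trans hu.1)) (fun u _ => ⟨1, one_pos, fun v _ => by ring⟩)
      (by simp) (fun u hu _ => ?_) t ⟨hst, le_rfl⟩
  refine mul_le_mul_of_nonneg_left ?_ (ringRate_pos lam).le
  exact_mod_cast (activeAt_le_arrivals _ _ _ _).trans
    ((h.arrivals_mono he x (hs.trans hu.1) hu.2.le).trans ha)

/-- A site at which `k` particles have arrived by time `t₀` will be stabilized. -/
theorem exists_settleRings_le (h : IsFlow lam e b c L) (he : ∀ x, IsClock (e x)) {x : ℤ}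
    {k : ℕ} {t₀ : ℝ} (ht₀ : 0 ≤ t₀) (ha : k ≤ arrivals e b c L x t₀) :
    ∃ t, t₀ ≤ t ∧ settleRings lam (b x) k ≤ ringCount (e x) (L x t) := by
  by_contra! hcon
  set m := settleRings lam (b x) k with hm
  have hρ := ringRate_pos lam
  have hS : 0 ≤ clockSum (e x) m := by
    rw [← clockSum_zero (e x)]
    exact (he x).strictMono.monotone (Nat.zero_le _)
  -- With fewer than `m` rings some particle is active, so the clock runs at speed at least
  -- `ringRate lam` and reaches its `m`-th ring within this time.
  set t := t₀ + clockSum (e x) m / ringRate lam with ht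
  have htt : t₀ ≤ t := by
    have : 0 ≤ clockSum (e x) m / ringRate lam := by positivity
    linarith
  have hle : ringRate lam * (t - t₀) ≤ L x t := by
    refine le_of_right_slopes (a := t₀) (b := t)
      (f := fun u => ringRate lam * (u - t₀)) (p := fun _ => ringRate lam)
      (by fun_prop) (h.contOn x ht₀) (fun u _ => ⟨1, one_pos, fun v _ => by ring⟩)
      (fun u hu => h.slope x u (ht₀.trans hu.1)) (by simpa using h.nonneg x ht₀)
      (fun u hu _ => ?_) t ⟨htt, le_rfl⟩
    refine le_mul_of_one_le_right hρ.le ?_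
    have h1 := activeAt_pos_of_lt (hcon u hu.1)
    have h2 := activeAt_mono lam (b x) (ha.trans (h.arrivals_mono he x ht₀ hu.1))
      (ringCount (e x) (L x u))
    exact_mod_cast h1.trans_le h2
  have h1 : ringRate lam * (t - t₀) = clockSum (e x) m := by
    rw [ht]
    field_simp
    ring
  rw [h1] at hle
  exact absurd (hcon t htt) (not_lt.2 (((he x).le_ringCount_iff (h.nonneg x (ht₀.trans htt))).2 hle))

end IsFlow

/-! ### The finite systems are flows -/

/-- The waiting times of the clock at `x`. -/
def clocks (ω : Noise) (x : ℤ) (j : ℕ) : ℝ := ω.2.1 (x, j)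

/-- The instructions at `x`. -/
def instr (ω : Noise) (x : ℤ) (j : ℕ) : Bool := ω.2.2 (x, j)

/-- The initial numbers of particles of the system with the particles that start in `V`. -/
def start (ω : Noise) (V : Finset ℤ) (x : ℤ) : ℕ := if x ∈ V then ω.1 x else 0

/-- The almost sure properties of the noise that make the finite systems well behaved. -/
structure IsGeneric (ω : Noise) : Prop where
  clock : ∀ x, IsClock (clocks ω x)
  linearIndependent : LinearIndependent ℚ ω.2.1
  exists_long : ∀ (M : ℝ) (x : ℤ), ∃ y ≥ x, M < clocks ω y 0
  jumpsOften : ∀ x, JumpsOften (instr ω x)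

/-- A number of arrivals `a` and a number of rings `r` that are possible at a site: rings only
take place when there is an active particle. -/
def Legal (b : ℕ → Bool) (a r : ℕ) : Prop :=
  jumps b r ≤ a ∧ (0 < r → b (r - 1) = false → jumps b r < a)

/-! ### The updates of one site agree with `siteState` -/

section SiteState

variable {lam : ℝ≥0∞} {b : ℕ → Bool} {a r : ℕ}

theorem siteState_eq_active (h : 0 < activeAt lam b a r) :
    siteState lam b a r = .active (a - jumps b r) := by
  unfold activeAt at h
  unfold siteState at h ⊢
  split_ifs at h ⊢ with h'
  · simp [SiteState.numActive] at h
  · rfl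

theorem jumps_lt_of_activeAt_pos (h : 0 < activeAt lam b a r) : jumps b r < a := by
  have := activeAt_le lam b a r
  omega

theorem Legal.ring (_ : Legal b a r) (ha : 0 < activeAt lam b a r) : Legal b a (r + 1) := by
  have := jumps_lt_of_activeAt_pos ha
  unfold Legal
  rw [jumps_succ, Nat.add_sub_cancel]
  split_ifs with hb
  · exact ⟨this, fun _ h => by simp [hb] at h⟩
  · exact ⟨this.le, fun _ _ => this⟩

theorem Legal.mono (h : Legal b a r) {a' : ℕ} (ha : a ≤ a') : Legal b a' r :=
  ⟨h.1.trans ha, fun h1 h2 => (h.2 h1 h2).trans_le ha⟩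

theorem Legal.eq_zero (h : Legal b 0 r) : r = 0 := by
  by_contra hr
  have h0 : jumps b r = 0 := Nat.le_zero.1 h.1
  have hlast : b (r - 1) = false := by
    by_contra hb
    have := jumps_succ b (r - 1)
    rw [Nat.sub_add_cancel (Nat.pos_of_ne_zero hr), h0, if_pos (by simpa using hb)] at this
    omega
  exact absurd (h.2 (Nat.pos_of_ne_zero hr) hlast) (by omega)

theorem siteState_jump (ha : 0 < activeAt lam b a r) (hb : b r = true) :
    siteState lam b a (r + 1) = settle lam (siteState lam b a r).removeParticle := by
  rw [siteState_eq_active ha]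
  have hlt := jumps_lt_of_activeAt_pos ha
  have hj : jumps b (r + 1) = jumps b r + 1 := by rw [jumps_succ, if_pos hb]
  obtain ⟨n, hn⟩ : ∃ n, a = jumps b r + 1 + n := ⟨a - (jumps b r + 1), by omega⟩
  have h1 : a - jumps b r = n + 1 := by omega
  have h2 : a - jumps b (r + 1) = n := by omega
  unfold siteState settle
  rw [h1, h2]
  rcases eq_or_ne lam ⊤ with hl | hl
  · simp only [hl, true_or, and_true, if_true, SiteState.removeParticle, Nat.add_sub_cancel]
    split_ifs with h
    · rw [h]
      rfl
    · unfold SiteState.trySleep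
      split
      · rename_i heq
        exact absurd (by simpa using heq) h
      · rfl
  · simp [hl, hb, SiteState.removeParticle]

theorem siteState_sleep (ha : 0 < activeAt lam b a r) (hb : b r = false) :
    siteState lam b a (r + 1) = (siteState lam b a r).trySleep := by
  rw [siteState_eq_active ha]
  have hj : jumps b (r + 1) = jumps b r := by rw [jumps_succ, hb]; simp
  unfold siteState
  rw [hj]
  by_cases h : a - jumps b r = 1
  · simp [h, hb, SiteState.trySleep]
  · rw [if_neg (fun h' => h h'.1)]
    unfold SiteState.trySleep
    split
    · rename_i heq
      exact absurd (by simpa using heq) h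
    · rfl

/-- `Legal` excludes an empty site whose last instruction was a sleep attempt; there, for finite
`lam`, the closed form would put the arriving particle to sleep at once. -/
theorem siteState_arrive (h : Legal b a r) :
    siteState lam b (a + 1) r = settle lam (siteState lam b a r).addParticle := by
  obtain ⟨n, hn⟩ : ∃ n, a = jumps b r + n := ⟨a - jumps b r, by have := h.1; omega⟩
  have h1 : a - jumps b r = n := by omega
  have h2 : a + 1 - jumps b r = n + 1 := by omega
  unfold siteState settle
  rw [h1, h2]
  rcases n with _ | n
  · have h3 : ¬ (0 < r ∧ b (r - 1) = false) := fun h' => by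
      have := h.2 h'.1 h'.2
      omega
    rcases eq_or_ne lam ⊤ with hl | hl <;>
      simp [hl, h3, SiteState.addParticle, SiteState.trySleep]
  · split_ifs <;> simp_all [SiteState.addParticle, SiteState.trySleep]

theorem siteState_zero_rings (n : ℕ) : siteState lam b n 0 = settle lam (.active n) := by
  unfold siteState settle
  rw [jumps_zero]
  rcases eq_or_ne lam ⊤ with hl | hl
  · by_cases h : n = 1
    · simp [hl, h, SiteState.trySleep]
    · simp only [hl, Nat.sub_zero, h, false_and, if_false, if_true]
      unfold SiteState.trySleep
      split
      · rename_i heq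
        exact absurd (by simpa using heq) h
      · rfl
  · simp [hl]

/-- Makes departures visible: a site in a constant state has emitted nothing. This is how unbounded
outflow contradicts fixation. -/
theorem settle_removeParticle_ne {s : SiteState} (h : 0 < s.numActive) :
    settle lam s.removeParticle ≠ s := by
  rcases s with n | _
  · simp only [SiteState.numActive] at h
    unfold settle SiteState.removeParticle SiteState.trySleep
    split_ifs
    · split
      · simp
      · simp only [ne_eq, SiteState.active.injEq]
        omega
    · simp only [ne_eq, SiteState.active.injEq]
      omega
  · simp [SiteState.numActive] at h

end SiteState

/-! ### Invariants of the finite systems -/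

namespace Snapshot

/-- The internal time of the clock at `x`. -/
noncomputable def clock (ω : Noise) (s : Snapshot) (x : ℤ) : ℝ :=
  clockSum (clocks ω x) (s.rings x + 1) - s.residual x

/-- The number of arrivals at `x` before a snapshot, including the particles that start there. -/
def arrived (ω : Noise) (V : Finset ℤ) (s : Snapshot) (x : ℤ) : ℕ :=
  start ω V x + jumps (instr ω (x - 1)) (s.rings (x - 1))

/-- The invariants of the snapshots of the system that starts in `V`. -/
structure Reachable (lam : ℝ≥0∞) (ω : Noise) (V : Finset ℤ) (s : Snapshot) : Prop where
  config : ∀ x, s.config x = siteState lam (instr ω x) (s.arrived ω V x) (s.rings x)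
  legal : ∀ x, Legal (instr ω x) (s.arrived ω V x) (s.rings x)
  residual_pos : ∀ x, 0 < s.residual x
  residual_le : ∀ x, s.residual x ≤ clocks ω x (s.rings x)
  generic : ∀ x, clocks ω x (s.rings x) - s.residual x ∈
    Submodule.span ℚ (ω.2.1 '' {p | p.2 < s.rings p.1})
  finite : {x | 0 < (s.config x).numActive}.Finite
  left : ∀ x, (∀ v ∈ V, x < v) → s.rings x = 0

theorem Reachable.congr {lam : ℝ≥0∞} {ω : Noise} {V : Finset ℤ} {s : Snapshot}
    (h : s.Reachable lam ω V) (t : ℝ≥0∞) : Reachable lam ω V { s with time := t } :=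
  ⟨h.config, h.legal, h.residual_pos, h.residual_le, h.generic, h.finite, h.left⟩

variable {lam : ℝ≥0∞} {ω : Noise} {V : Finset ℤ} {s : Snapshot}

theorem reachable_initial (hω : IsGeneric ω) : Reachable lam ω V (initial lam ω V) where
  config x := by
    simp only [initial, arrived, start, jumps_zero, add_zero]
    split_ifs
    · exact (siteState_zero_rings _).symm
    · rw [siteState_zero_rings]
      unfold settle
      split_ifs <;> rfl
  legal x := ⟨by simp [initial, jumps_zero], fun h => by simp [initial] at h⟩
  residual_pos x := (hω.clock x).pos 0
  residual_le x := le_rfl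
  generic x := by simp [initial, clocks]
  finite := V.finite_toSet.subset fun x hx => by
    by_contra h
    have h : x ∉ V := h
    simp [initial, h, SiteState.numActive] at hx
  left x _ := rfl

theorem Reachable.numActive (h : s.Reachable lam ω V) (x : ℤ) :
    (s.config x).numActive = activeAt lam (instr ω x) (s.arrived ω V x) (s.rings x) := by
  rw [h.config, activeAt]

theorem rate_mul_wait (hx : 0 < (s.config x).numActive) :
    ringRate lam * (s.config x).numActive * s.wait lam x = s.residual x := by
  have h1 := ringRate_pos lam
  have h2 : (0 : ℝ) < (s.config x).numActive := by exact_mod_cast hx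
  unfold wait
  field_simp

theorem Reachable.wait_pos (h : s.Reachable lam ω V) (hx : 0 < (s.config x).numActive) :
    0 < s.wait lam x := by
  have h1 := ringRate_pos lam
  have h2 : (0 : ℝ) < (s.config x).numActive := by exact_mod_cast hx
  exact div_pos (h.residual_pos x) (mul_pos h1 h2)

theorem rings_ringAt (x y : ℤ) :
    (s.ringAt lam ω x).rings y = s.rings y + if y = x then 1 else 0 := by
  simp only [ringAt, Function.update_apply]
  split_ifs with h
  · rw [h]
  · rfl

theorem arrived_ringAt (x y : ℤ) :
    (s.ringAt lam ω x).arrived ω V y = s.arrived ω V y +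
      if y = x + 1 ∧ instr ω x (s.rings x) = true then 1 else 0 := by
  unfold arrived
  rw [rings_ringAt]
  by_cases h : y = x + 1
  · subst h
    simp only [add_sub_cancel_right, if_true, true_and, jumps_succ, add_assoc]
  · have : y - 1 ≠ x := fun h' => h (by omega)
    simp [h, this]

theorem Reachable.residual_le_of_isNext (h : s.Reachable lam ω V) {x : ℤ} (hx : s.IsNext lam x)
    (y : ℤ) : ringRate lam * (s.config y).numActive * s.wait lam x ≤ s.residual y := by
  rcases Nat.eq_zero_or_pos (s.config y).numActive with h0 | h0
  · rw [h0]
    simpa using (h.residual_pos y).le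
  · rw [← rate_mul_wait (lam := lam) h0]
    exact mul_le_mul_of_nonneg_left (hx.2 y h0)
      (mul_nonneg (ringRate_pos lam).le (Nat.cast_nonneg _))

theorem config_ringAt_self (h : s.Reachable lam ω V) {x : ℤ} (hx : 0 < (s.config x).numActive) :
    (s.ringAt lam ω x).config x =
      siteState lam (instr ω x) (s.arrived ω V x) (s.rings x + 1) := by
  have ha := hx
  rw [h.numActive] at ha
  simp only [ringAt, topple]
  rcases hb : ω.2.2 (x, s.rings x)
  · simp only [if_true]
    rw [siteState_sleep ha hb, h.config]
  · simp only [if_true]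
    rw [siteState_jump ha hb, h.config]

/-- Up to the next ring, internal times advance in the ratios of the numbers of active particles,
which are rational. So the elapsed part of each current waiting time stays a rational combination of
waiting times already used up. -/
theorem Reachable.generic_ringAt (h : s.Reachable lam ω V) {x : ℤ} (hx : s.IsNext lam x)
    (y : ℤ) :
    clocks ω y (s.rings y) - (s.residual y - ringRate lam * (s.config y).numActive * s.wait lam x) ∈
      Submodule.span ℚ (ω.2.1 '' {p | p.2 < (s.ringAt lam ω x).rings p.1}) := by
  have hle : Submodule.span ℚ (ω.2.1 '' {p | p.2 < s.rings p.1}) ≤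
      Submodule.span ℚ (ω.2.1 '' {p | p.2 < (s.ringAt lam ω x).rings p.1}) := by
    refine Submodule.span_mono (Set.image_mono fun p hp => ?_)
    have hp : p.2 < s.rings p.1 := hp
    change p.2 < _
    rw [rings_ringAt]
    omega
  have hx1 : clocks ω x (s.rings x) ∈
      Submodule.span ℚ (ω.2.1 '' {p | p.2 < (s.ringAt lam ω x).rings p.1}) := by
    refine Submodule.subset_span ⟨(x, s.rings x), ?_, rfl⟩
    change s.rings x < _
    rw [rings_ringAt]
    simp
  have hres : s.residual x ∈
      Submodule.span ℚ (ω.2.1 '' {p | p.2 < (s.ringAt lam ω x).rings p.1}) := by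
    have := Submodule.sub_mem _ hx1 (hle (h.generic x))
    rwa [sub_sub_cancel] at this
  have hn : (0 : ℝ) < (s.config x).numActive := by exact_mod_cast hx.1
  have heq : ringRate lam * (s.config y).numActive * s.wait lam x =
      (((s.config y).numActive : ℚ) / (s.config x).numActive) • s.residual x := by
    rw [← rate_mul_wait (lam := lam) hx.1, Rat.smul_def]
    push_cast
    field_simp
  have := Submodule.add_mem _ (hle (h.generic y))
    (Submodule.smul_mem _ (((s.config y).numActive : ℚ) / (s.config x).numActive) hres)
  rw [← heq] at this
  convert this using 1
  ring

theorem Reachable.ringAt (hω : IsGeneric ω) (h : s.Reachable lam ω V) {x : ℤ}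
    (hx : s.IsNext lam x) : Reachable lam ω V (s.ringAt lam ω x) where
  config y := by
    by_cases hyx : y = x
    · subst hyx
      rw [config_ringAt_self h hx.1, arrived_ringAt, rings_ringAt]
      simp
    · rw [arrived_ringAt, rings_ringAt, if_neg hyx]
      simp only [Snapshot.ringAt, topple, instr]
      rcases Bool.eq_false_or_eq_true (ω.2.2 (x, s.rings x)) with hb | hb
      · by_cases hy : y = x + 1
        · subst hy
          simp only [hb, hyx, if_false, add_zero, and_true, if_true, h.config]
          exact (siteState_arrive (h.legal (x + 1))).symm
        · simp only [hb, hyx, hy, if_false, add_zero, and_true, h.config]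
      · simp only [hb, hyx, if_false, add_zero, h.config, reduceCtorEq, and_false]
  legal y := by
    have h1 : Legal (instr ω y) (s.arrived ω V y) ((s.ringAt lam ω x).rings y) := by
      rw [rings_ringAt]
      split_ifs with hyx
      · subst hyx
        have ha := hx.1
        rw [h.numActive] at ha
        exact (h.legal y).ring ha
      · exact h.legal y
    refine h1.mono ?_
    rw [arrived_ringAt]
    omega
  residual_pos y := by
    by_cases hyx : y = x
    · subst hyx
      simp only [Snapshot.ringAt, Function.update_self]
      exact (hω.clock y).pos _
    · have hgen := h.generic_ringAt hx y
      have hr : (s.ringAt lam ω x).rings y = s.rings y := by simp [rings_ringAt, hyx]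
      simp only [Snapshot.ringAt, Function.update_of_ne hyx]
      -- A zero residual would be a ring at `y` simultaneous with that at `x`; the waiting time in
      -- progress at `y` would lie in the rational span of those used up.
      refine lt_of_le_of_ne (sub_nonneg.2 (h.residual_le_of_isNext hx y)) fun h0 => ?_
      rw [← h0, sub_zero] at hgen
      refine hω.linearIndependent.notMem_span_image ?_ hgen
      change ¬ (s.rings y < _)
      simp [hr]
  residual_le y := by
    by_cases hyx : y = x
    · subst hyx
      rw [rings_ringAt]
      simp [Snapshot.ringAt, clocks]
    · rw [rings_ringAt, if_neg hyx]
      simp only [Snapshot.ringAt, Function.update_of_ne hyx, add_zero]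
      have h1 := h.residual_le y
      have h2 : 0 ≤ ringRate lam * (s.config y).numActive * s.wait lam x :=
        mul_nonneg (mul_nonneg (ringRate_pos lam).le (Nat.cast_nonneg _)) (h.wait_pos hx.1).le
      linarith
  generic y := by
    by_cases hyx : y = x
    · subst hyx
      rw [rings_ringAt]
      simp [Snapshot.ringAt, clocks]
    · have hr : (s.ringAt lam ω x).rings y = s.rings y := by simp [rings_ringAt, hyx]
      have := h.generic_ringAt hx y
      rw [hr]
      simpa only [Snapshot.ringAt, Function.update_of_ne hyx] using this
  finite := by
    refine (h.finite.union (Set.toFinite {x, x + 1})).subset fun y hy => ?_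
    by_cases h1 : y = x ∨ y = x + 1
    · exact Or.inr (by simpa using h1)
    · left
      push Not at h1
      have hc : (s.ringAt lam ω x).config y = s.config y := by
        simp only [Snapshot.ringAt, topple, h1.1, h1.2, if_false]
        split <;> rfl
      change 0 < ((s.ringAt lam ω x).config y).numActive at hy
      rwa [hc] at hy
  left y hy := by
    rw [rings_ringAt]
    have h0 := h.left y hy
    have hyx : y ≠ x := fun hyx => by
      subst hyx
      have ha := hx.1
      rw [h.numActive] at ha
      have h1 := activeAt_le_arrivals lam (instr ω y) (s.arrived ω V y) (s.rings y)
      have h2 : s.arrived ω V y = 0 := by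
        unfold arrived start
        rw [if_neg fun hv => lt_irrefl _ (hy y hv), h.left (y - 1) fun v hv => by
          have := hy v hv
          omega, jumps_zero]
      omega
    simp [h0, hyx]

theorem Reachable.next_cases (h : s.Reachable lam ω V) :
    (∃ x, s.IsNext lam x ∧ s.next lam ω = s.ringAt lam ω x) ∨
      ((∀ x, (s.config x).numActive = 0) ∧ s.next lam ω = { s with time := ⊤ }) := by
  unfold next
  split_ifs with hex
  · exact Or.inl ⟨_, hex.choose_spec, rfl⟩
  · refine Or.inr ⟨fun x => ?_, rfl⟩
    by_contra hx
    obtain ⟨y, hy, hmin⟩ := Set.exists_min_image _ (fun y => s.wait lam y) h.finite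
      ⟨x, Nat.pos_of_ne_zero hx⟩
    exact hex ⟨y, hy, hmin⟩

theorem clock_ringAt {x : ℤ} (hx : s.IsNext lam x) (y : ℤ) :
    (s.ringAt lam ω x).clock ω y =
      s.clock ω y + ringRate lam * (s.config y).numActive * s.wait lam x := by
  unfold clock
  rw [rings_ringAt]
  by_cases hyx : y = x
  · subst hyx
    rw [rate_mul_wait hx.1, if_pos rfl, clockSum_succ _ (s.rings y + 1)]
    simp [ringAt, clocks]
  · simp only [hyx, if_false, add_zero, ringAt, Function.update_of_ne hyx]
    ring

theorem Reachable.clockSum_le_clock (h : s.Reachable lam ω V) (x : ℤ) :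
    clockSum (clocks ω x) (s.rings x) ≤ s.clock ω x := by
  unfold clock
  rw [clockSum_succ]
  linarith [h.residual_le x]

/-- The number of arrivals at a site is at most the total number of particles. -/
theorem Reachable.arrived_le (h : s.Reachable lam ω V) (x : ℤ) :
    s.arrived ω V x ≤ ∑ v ∈ V, ω.1 v := by
  obtain ⟨x₀, hx₀⟩ : ∃ x₀, ∀ v ∈ V, x₀ < v := by
    obtain ⟨m, hm⟩ := V.bddBelow
    exact ⟨m - 1, fun v hv => by have := hm hv; omega⟩
  have h0 : ∀ x ≤ x₀, s.arrived ω V x = 0 := fun x hx => by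
    unfold arrived start
    rw [if_neg fun hv => by have := hx₀ x hv; omega,
      h.left (x - 1) fun v hv => by have := hx₀ v hv; omega, jumps_zero]
  rcases le_total x x₀ with hx | hx
  · rw [h0 x hx]
    exact Nat.zero_le _
  · have : s.arrived ω V x ≤ ∑ v ∈ V, if v ≤ x then ω.1 v else 0 := by
      induction x, hx using Int.leInduction with
      | base => rw [h0 _ le_rfl]; exact Nat.zero_le _
      | succ x _ ih =>
        have h1 : ∀ v, (if v ≤ x + 1 then ω.1 v else 0) =
            (if v ≤ x then ω.1 v else 0) + if x + 1 = v then ω.1 v else 0 := fun v => by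
          rcases lt_trichotomy v (x + 1) with hv | hv | hv
          · rw [if_pos hv.le, if_pos (by omega), if_neg hv.ne', add_zero]
          · subst hv
            simp
          · rw [if_neg (by omega), if_neg (by omega), if_neg hv.ne]
        simp_rw [h1]
        rw [Finset.sum_add_distrib, Finset.sum_ite_eq, add_comm (Finset.sum _ _)]
        unfold arrived start
        rw [add_sub_cancel_right]
        exact Nat.add_le_add_left ((h.legal x).1.trans ih) _
    refine this.trans (Finset.sum_le_sum fun v _ => ?_)
    split_ifs
    · exact le_rfl
    · exact Nat.zero_le _

theorem Reachable.numActive_le (h : s.Reachable lam ω V) (x : ℤ) :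
    (s.config x).numActive ≤ ∑ v ∈ V, ω.1 v := by
  rw [h.numActive]
  exact (activeAt_le_arrivals _ _ _ _).trans (h.arrived_le x)

end Snapshot

/-! ### The finite systems do not explode and are flows -/

section Trajectory

variable {lam : ℝ≥0∞} {ω : Noise} {V : Finset ℤ}

theorem snapshot_succ (lam : ℝ≥0∞) (ω : Noise) (V : Finset ℤ) (k : ℕ) :
    snapshot lam ω V (k + 1) = (snapshot lam ω V k).next lam ω :=
  Function.iterate_succ_apply' _ _ _

theorem reachable_snapshot (hω : IsGeneric ω) (lam : ℝ≥0∞) (V : Finset ℤ) (k : ℕ) :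
    (snapshot lam ω V k).Reachable lam ω V := by
  induction k with
  | zero => exact Snapshot.reachable_initial hω
  | succ k ih =>
    rw [snapshot_succ]
    rcases ih.next_cases with ⟨x, hx, h⟩ | ⟨_, h⟩
    · rw [h]
      exact ih.ringAt hω hx
    · rw [h]
      exact ih.congr _

theorem time_lt_succ (hω : IsGeneric ω) {k : ℕ} (hk : (snapshot lam ω V k).time ≠ ⊤) :
    (snapshot lam ω V k).time < (snapshot lam ω V (k + 1)).time := by
  have hr := reachable_snapshot hω lam V k
  rw [snapshot_succ]
  rcases hr.next_cases with ⟨x, hx, h⟩ | ⟨_, h⟩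
  · rw [h]
    exact ENNReal.lt_add_right hk (ENNReal.ofReal_pos.2 (hr.wait_pos hx.1)).ne'
  · rw [h]
    exact hk.lt_top

theorem time_mono (hω : IsGeneric ω) : Monotone fun k => (snapshot lam ω V k).time :=
  monotone_nat_of_le_succ fun k => by
    by_cases hk : (snapshot lam ω V k).time = ⊤
    · rcases (reachable_snapshot hω lam V k).next_cases with ⟨x, _, h⟩ | ⟨_, h⟩
      · rw [snapshot_succ, h]
        exact le_self_add
      · rw [snapshot_succ, h]
        exact le_top
    · exact (time_lt_succ hω hk).le

/-- No site ever has more active particles than the whole system has particles, which bounds the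
speed of every clock. -/
theorem clock_le (hω : IsGeneric ω) {k : ℕ} (hk : (snapshot lam ω V k).time ≠ ⊤) (x : ℤ) :
    (snapshot lam ω V k).clock ω x ≤
      ringRate lam * (∑ v ∈ V, ω.1 v : ℕ) * (snapshot lam ω V k).time.toReal := by
  induction k with
  | zero => simp [snapshot, initial, Snapshot.clock, clockSum, clocks]
  | succ k ih =>
    have hk' : (snapshot lam ω V k).time ≠ ⊤ :=
      ne_top_of_le_ne_top hk (time_mono hω k.le_succ)
    have hr := reachable_snapshot hω lam V k
    rw [snapshot_succ] at hk ⊢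
    rcases hr.next_cases with ⟨y, hy, h⟩ | ⟨_, h⟩
    · rw [h, Snapshot.clock_ringAt hy]
      have h1 : ((snapshot lam ω V k).ringAt lam ω y).time.toReal =
          (snapshot lam ω V k).time.toReal + (snapshot lam ω V k).wait lam y := by
        simp only [Snapshot.ringAt]
        rw [ENNReal.toReal_add hk' ENNReal.ofReal_ne_top,
          ENNReal.toReal_ofReal (hr.wait_pos hy.1).le]
      rw [h1, mul_add]
      refine add_le_add (ih hk') (mul_le_mul_of_nonneg_right ?_ (hr.wait_pos hy.1).le)
      exact mul_le_mul_of_nonneg_left (by exact_mod_cast hr.numActive_le x) (ringRate_pos lam).le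
    · rw [h] at hk
      exact absurd rfl hk

/-- If all ring times were at most `T`, all internal times would be at most `M`. Some site `y`
beyond the particles has a first waiting time above `M`, so nothing passes it, and nothing happens
to the left of the particles. The finitely many sites in between ring boundedly often, although `k`
rings occur in total for every `k`. -/
theorem exists_time_gt (hω : IsGeneric ω) (T : ℝ≥0) : ∃ k, T < (snapshot lam ω V k).time := by
  by_contra! hT
  have hfin : ∀ k, (snapshot lam ω V k).time ≠ ⊤ := fun k =>
    ne_top_of_le_ne_top ENNReal.coe_ne_top (hT k)
  set M : ℝ := ringRate lam * (∑ v ∈ V, ω.1 v : ℕ) * T with hM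
  have hclock : ∀ k x, (snapshot lam ω V k).clock ω x ≤ M := fun k x => by
    refine (clock_le hω (hfin k) x).trans (mul_le_mul_of_nonneg_left ?_
      (mul_nonneg (ringRate_pos lam).le (Nat.cast_nonneg _)))
    exact ENNReal.toReal_le_of_le_ofReal T.2 (by simpa using hT k)
  have hrings : ∀ k x, clockSum (clocks ω x) ((snapshot lam ω V k).rings x) ≤ M := fun k x =>
    ((reachable_snapshot hω lam V k).clockSum_le_clock x).trans (hclock k x)
  obtain ⟨x₀, hx₀⟩ : ∃ x₀, ∀ v ∈ V, x₀ < v := by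
    obtain ⟨m, hm⟩ := V.bddBelow
    exact ⟨m - 1, fun v hv => by have := hm hv; omega⟩
  obtain ⟨x₁, hx₁⟩ := V.bddAbove
  obtain ⟨y, hy, hMy⟩ := hω.exists_long M (max x₀ x₁)
  have hright : ∀ k, ∀ z ≥ y, (snapshot lam ω V k).rings z = 0 := fun k z hz => by
    induction z, hz using Int.leInduction with
    | base =>
      by_contra h0
      have h1 := (hω.clock y).strictMono.monotone (Nat.one_le_iff_ne_zero.2 h0)
      have h2 := hrings k y
      have h3 : clockSum (clocks ω y) 1 = clocks ω y 0 := by simp [clockSum]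
      linarith
    | succ z hz ih =>
      have hr := reachable_snapshot hω lam V k
      have h0 : (snapshot lam ω V k).arrived ω V (z + 1) = 0 := by
        unfold Snapshot.arrived start
        rw [add_sub_cancel_right, ih, jumps_zero, if_neg fun hv => by
          have := hx₁ hv
          omega]
      have := hr.legal (z + 1)
      rw [h0] at this
      exact this.eq_zero
  have hleft : ∀ k, ∀ z ≤ x₀, (snapshot lam ω V k).rings z = 0 := fun k z hz =>
    (reachable_snapshot hω lam V k).left z fun v hv => hz.trans_lt (hx₀ v hv)
  have htotal : ∀ k, ∑ z ∈ Finset.Ioo x₀ y, (snapshot lam ω V k).rings z = k := fun k => by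
    induction k with
    | zero => simp [snapshot, initial]
    | succ k ih =>
      rcases (reachable_snapshot hω lam V k).next_cases with ⟨x, hx, h⟩ | ⟨_, h⟩
      · have hstep : ∀ z, (snapshot lam ω V (k + 1)).rings z =
            (snapshot lam ω V k).rings z + if z = x then 1 else 0 := fun z => by
          rw [snapshot_succ, h, Snapshot.rings_ringAt]
        have hmem : x ∈ Finset.Ioo x₀ y := by
          rw [Finset.mem_Ioo]
          by_contra hcon
          have := hstep x
          rcases le_or_gt x x₀ with hle | hlt
          · rw [hleft _ x hle] at this
            simp at this
          · rw [hright _ x (by omega)] at this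
            simp at this
        simp_rw [hstep]
        rw [Finset.sum_add_distrib, ih, Finset.sum_ite_eq' _ x, if_pos hmem]
      · have := hfin (k + 1)
        rw [snapshot_succ, h] at this
        exact absurd rfl this
  choose B hB using fun x => (hω.clock x).unbounded M
  have hlt : ∀ k z, (snapshot lam ω V k).rings z ≤ B z := fun k z =>
    ((hω.clock z).strictMono.lt_iff_lt.1 ((hrings k z).trans_lt (hB z))).le
  have := htotal (∑ z ∈ Finset.Ioo x₀ y, B z + 1)
  have h2 := Finset.sum_le_sum fun z (_ : z ∈ Finset.Ioo x₀ y) =>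
    hlt (∑ z ∈ Finset.Ioo x₀ y, B z + 1) z
  omega

theorem numRings_eq (hω : IsGeneric ω) {t : ℝ≥0} {k : ℕ} (h₁ : (snapshot lam ω V k).time ≤ t)
    (h₂ : t < (snapshot lam ω V (k + 1)).time) : numRings lam ω V t = k := by
  have : {k | (snapshot lam ω V k).time ≤ t} = Set.Iic k := by
    ext j
    simp only [Set.mem_ofPred_eq, Set.mem_Iic]
    constructor
    · intro hj
      by_contra! hlt
      exact absurd (h₂.trans_le (time_mono hω (Nat.succ_le_of_lt hlt))) (not_lt.2 hj)
    · exact fun hj => (time_mono hω hj).trans h₁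
  rw [numRings, this, csSup_Iic]

theorem numRings_spec (hω : IsGeneric ω) (t : ℝ≥0) :
    (snapshot lam ω V (numRings lam ω V t)).time ≤ t ∧
      t < (snapshot lam ω V (numRings lam ω V t + 1)).time := by
  classical
  have hex := exists_time_gt (lam := lam) (V := V) hω t
  have h0 : Nat.find hex ≠ 0 := fun h => by
    have := Nat.find_spec hex
    rw [h] at this
    simp [snapshot, initial] at this
  obtain ⟨k, hk⟩ := Nat.exists_eq_succ_of_ne_zero h0
  have h1 : (snapshot lam ω V k).time ≤ t := not_lt.1 (Nat.find_min hex (by omega))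
  have h2 : t < (snapshot lam ω V (k + 1)).time := by
    have := Nat.find_spec hex
    rwa [hk] at this
  rw [numRings_eq hω h1 h2]
  exact ⟨h1, h2⟩

theorem time_numRings_ne_top (hω : IsGeneric ω) (t : ℝ≥0) :
    (snapshot lam ω V (numRings lam ω V t)).time ≠ ⊤ :=
  ne_top_of_le_ne_top ENNReal.coe_ne_top (numRings_spec hω t).1

/-- The internal time of the clock at `x` at time `t`, in the system that starts in `V`. -/
noncomputable def internalTime (lam : ℝ≥0∞) (ω : Noise) (V : Finset ℤ) (x : ℤ) (t : ℝ) : ℝ :=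
  let s := snapshot lam ω V (numRings lam ω V t.toNNReal)
  s.clock ω x + ringRate lam * (s.config x).numActive * (t - s.time.toReal)

theorem internalTime_eq (hω : IsGeneric ω) {t : ℝ} {k : ℕ}
    (h₁ : (snapshot lam ω V k).time ≤ ENNReal.ofReal t)
    (h₂ : ENNReal.ofReal t < (snapshot lam ω V (k + 1)).time) (x : ℤ) :
    internalTime lam ω V x t = (snapshot lam ω V k).clock ω x +
      ringRate lam * ((snapshot lam ω V k).config x).numActive *
        (t - (snapshot lam ω V k).time.toReal) := by
  unfold internalTime
  rw [numRings_eq hω (t := t.toNNReal) h₁ h₂]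

/-- The upper bound is strict because the next snapshot has not been reached yet. Together the
bounds let `ringCount` recover the number of rings from the internal time. -/
theorem internalTime_window (hω : IsGeneric ω) (t : ℝ≥0) (x : ℤ) :
    clockSum (clocks ω x) ((snapshot lam ω V (numRings lam ω V t)).rings x) ≤
        internalTime lam ω V x t ∧
      internalTime lam ω V x t <
        clockSum (clocks ω x) ((snapshot lam ω V (numRings lam ω V t)).rings x + 1) := by
  obtain ⟨h1, h2⟩ := numRings_spec (lam := lam) (V := V) hω t
  set k := numRings lam ω V t with hk
  have hr := reachable_snapshot hω lam V k
  have htop := time_numRings_ne_top (lam := lam) (V := V) hω t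
  rw [← hk] at htop
  rw [internalTime_eq (k := k) hω (t := (t : ℝ)) (by simpa using h1) (by simpa using h2)]
  have h1' : (snapshot lam ω V k).time.toReal ≤ t := by
    simpa using ENNReal.toReal_mono ENNReal.coe_ne_top h1
  have hρ := ringRate_pos lam
  have hn : (0 : ℝ) ≤ ((snapshot lam ω V k).config x).numActive := Nat.cast_nonneg _
  constructor
  · have := hr.clockSum_le_clock x
    have h3 := mul_nonneg (mul_nonneg hρ.le hn) (sub_nonneg.2 h1')
    linarith
  · suffices ringRate lam * ((snapshot lam ω V k).config x).numActive *
        (t - (snapshot lam ω V k).time.toReal) < (snapshot lam ω V k).residual x by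
      unfold Snapshot.clock
      linarith
    rcases Nat.eq_zero_or_pos ((snapshot lam ω V k).config x).numActive with h0 | h0
    · rw [h0]
      simpa using hr.residual_pos x
    rcases hr.next_cases with ⟨y, hy, h⟩ | ⟨h, _⟩
    · rw [snapshot_succ, h] at h2
      have h3 : (t : ℝ) < (snapshot lam ω V k).time.toReal + (snapshot lam ω V k).wait lam y := by
        have h4 : ((snapshot lam ω V k).ringAt lam ω y).time ≠ ⊤ :=
          ENNReal.add_ne_top.2 ⟨htop, ENNReal.ofReal_ne_top⟩
        have h5 := (ENNReal.toReal_lt_toReal ENNReal.coe_ne_top h4).2 h2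
        simp only [Snapshot.ringAt] at h5
        rwa [ENNReal.toReal_add htop ENNReal.ofReal_ne_top,
          ENNReal.toReal_ofReal (hr.wait_pos hy.1).le] at h5
      refine lt_of_lt_of_le ?_ (hr.residual_le_of_isNext hy x)
      have hn' : (0 : ℝ) < ((snapshot lam ω V k).config x).numActive := by exact_mod_cast h0
      exact mul_lt_mul_of_pos_left (by linarith) (mul_pos hρ hn')
    · exact absurd (h x) h0.ne'

theorem ringCount_internalTime (hω : IsGeneric ω) (t : ℝ≥0) (x : ℤ) :
    ringCount (clocks ω x) (internalTime lam ω V x t) =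
      (snapshot lam ω V (numRings lam ω V t)).rings x :=
  (hω.clock x).ringCount_eq (internalTime_window hω t x).1 (internalTime_window hω t x).2

theorem arrivals_internalTime (hω : IsGeneric ω) (t : ℝ≥0) (x : ℤ) :
    arrivals (clocks ω) (instr ω) (start ω V) (internalTime lam ω V) x t =
      (snapshot lam ω V (numRings lam ω V t)).arrived ω V x := by
  unfold arrivals Snapshot.arrived
  rw [ringCount_internalTime hω]

theorem finiteProcess_eq (hω : IsGeneric ω) (t : ℝ≥0) (x : ℤ) :
    finiteProcess lam ω V t x = siteState lam (instr ω x)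
      (arrivals (clocks ω) (instr ω) (start ω V) (internalTime lam ω V) x t)
      (ringCount (clocks ω x) (internalTime lam ω V x t)) := by
  rw [arrivals_internalTime hω, ringCount_internalTime hω]
  exact (reachable_snapshot hω lam V _).config x

theorem activeCount_internalTime (hω : IsGeneric ω) (t : ℝ≥0) (x : ℤ) :
    activeCount lam (clocks ω) (instr ω) (start ω V) (internalTime lam ω V) x t =
      ((snapshot lam ω V (numRings lam ω V t)).config x).numActive := by
  unfold activeCount activeAt
  rw [← finiteProcess_eq hω]
  rfl

/-- This gives left continuity. It needs an argument only at ring times, where the linear piece of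
the preceding snapshot must arrive at the value given by the new one; `Snapshot.clock_ringAt` says
that it does. -/
theorem internalTime_left (hω : IsGeneric ω) {t : ℝ} (ht : 0 < t) (x : ℤ) :
    ∃ s < t, ∃ A m : ℝ, ∀ u ∈ Set.Icc s t, internalTime lam ω V x u = A + m * (u - s) := by
  lift t to ℝ≥0 using ht.le
  obtain ⟨h1, h2⟩ := numRings_spec (lam := lam) (V := V) hω t
  set k := numRings lam ω V t with hk
  have hr := reachable_snapshot hω lam V k
  have htop : (snapshot lam ω V k).time ≠ ⊤ := time_numRings_ne_top (lam := lam) (V := V) hω t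
  rcases h1.lt_or_eq with hlt | heq
  · refine ⟨(snapshot lam ω V k).time.toReal, ?_, _, _, fun u hu => internalTime_eq (k := k) hω
      ?_ ?_ x⟩
    · simpa using (ENNReal.toReal_lt_toReal htop ENNReal.coe_ne_top).2 hlt
    · rw [ENNReal.le_ofReal_iff_toReal_le htop (ENNReal.toReal_nonneg.trans hu.1)]
      exact hu.1
    · refine lt_of_le_of_lt ?_ h2
      simpa using ENNReal.ofReal_le_ofReal hu.2
  · have hk0 : k ≠ 0 := fun h0 => by
      rw [h0] at heq
      have : (0 : ℝ≥0∞) = t := heq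
      have h3 : (t : ℝ) = 0 := by exact_mod_cast this.symm
      exact ht.ne' h3
    obtain ⟨j, hj⟩ := Nat.exists_eq_succ_of_ne_zero hk0
    have hrj := reachable_snapshot hω lam V j
    have htopj : (snapshot lam ω V j).time ≠ ⊤ :=
      ne_top_of_le_ne_top htop (time_mono hω (by omega))
    have hltj := time_lt_succ (lam := lam) (V := V) hω htopj
    have hsucc : snapshot lam ω V (j + 1) = snapshot lam ω V k := by rw [hj]
    have hts : (snapshot lam ω V k).time.toReal = t := by rw [heq]; simp
    refine ⟨(snapshot lam ω V j).time.toReal, ?_, (snapshot lam ω V j).clock ω x,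
      ringRate lam * ((snapshot lam ω V j).config x).numActive, fun u hu => ?_⟩
    · rw [hsucc] at hltj
      rw [← hts]
      exact (ENNReal.toReal_lt_toReal htopj htop).2 hltj
    · have hu0 : 0 ≤ u := ENNReal.toReal_nonneg.trans hu.1
      rcases hu.2.lt_or_eq with hut | hut
      · refine internalTime_eq hω ?_ ?_ x
        · rw [ENNReal.le_ofReal_iff_toReal_le htopj hu0]
          exact hu.1
        · rw [hsucc, heq, ← ENNReal.ofReal_coe_nnreal]
          exact (ENNReal.ofReal_lt_ofReal_iff ht).2 hut
      · subst hut
        rw [internalTime_eq (k := k) hω (by rw [heq]; simp) (by simpa using h2), hts, sub_self,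
          mul_zero, add_zero, ← hsucc, snapshot_succ]
        rcases hrj.next_cases with ⟨y, hy, h⟩ | ⟨_, h⟩
        · rw [h, Snapshot.clock_ringAt hy]
          have h5 : (t : ℝ) = (snapshot lam ω V j).time.toReal +
              (snapshot lam ω V j).wait lam y := by
            rw [← hts, ← hsucc, snapshot_succ, h]
            simp only [Snapshot.ringAt]
            rw [ENNReal.toReal_add htopj ENNReal.ofReal_ne_top,
              ENNReal.toReal_ofReal (hrj.wait_pos hy.1).le]
          rw [h5, add_sub_cancel_left]
        · rw [← hsucc, snapshot_succ, h] at htop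
          exact absurd rfl htop

theorem internalTime_slope (hω : IsGeneric ω) {t : ℝ} (ht : 0 ≤ t) (x : ℤ) :
    ∃ ε > 0, ∀ u ∈ Set.Icc t (t + ε), internalTime lam ω V x u = internalTime lam ω V x t +
      ringRate lam * activeCount lam (clocks ω) (instr ω) (start ω V)
        (internalTime lam ω V) x t * (u - t) := by
  lift t to ℝ≥0 using ht
  obtain ⟨h1, h2⟩ := numRings_spec (lam := lam) (V := V) hω t
  rw [activeCount_internalTime hω]
  set k := numRings lam ω V t with hk
  obtain ⟨ε, hε, hlt⟩ : ∃ ε > 0, ENNReal.ofReal (t + ε) < (snapshot lam ω V (k + 1)).time := by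
    obtain ⟨r, hr1, hr2⟩ := ENNReal.lt_iff_exists_nnreal_btwn.1 h2
    have hr1 : t < r := by exact_mod_cast hr1
    refine ⟨r - t, sub_pos.2 hr1, ?_⟩
    simpa using hr2
  refine ⟨ε, hε, fun u hu => ?_⟩
  have hu0 : 0 ≤ u := t.2.trans hu.1
  rw [internalTime_eq (k := k) hω (h1.trans (by simpa using ENNReal.ofReal_le_ofReal hu.1))
    ((ENNReal.ofReal_le_ofReal hu.2).trans_lt hlt),
    internalTime_eq (k := k) hω (t := (t : ℝ)) (by simpa using h1) (by simpa using h2)]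
  ring

/-- The bridge from the ring-by-ring definition to the comparison principles. -/
theorem isFlow_internalTime (hω : IsGeneric ω) :
    IsFlow lam (clocks ω) (instr ω) (start ω V) (internalTime lam ω V) where
  zero x := by
    have h0 : (snapshot lam ω V 0).time = 0 := rfl
    have := internalTime_eq (lam := lam) (V := V) (k := 0) (t := 0) hω (by rw [h0]; exact zero_le)
      (by
        have h1 := time_lt_succ (lam := lam) (V := V) (k := 0) hω (by rw [h0]; simp)
        rw [h0] at h1
        simpa using h1) x
    rw [this, h0]
    simp [snapshot, initial, Snapshot.clock, clockSum, clocks]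
  cont x t ht := by
    have hright : ContinuousWithinAt (internalTime lam ω V x) (Set.Ici t) t := by
      obtain ⟨ε, hε, h⟩ := internalTime_slope (lam := lam) (V := V) hω ht x
      refine ContinuousWithinAt.mono_of_mem_nhdsWithin (t := Set.Icc t (t + ε)) ?_
        (Icc_mem_nhdsGE (by linarith))
      refine ContinuousWithinAt.congr_of_mem (Continuous.continuousWithinAt ?_) h
        ⟨le_rfl, by linarith⟩
      fun_prop
    rcases (show 0 ≤ t from ht).eq_or_lt with rfl | hpos
    · exact hright
    · have hleft : ContinuousWithinAt (internalTime lam ω V x) (Set.Iic t) t := by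
        obtain ⟨s, hs, A, m, h⟩ := internalTime_left (lam := lam) (V := V) hω hpos x
        refine ContinuousWithinAt.mono_of_mem_nhdsWithin (t := Set.Icc s t) ?_
          (Icc_mem_nhdsLE hs)
        refine ContinuousWithinAt.congr_of_mem (Continuous.continuousWithinAt ?_) h
          ⟨hs.le, le_rfl⟩
        fun_prop
      exact (continuousAt_iff_continuous_left_right.2 ⟨hleft, hright⟩).continuousWithinAt
  slope x t ht := internalTime_slope hω ht x
  left := by
    obtain ⟨m, hm⟩ := V.bddBelow
    refine ⟨m, fun x hx t ht => ?_⟩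
    have hV : ∀ v ∈ V, x < v := fun v hv => hx.trans_le (hm hv)
    set s := snapshot lam ω V (numRings lam ω V t.toNNReal) with hs
    have hr : s.Reachable lam ω V := reachable_snapshot hω lam V _
    have h1 : s.rings x = 0 := hr.left x hV
    have h2 : (s.config x).numActive = 0 := by
      have h3 : s.arrived ω V x = 0 := by
        unfold Snapshot.arrived start
        rw [if_neg fun hv => lt_irrefl _ (hV x hv),
          hr.left (x - 1) fun v hv => by have := hV v hv; omega, jumps_zero]
      rw [hr.numActive, h3]
      exact Nat.le_zero.1 (activeAt_le_arrivals _ _ _ _)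
    have hres : ∀ k, (snapshot lam ω V k).residual x = clocks ω x 0 := fun k => by
      induction k with
      | zero => rfl
      | succ k ih =>
        have hrk := reachable_snapshot hω lam V k
        have h3 : (snapshot lam ω V k).arrived ω V x = 0 := by
          unfold Snapshot.arrived start
          rw [if_neg fun hv => lt_irrefl _ (hV x hv),
            hrk.left (x - 1) fun v hv => by have := hV v hv; omega, jumps_zero]
        have h4 : ((snapshot lam ω V k).config x).numActive = 0 := by
          rw [hrk.numActive, h3]
          exact Nat.le_zero.1 (activeAt_le_arrivals _ _ _ _)
        rw [snapshot_succ]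
        rcases hrk.next_cases with ⟨y, hy, h⟩ | ⟨_, h⟩
        · have hxy : x ≠ y := fun hxy => by
            have := hy.1
            rw [← hxy, h4] at this
            exact lt_irrefl _ this
          rw [h]
          simp [Snapshot.ringAt, Function.update_of_ne hxy, h4, ih]
        · rw [h]
          exact ih
    change s.clock ω x + ringRate lam * (s.config x).numActive * _ = 0
    rw [h2, Snapshot.clock, h1, hres, clockSum_succ, clockSum_zero]
    simp

/-- A jump is visible: no two rings happen at the same time. -/
theorem jumps_eq_of_finiteProcess_eq (hω : IsGeneric ω) {x : ℤ} {t₀ T : ℝ≥0} (hT : t₀ ≤ T)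
    {s : SiteState} (hs : ∀ t, t₀ ≤ t → t ≤ T → finiteProcess lam ω V t x = s) :
    jumps (instr ω x) (ringCount (clocks ω x) (internalTime lam ω V x T)) =
      jumps (instr ω x) (ringCount (clocks ω x) (internalTime lam ω V x t₀)) := by
  rw [ringCount_internalTime hω, ringCount_internalTime hω]
  obtain ⟨ha, hb⟩ := numRings_spec (lam := lam) (V := V) hω t₀
  obtain ⟨hc, hd⟩ := numRings_spec (lam := lam) (V := V) hω T
  set k₀ := numRings lam ω V t₀ with hk₀
  set K := numRings lam ω V T with hK
  have hkK : k₀ ≤ K := by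
    by_contra! hlt
    have := time_mono (lam := lam) (V := V) hω (Nat.succ_le_of_lt hlt)
    exact absurd (hd.trans_le (this.trans ha)) (not_lt.2 (by exact_mod_cast hT))
  have hconfig : ∀ k, k₀ ≤ k → k ≤ K → (snapshot lam ω V k).config x = s := fun k h1 h2 => by
    have htk : (snapshot lam ω V k).time ≤ T := (time_mono hω h2).trans hc
    have htop : (snapshot lam ω V k).time ≠ ⊤ := ne_top_of_le_ne_top ENNReal.coe_ne_top htk
    have hlt := time_lt_succ hω htop
    have hk : ((snapshot lam ω V k).time.toNNReal : ℝ≥0∞) = (snapshot lam ω V k).time :=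
      ENNReal.coe_toNNReal htop
    -- A time in `[t₀, T]` at which snapshot `k` is the current one; the maximum matters for `k =
    -- k₀`, which may begin before `t₀`.
    set τ := max t₀ (snapshot lam ω V k).time.toNNReal with hτ
    have h3 : (snapshot lam ω V k).time ≤ τ := by
      rw [← hk]
      exact_mod_cast le_max_right _ _
    have h4 : (τ : ℝ≥0∞) < (snapshot lam ω V (k + 1)).time := by
      rw [hτ, ENNReal.coe_max, hk]
      exact max_lt (hb.trans_le (time_mono hω (Nat.succ_le_succ h1))) hlt
    have h5 : τ ≤ T := max_le hT (by
      rw [← hk] at htk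
      exact_mod_cast htk)
    have := hs τ (le_max_left _ _) h5
    rwa [finiteProcess, numRings_eq hω h3 h4] at this
  suffices ∀ k, k₀ ≤ k → k ≤ K → jumps (instr ω x) ((snapshot lam ω V k).rings x) =
      jumps (instr ω x) ((snapshot lam ω V k₀).rings x) from this K hkK le_rfl
  intro k hk
  induction k, hk using Nat.le_induction with
  | base => exact fun _ => rfl
  | succ k hk ih =>
    intro hkK'
    rw [← ih (by omega)]
    have hr := reachable_snapshot hω lam V k
    have hs1 := hconfig k hk (by omega)
    have hs2 := hconfig (k + 1) (by omega) hkK'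
    rw [snapshot_succ] at hs2 ⊢
    rcases hr.next_cases with ⟨y, hy, h⟩ | ⟨_, h⟩
    · rw [h] at hs2 ⊢
      rw [Snapshot.rings_ringAt]
      by_cases hxy : x = y
      · subst hxy
        rw [if_pos rfl, jumps_succ]
        split_ifs with hb'
        · exfalso
          rw [Snapshot.config_ringAt_self hr hy.1] at hs2
          have hact := hy.1
          rw [hr.numActive] at hact
          rw [siteState_jump hact hb', ← hr.config, hs1] at hs2
          refine settle_removeParticle_ne ?_ hs2
          rw [← hs1]
          exact hy.1
        · rfl
      · rw [if_neg hxy, add_zero]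
    · rw [h]

end Trajectory

/-! ### The infinite system -/

/-- The number of rings at `x` up to time `t` in the system that starts in `V`. -/
noncomputable def ringsUpTo (lam : ℝ≥0∞) (ω : Noise) (V : Finset ℤ) (x : ℤ) (t : ℝ) : ℕ :=
  ringCount (clocks ω x) (internalTime lam ω V x t)

/-- For each time `T` there are sites arbitrarily far to the left at which no clock rings up to
time `T`, whichever particles are present. -/
def HasBlocks (lam : ℝ≥0∞) (ω : Noise) : Prop :=
  ∀ (T : ℝ≥0) (x : ℤ), ∃ y < x, ∀ V : Finset ℤ, ringsUpTo lam ω V y T = 0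

theorem exists_forall_ge_eq_of_monotone {α : Type*} [Preorder α] [Nonempty α] {f : α → ℕ}
    (hf : Monotone f) {B : ℕ} (hB : ∀ a, f a ≤ B) : ∃ a, ∀ b ≥ a, f b = f a := by
  have hbdd : BddAbove (Set.range f) := ⟨B, by rintro _ ⟨a, rfl⟩; exact hB a⟩
  obtain ⟨a, ha⟩ := Nat.sSup_mem (Set.range_nonempty f) hbdd
  refine ⟨a, fun b hb => le_antisymm ?_ (hf hb)⟩
  rw [ha]
  exact le_csSup hbdd ⟨b, rfl⟩

section Infinite

variable {lam : ℝ≥0∞} {ω : Noise}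

theorem start_mono (ω : Noise) {V V' : Finset ℤ} (h : V ⊆ V') (x : ℤ) :
    start ω V x ≤ start ω V' x := by
  unfold start
  split_ifs with h1 h2
  · exact le_rfl
  · exact absurd (h h1) h2
  · exact Nat.zero_le _
  · exact le_rfl

theorem ringsUpTo_mono (hω : IsGeneric ω) {V V' : Finset ℤ} (h : V ⊆ V') (x : ℤ) {s t : ℝ≥0}
    (hst : s ≤ t) : ringsUpTo lam ω V x s ≤ ringsUpTo lam ω V' x t := by
  have h1 := isFlow_internalTime (lam := lam) (V := V) hω
  have h2 := isFlow_internalTime (lam := lam) (V := V') hω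
  exact ((hω.clock x).ringCount_mono (h1.nonneg x s.2)
    (h1.mono_initial h2 hω.clock (start_mono ω h) x s.2)).trans
    (h2.ringCount_mono hω.clock x s.2 hst)

/-- To the right of a block, only the particles that start there matter. -/
theorem eq_of_block (hω : IsGeneric ω) {y z : ℤ} {T : ℝ≥0}
    (hy : ∀ V : Finset ℤ, ringsUpTo lam ω V y T = 0) (hyz : y < z) {V : Finset ℤ}
    (hV : Finset.Icc (y + 1) z ⊆ V) {t : ℝ≥0} (ht : t ≤ T) :
    ringsUpTo lam ω V z t = ringsUpTo lam ω (Finset.Icc (y + 1) z) z t ∧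
      finiteProcess lam ω V t z = finiteProcess lam ω (Finset.Icc (y + 1) z) t z := by
  have h1 := isFlow_internalTime (lam := lam) (V := V) hω
  have h2 := isFlow_internalTime (lam := lam) (V := Finset.Icc (y + 1) z) hω
  obtain ⟨h3, h4⟩ := h1.eq_of_no_rings h2 hω.clock (hy V) (hy _) (z := z) (fun x hx hxz => by
    have hmem : x ∈ Finset.Icc (y + 1) z := Finset.mem_Icc.2 ⟨hx, hxz⟩
    simp only [start, hmem, hV hmem, if_true]) hyz le_rfl
  have h5 := h3 t t.coe_nonneg (by exact_mod_cast ht)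
  have h6 := h4 t t.coe_nonneg (by exact_mod_cast ht)
  constructor
  · unfold ringsUpTo
    rw [h5]
  · rw [finiteProcess_eq hω, finiteProcess_eq hω, h5, h6]

theorem wellDefined_of_hasBlocks (hω : IsGeneric ω) (hb : HasBlocks lam ω) :
    WellDefined lam ω := fun x T => by
  obtain ⟨y, hy, h⟩ := hb T x
  exact ⟨Finset.Icc (y + 1) x, fun V hV t ht => (eq_of_block hω h hy hV ht).2⟩

/-- Adding to `V` the sites between a block and `x` can only add rings, and the enlarged system
agrees at `x` with the system of those sites alone. -/
theorem exists_ringsUpTo_le (hω : IsGeneric ω) (hb : HasBlocks lam ω) (x : ℤ) (T : ℝ≥0) :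
    ∃ B, ∀ V, ringsUpTo lam ω V x T ≤ B := by
  obtain ⟨y, hy, h⟩ := hb T x
  refine ⟨ringsUpTo lam ω (Finset.Icc (y + 1) x) x T, fun V => ?_⟩
  rw [← (eq_of_block hω h hy (V := V ∪ Finset.Icc (y + 1) x) Finset.subset_union_right le_rfl).1]
  exact ringsUpTo_mono hω Finset.subset_union_left x le_rfl

theorem process_eq_of_eventually {t : ℝ≥0} {x : ℤ} {s : SiteState}
    (h : ∀ᶠ V : Finset ℤ in atTop, finiteProcess lam ω V t x = s) : process lam ω t x = s := by
  have hex : ∃ s : SiteState, ∀ᶠ V : Finset ℤ in atTop, finiteProcess lam ω V t x = s := ⟨s, h⟩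
  unfold process
  rw [dif_pos hex]
  obtain ⟨V, h1, h2⟩ := (hex.choose_spec.and h).exists
  rw [← h1, h2]

theorem exists_process_eq (hw : WellDefined lam ω) (x : ℤ) (T : ℝ≥0) :
    ∃ V₀ : Finset ℤ, ∀ V, V₀ ⊆ V → ∀ t ≤ T, finiteProcess lam ω V t x = process lam ω t x := by
  obtain ⟨V₀, h⟩ := hw x T
  refine ⟨V₀, fun V hV t ht => ?_⟩
  rw [h V hV t ht]
  refine (process_eq_of_eventually ?_).symm
  filter_upwards [eventually_ge_atTop V₀] with V' hV'
  exact h V' hV' t ht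

/-- If the numbers of rings are bounded, uniformly in the set of initial particles and in time,
the system locally fixates. -/
theorem locallyFixates_of_bounded (hω : IsGeneric ω)
    (h : ∀ x, ∃ B, ∀ (V : Finset ℤ) (t : ℝ≥0), ringsUpTo lam ω V x t ≤ B) :
    LocallyFixates (process lam ω) := by
  choose B hB using h
  have hV : ∀ (x : ℤ) (t : ℝ≥0), ∃ V : Finset ℤ, ∀ V' ≥ V,
      ringsUpTo lam ω V' x t = ringsUpTo lam ω V x t := fun x t =>
    exists_forall_ge_eq_of_monotone (f := fun V : Finset ℤ => ringsUpTo lam ω V x t)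
      (fun _ _ hVV => ringsUpTo_mono hω hVV x le_rfl) fun V => hB x V t
  choose W hW using hV
  -- The set `W x t` varies with `t`, but the limiting ring counts it realizes are monotone in `t`
  -- and bounded.
  have ht : ∀ x, ∃ t : ℝ≥0, ∀ u ≥ t,
      ringsUpTo lam ω (W x u) x u = ringsUpTo lam ω (W x t) x t := fun x =>
    exists_forall_ge_eq_of_monotone (f := fun t : ℝ≥0 => ringsUpTo lam ω (W x t) x t)
      (fun s t hst => by
        change ringsUpTo lam ω (W x s) x s ≤ ringsUpTo lam ω (W x t) x t
        rw [← hW x t (W x s ∪ W x t) Finset.subset_union_right]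
        exact ringsUpTo_mono hω Finset.subset_union_left x hst) fun t => hB x _ t
  choose τ hτ using ht
  intro x
  refine ⟨siteState lam (instr ω x)
    (ω.1 x + jumps (instr ω (x - 1)) (ringsUpTo lam ω (W (x - 1) (τ (x - 1))) (x - 1) (τ (x - 1))))
    (ringsUpTo lam ω (W x (τ x)) x (τ x)), ?_⟩
  filter_upwards [eventually_ge_atTop (τ x), eventually_ge_atTop (τ (x - 1))] with t h1 h2
  refine process_eq_of_eventually ?_
  filter_upwards [eventually_ge_atTop (W x t), eventually_ge_atTop (W (x - 1) t),
    eventually_ge_atTop {x}] with V h3 h4 h5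
  rw [finiteProcess_eq hω]
  have hx : x ∈ V := h5 (Finset.mem_singleton_self x)
  unfold arrivals
  rw [start, if_pos hx, ← hτ x t h1, ← hτ (x - 1) t h2, ← hW x t V h3, ← hW (x - 1) t V h4]
  rfl

/-- If the number of jumps from some site is unbounded, the system does not locally fixate. -/
theorem not_locallyFixates_of_unbounded (hω : IsGeneric ω) (hb : HasBlocks lam ω) (x : ℤ)
    (h : ∀ M, ∃ (V : Finset ℤ) (t : ℝ≥0), M ≤ jumps (instr ω x) (ringsUpTo lam ω V x t)) :
    ¬ LocallyFixates (process lam ω) := by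
  intro hfix
  obtain ⟨s, hs⟩ := hfix x
  obtain ⟨t₀, ht₀⟩ := eventually_atTop.1 hs
  -- Up to `t₀` there are at most `B` rings, whatever the initial set, so `B + 1` jumps require one
  -- after the state has become constant.
  obtain ⟨B, hB⟩ := exists_ringsUpTo_le hω hb x t₀
  obtain ⟨V₁, t₁, h₁⟩ := h (B + 1)
  obtain ⟨V₀, hV₀⟩ := exists_process_eq (wellDefined_of_hasBlocks hω hb) x (max t₀ t₁)
  have key := jumps_eq_of_finiteProcess_eq (lam := lam) (V := V₀ ∪ V₁) hω (x := x)
    (le_max_left t₀ t₁) (s := s) fun t h1 h2 => by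
      rw [hV₀ _ Finset.subset_union_left t h2, ht₀ t h1]
  have h2 : jumps (instr ω x) (ringsUpTo lam ω V₁ x t₁) ≤
      jumps (instr ω x) (ringsUpTo lam ω (V₀ ∪ V₁) x ↑(max t₀ t₁)) :=
    jumps_mono _ (ringsUpTo_mono hω Finset.subset_union_right x (le_max_right _ _))
  have h3 := (jumps_le (instr ω x) (ringsUpTo lam ω (V₀ ∪ V₁) x t₀)).trans (hB (V₀ ∪ V₁))
  unfold ringsUpTo at h2 h3 h₁
  rw [key] at h2
  omega

end Infinite

/-! ### Recursions from site to site -/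

/-- The noise at one site: the initial number of particles, the waiting times of the clock, and
the instructions. -/
abbrev SiteNoise := ℕ × (ℕ → ℝ) × (ℕ → Bool)

/-- The noise, sorted by sites. -/
def sites (ω : Noise) (x : ℤ) : SiteNoise := (ω.1 x, clocks ω x, instr ω x)

/-- The state after the sites `y, …, y + n - 1` of the recursion `F`, started from `z`. -/
def chain {X : Type*} (F : X → SiteNoise → X) (z : X) (σ : ℤ → SiteNoise) (y : ℤ) : ℕ → X
  | 0 => z
  | n + 1 => F (chain F z σ y n) (σ (y + n))

/-- The number of particles that leave a site, given the number of those that arrive. -/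
noncomputable def outStep (lam : ℝ≥0∞) (w : ℕ) (s : SiteNoise) : ℕ := outflow lam s.2.2 (s.1 + w)

/-- An upper bound for the internal times of a site at the end of each time slice, given the
number of rings at the site to the left up to the end of each time slice. Time slices have length
`1 / (2 * ringRate lam)`. -/
noncomputable def crudeTime (α : ℕ → ℕ) (n : ℕ) (i : ℕ) : ℝ :=
  ∑ l ∈ Finset.range (i + 1), ((n + α l : ℕ) : ℝ) / 2

/-- An upper bound for the number of rings of a site up to the end of each time slice, given
such a bound for the site to the left. -/
noncomputable def crudeStep (α : ℕ → ℕ) (s : SiteNoise) (i : ℕ) : ℕ :=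
  ringCount s.2.1 (crudeTime α s.1 i)

section Recursions

variable {lam : ℝ≥0∞} {ω : Noise} {V : Finset ℤ}

theorem start_le (ω : Noise) (V : Finset ℤ) (x : ℤ) : start ω V x ≤ ω.1 x := by
  unfold start
  split_ifs
  · exact le_rfl
  · exact Nat.zero_le _

theorem ringsUpTo_left_eq_zero (hω : IsGeneric ω) {x : ℤ} (hx : ∀ v ∈ V, x < v) (t : ℝ≥0) :
    ringsUpTo lam ω V x t = 0 := by
  rw [ringsUpTo, ringCount_internalTime hω]
  exact (reachable_snapshot hω lam V _).left x hx

/-- In one time slice the clock of a site advances by at most half the number of arrivals up to the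
end of the slice, by the choice of the slice length. Arrivals from the left are at most the rings
there. -/
theorem crude_bound (hω : IsGeneric ω) {y : ℤ} (hy : ∀ v ∈ V, y ≤ v) (n : ℕ) :
    (∀ i : ℕ, ringsUpTo lam ω V (y + n - 1) (((i + 1 : ℕ) : ℝ) / (2 * ringRate lam)) ≤
      chain crudeStep (fun _ => 0) (sites ω) y n i) ∧
    ∀ i : ℕ, internalTime lam ω V (y + n) (((i + 1 : ℕ) : ℝ) / (2 * ringRate lam)) ≤
      crudeTime (chain crudeStep (fun _ => 0) (sites ω) y n) (ω.1 (y + n)) i := by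
  have hflow := isFlow_internalTime (lam := lam) (V := V) hω
  have hρ := ringRate_pos lam
  have hslice : ∀ j : ℕ, 0 ≤ (j : ℝ) / (2 * ringRate lam) := fun j => by positivity
  have key : ∀ n : ℕ, (∀ i : ℕ, ringsUpTo lam ω V (y + n - 1)
      (((i + 1 : ℕ) : ℝ) / (2 * ringRate lam)) ≤
        chain crudeStep (fun _ => 0) (sites ω) y n i) →
      ∀ i : ℕ, internalTime lam ω V (y + n) (((i + 1 : ℕ) : ℝ) / (2 * ringRate lam)) ≤
        crudeTime (chain crudeStep (fun _ => 0) (sites ω) y n) (ω.1 (y + n)) i := by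
    intro n hn i
    have hstep : ∀ j : ℕ, internalTime lam ω V (y + n) (((j + 1 : ℕ) : ℝ) / (2 * ringRate lam)) ≤
        internalTime lam ω V (y + n) ((j : ℝ) / (2 * ringRate lam)) +
          ((ω.1 (y + n) + chain crudeStep (fun _ => 0) (sites ω) y n j : ℕ) : ℝ) / 2 := fun j => by
      have hle : (j : ℝ) / (2 * ringRate lam) ≤ ((j + 1 : ℕ) : ℝ) / (2 * ringRate lam) := by
        push_cast
        gcongr
        linarith
      have := hflow.le_add_of_arrivals_le hω.clock (x := y + n) (hslice j) hle
        (k := ω.1 (y + n) + chain crudeStep (fun _ => 0) (sites ω) y n j)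
        (Nat.add_le_add (start_le ω V _) ((jumps_le _ _).trans (hn j)))
      refine this.trans (le_of_eq ?_)
      rw [← sub_div]
      push_cast
      field_simp
      ring
    induction i with
    | zero =>
      have := hstep 0
      rw [Nat.cast_zero, zero_div, hflow.zero, zero_add] at this
      simpa [crudeTime] using this
    | succ i ih =>
      unfold crudeTime at ih ⊢
      rw [Finset.sum_range_succ]
      exact (hstep (i + 1)).trans (by gcongr)
  induction n with
  | zero =>
    have h0 : ∀ i : ℕ, ringsUpTo lam ω V (y + (0 : ℕ) - 1)
        (((i + 1 : ℕ) : ℝ) / (2 * ringRate lam)) ≤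
        chain crudeStep (fun _ => 0) (sites ω) y 0 i := fun i => by
      have := ringsUpTo_left_eq_zero (lam := lam) (V := V) hω (x := y + (0 : ℕ) - 1)
        (fun v hv => by have := hy v hv; push_cast; omega) ⟨_, hslice (i + 1)⟩
      exact this.le
    exact ⟨h0, key 0 h0⟩
  | succ n ih =>
    have h1 : ∀ i : ℕ, ringsUpTo lam ω V (y + (n + 1 : ℕ) - 1)
        (((i + 1 : ℕ) : ℝ) / (2 * ringRate lam)) ≤
        chain crudeStep (fun _ => 0) (sites ω) y (n + 1) i := fun i => by
      have hx : y + ((n + 1 : ℕ) : ℤ) - 1 = y + n := by push_cast; ring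
      rw [hx]
      exact (hω.clock _).ringCount_mono (hflow.nonneg _ (hslice _)) (ih.2 i)
    exact ⟨h1, key _ h1⟩

/-- One site `y` must serve every finite `V`, and `V` may reach arbitrarily far to the left, so all
depths `n` are needed. The index `i` is chosen so that its slice ends after `T`. -/
theorem hasBlocks_of_crude (hω : IsGeneric ω)
    (h : ∀ (i : ℕ) (x : ℤ), ∃ y < x, ∀ n : ℕ,
      crudeTime (chain crudeStep (fun _ => 0) (sites ω) (y - n) n) (ω.1 y) i < clocks ω y 0) :
    HasBlocks lam ω := by
  intro T x
  have hρ := ringRate_pos lam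
  obtain ⟨i, hi⟩ := exists_nat_gt ((T : ℝ) * (2 * ringRate lam))
  obtain ⟨y, hy, hlt⟩ := h i x
  refine ⟨y, hy, fun V => ?_⟩
  have hflow := isFlow_internalTime (lam := lam) (V := V) hω
  obtain ⟨m, hm⟩ := V.bddBelow
  obtain ⟨n, hn⟩ : ∃ n : ℕ, y - n ≤ m := ⟨(y - m).toNat, by have := Int.self_le_toNat (y - m); omega⟩
  have h1 := (crude_bound (lam := lam) hω (fun v hv => hn.trans (hm hv)) n).2 i
  rw [sub_add_cancel] at h1
  have hT : (T : ℝ) ≤ ((i + 1 : ℕ) : ℝ) / (2 * ringRate lam) := by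
    rw [le_div_iff₀ (by positivity)]
    push_cast
    linarith
  have h2 := (hflow.mono y T.2 hT).trans_lt (h1.trans_lt (hlt n))
  refine (hω.clock y).ringCount_eq ?_ ?_
  · rw [clockSum_zero]
    exact hflow.nonneg y T.2
  · simpa [clockSum] using h2

/-- Upper half of the abelian property: inductively from the left, no site receives more than in the
stabilization, whatever the order of events. -/
theorem ringsUpTo_le_settleRings (hω : IsGeneric ω) {y : ℤ} (hy : ∀ v ∈ V, y ≤ v) (n : ℕ)
    (t : ℝ≥0) : ringsUpTo lam ω V (y + n) t ≤ settleRings lam (instr ω (y + n))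
      (ω.1 (y + n) + chain (outStep lam) 0 (sites ω) y n) := by
  have hflow := isFlow_internalTime (lam := lam) (V := V) hω
  induction n with
  | zero =>
    refine hflow.ringCount_le_settleRings hω.clock (hω.jumpsOften _) t.2
      (Nat.add_le_add (start_le ω V _) ?_)
    have := ringsUpTo_left_eq_zero (lam := lam) (V := V) hω (x := y + (0 : ℕ) - 1)
        (fun v hv => by have := hy v hv; push_cast; omega) t
    unfold ringsUpTo at this
    change jumps _ (ringCount _ (internalTime lam ω V _ (t : ℝ))) ≤ _
    rw [this, jumps_zero]
    exact Nat.zero_le _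
  | succ n ih =>
    refine hflow.ringCount_le_settleRings hω.clock (hω.jumpsOften _) t.2
      (Nat.add_le_add (start_le ω V _) ?_)
    have hx : y + ((n + 1 : ℕ) : ℤ) - 1 = y + n := by push_cast; ring
    rw [hx]
    exact jumps_mono _ ih

theorem bounded_of_chain (hω : IsGeneric ω)
    (h : ∀ x : ℤ, ∃ B, ∀ n : ℕ, chain (outStep lam) 0 (sites ω) (x - n) n ≤ B) (x : ℤ) :
    ∃ B, ∀ (V : Finset ℤ) (t : ℝ≥0), ringsUpTo lam ω V x t ≤ B := by
  obtain ⟨B, hB⟩ := h x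
  refine ⟨settleRings lam (instr ω x) (ω.1 x + B), fun V t => ?_⟩
  obtain ⟨m, hm⟩ := V.bddBelow
  obtain ⟨n, hn⟩ : ∃ n : ℕ, x - n ≤ m := ⟨(x - m).toNat, by have := Int.self_le_toNat (x - m); omega⟩
  have := ringsUpTo_le_settleRings (lam := lam) hω (fun v hv => hn.trans (hm hv)) n t
  rw [sub_add_cancel] at this
  exact this.trans (settleRings_mono (hω.jumpsOften x) (Nat.add_le_add_left (hB n) _))

/-- Lower half of the abelian property: given enough time, each site from `y` on passes on at least
what the stabilization prescribes. -/
theorem exists_chain_le_jumps (hω : IsGeneric ω) (y : ℤ) (n : ℕ)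
    (hV : ∀ m ≤ n, y + m ∈ V) : ∃ t : ℝ≥0,
    chain (outStep lam) 0 (sites ω) y (n + 1) ≤
      jumps (instr ω (y + n)) (ringsUpTo lam ω V (y + n) t) := by
  have hflow := isFlow_internalTime (lam := lam) (V := V) hω
  obtain ⟨t₀, ht₀⟩ : ∃ t₀ : ℝ≥0, ω.1 (y + n) + chain (outStep lam) 0 (sites ω) y n ≤
      arrivals (clocks ω) (instr ω) (start ω V) (internalTime lam ω V) (y + n) t₀ := by
    have hst : start ω V (y + n) = ω.1 (y + n) := if_pos (hV n le_rfl)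
    induction n with
    | zero => exact ⟨0, by unfold arrivals chain; omega⟩
    | succ n ih =>
      have hst' : start ω V (y + n) = ω.1 (y + n) := if_pos (hV n (by omega))
      obtain ⟨t₀, ht₀⟩ := ih (fun m hm => hV m (by omega)) hst'
      obtain ⟨t, ht, hle⟩ := hflow.exists_settleRings_le hω.clock t₀.2 ht₀
      refine ⟨⟨t, t₀.2.trans ht⟩, ?_⟩
      have hx : y + ((n + 1 : ℕ) : ℤ) - 1 = y + n := by push_cast; ring
      unfold arrivals
      rw [hst, hx]
      exact Nat.add_le_add_left (jumps_mono _ hle) _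
  obtain ⟨t, ht, hle⟩ := hflow.exists_settleRings_le hω.clock t₀.2 ht₀
  exact ⟨⟨t, t₀.2.trans ht⟩, jumps_mono _ hle⟩

theorem unbounded_of_chain (hω : IsGeneric ω)
    (h : ∀ M, ∃ n : ℕ, M ≤ chain (outStep lam) 0 (sites ω) (-n) (n + 1)) (M : ℕ) :
    ∃ (V : Finset ℤ) (t : ℝ≥0), M ≤ jumps (instr ω 0) (ringsUpTo lam ω V 0 t) := by
  obtain ⟨n, hn⟩ := h M
  obtain ⟨t, ht⟩ := exists_chain_le_jumps (lam := lam) (V := Finset.Icc (-n) 0) hω (-n) n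
    fun m hm => Finset.mem_Icc.2 (by omega)
  rw [neg_add_cancel] at ht
  exact ⟨_, t, hn.trans ht⟩

end Recursions

/-! ### Product measures -/

/-- The product of two infinite products is an infinite product of products. -/
theorem infinitePi_prod_map_zip {ι : Type*} {X Y : ι → Type*} [∀ i, MeasurableSpace (X i)]
    [∀ i, MeasurableSpace (Y i)] (μ : ∀ i, Measure (X i)) (ν : ∀ i, Measure (Y i))
    [∀ i, IsProbabilityMeasure (μ i)] [∀ i, IsProbabilityMeasure (ν i)] :
    ((Measure.infinitePi μ).prod (Measure.infinitePi ν)).map (fun p i => (p.1 i, p.2 i)) =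
      Measure.infinitePi fun i => (μ i).prod (ν i) := by
  have hmeas : Measurable fun (p : (∀ i, X i) × ∀ i, Y i) i => (p.1 i, p.2 i) := by fun_prop
  refine Measure.eq_infinitePi _ fun s t ht => ?_
  have hbox : MeasurableSet (Set.pi (s : Set ι) t) := .pi s.countable_toSet fun i _ => ht i
  rw [Measure.map_apply hmeas hbox, Measure.prod_apply (hmeas hbox)]
  have hslice : ∀ f : ∀ i, X i, Measure.infinitePi ν
      (Prod.mk f ⁻¹' ((fun (p : (∀ i, X i) × ∀ i, Y i) i => (p.1 i, p.2 i)) ⁻¹' Set.pi s t)) =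
        ∏ i ∈ s, ν i (Prod.mk (f i) ⁻¹' t i) := fun f => by
    rw [← Measure.infinitePi_pi (μ := ν) fun i _ => measurable_prodMk_left (ht i)]
    rfl
  simp_rw [hslice]
  rw [lintegral_prod_eq_prod_lintegral_of_indepFun s
    (fun i (f : ∀ i, X i) => ν i (Prod.mk (f i) ⁻¹' t i))
    (iIndepFun_infinitePi (X := fun i x => ν i (Prod.mk x ⁻¹' t i))
      fun i => measurable_measure_prodMk_left (ht i))
    (fun i => (measurable_measure_prodMk_left (ht i)).comp (measurable_pi_apply i))]
  refine Finset.prod_congr rfl fun i _ => ?_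
  rw [Measure.prod_apply (ht i), ← Measure.infinitePi_map_eval μ i,
    lintegral_map (measurable_measure_prodMk_left (ht i)) (measurable_pi_apply i)]

/-- An event of positive probability happens for infinitely many of countably many independent
trials. -/
theorem ae_frequently_mem_of_injective {ι X : Type*} [MeasurableSpace X] (ν : Measure X)
    [IsProbabilityMeasure ν] {A : Set X} (hA : MeasurableSet A) (hpos : ν A ≠ 0) {f : ℕ → ι}
    (hf : Function.Injective f) :
    ∀ᵐ ω ∂Measure.infinitePi (fun _ : ι => ν), ∃ᶠ n in atTop, ω (f n) ∈ A := by
  set P := Measure.infinitePi (fun _ : ι => ν) with hP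
  have hm : ∀ n, Measurable fun ω : ι → X => ω (f n) := fun n => measurable_pi_apply _
  have hms : ∀ n, MeasurableSet ((fun ω : ι → X => ω (f n)) ⁻¹' A) := fun n => hm n hA
  have hprob : ∀ n, P ((fun ω : ι → X => ω (f n)) ⁻¹' A) = ν A := fun n => by
    rw [← Measure.map_apply (hm n) hA, hP]
    exact congrArg (· A) (Measure.infinitePi_map_eval (fun _ : ι => ν) (f n))
  have hind : iIndepFun (fun n (ω : ι → X) => ω (f n)) P :=
    (iIndepFun_infinitePi (P := fun _ : ι => ν) (X := fun _ x => x) fun _ => measurable_id).precomp hf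
  have hindset : iIndepSet (fun n => (fun ω : ι → X => ω (f n)) ⁻¹' A) P :=
    (iIndepSet_iff_meas_biInter hms).2 fun s =>
      hind.measure_inter_preimage_eq_mul s fun _ _ => hA
  have hone := measure_limsup_eq_one hms hindset (by
    simp_rw [hprob]
    exact ENNReal.tsum_const_eq_top_of_ne_zero hpos)
  have hae : ∀ᵐ ω ∂P, ω ∈ limsup (fun n => (fun ω : ι → X => ω (f n)) ⁻¹' A) atTop :=
    (prob_compl_eq_zero_iff (MeasurableSet.measurableSet_limsup hms)).2 hone
  filter_upwards [hae] with ω hω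
  exact mem_limsup_iff_frequently_mem.1 hω

/-! ### The law of the noise -/

instance : NullSingletonClass (expMeasure 1) := by
  unfold expMeasure gammaMeasure
  infer_instance

theorem expMeasure_Iic {x : ℝ} (hx : 0 ≤ x) :
    expMeasure 1 (Set.Iic x) = ENNReal.ofReal (1 - Real.exp (-x)) := by
  have h := cdf_expMeasure_eq one_pos x
  rw [cdf_eq_real, if_pos hx, one_mul] at h
  rw [← h, ofReal_measureReal]

theorem expMeasure_Ioi {x : ℝ} (hx : 0 ≤ x) :
    expMeasure 1 (Set.Ioi x) = ENNReal.ofReal (Real.exp (-x)) := by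
  rw [← Set.compl_Iic, prob_compl_eq_one_sub measurableSet_Iic, expMeasure_Iic hx,
    ← ENNReal.ofReal_one, ← ENNReal.ofReal_sub _ (by simpa using hx)]
  congr 1
  ring

theorem expMeasure_Ioi_ne_zero (x : ℝ) : expMeasure 1 (Set.Ioi x) ≠ 0 := by
  have h : expMeasure 1 (Set.Ioi (max x 0)) ≠ 0 := by
    rw [expMeasure_Ioi (le_max_right _ _)]
    simpa using Real.exp_pos _
  exact fun h0 => h (measure_mono_null (Set.Ioi_subset_Ioi (le_max_left _ _)) h0)

theorem ae_pos_expMeasure : ∀ᵐ x ∂expMeasure 1, 0 < x := by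
  have h := expMeasure_Iic le_rfl
  simp only [neg_zero, Real.exp_zero, sub_self, ENNReal.ofReal_zero] at h
  rw [ae_iff]
  convert h using 2
  ext x
  simp

theorem isClock_of_frequently {e : ℕ → ℝ} (hpos : ∀ j, 0 < e j)
    (hf : ∃ᶠ n in atTop, e n ∈ Set.Ioi (1 : ℝ)) : IsClock e := by
  have hmono : Monotone (clockSum e) := monotone_nat_of_le_succ fun n => by
    rw [clockSum_succ]
    linarith [hpos n]
  refine ⟨hpos, fun M => ?_⟩
  have : ∀ k : ℕ, ∃ n, (k : ℝ) ≤ clockSum e n := fun k => by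
    induction k with
    | zero => exact ⟨0, by simp [clockSum_zero]⟩
    | succ k ih =>
      obtain ⟨n, hn⟩ := ih
      obtain ⟨m, hm, hem⟩ := frequently_atTop.1 hf n
      refine ⟨m + 1, ?_⟩
      have hem : 1 < e m := hem
      rw [clockSum_succ]
      push_cast
      linarith [hmono hm]
  obtain ⟨k, hk⟩ := exists_nat_gt M
  obtain ⟨n, hn⟩ := this k
  exact ⟨n, hk.trans_le hn⟩

theorem jumpsOften_of_frequently {b : ℕ → Bool}
    (hf : ∃ᶠ n in atTop, b n ∈ ({true} : Set Bool)) : JumpsOften b := fun k => by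
  induction k with
  | zero => exact ⟨0, Nat.zero_le _⟩
  | succ k ih =>
    obtain ⟨r, hr⟩ := ih
    obtain ⟨m, hm, hbm⟩ := frequently_atTop.1 hf r
    refine ⟨m + 1, ?_⟩
    rw [jumps_succ, if_pos (by simpa using hbm)]
    exact Nat.succ_le_succ (hr.trans (jumps_mono b hm))

/-- The law of the waiting times of one clock. -/
noncomputable def clockLaw : Measure (ℕ → ℝ) := Measure.infinitePi fun _ : ℕ => expMeasure 1

/-- The law of the instructions at one site. -/
noncomputable def instrLaw (lam : ℝ≥0∞) : Measure (ℕ → Bool) :=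
  Measure.infinitePi fun _ : ℕ => instructionLaw lam

/-- The law of the noise at one site. -/
noncomputable def siteLaw (lam : ℝ≥0∞) (μ : ℝ≥0) : Measure SiteNoise :=
  (poissonMeasure μ).prod (clockLaw.prod (instrLaw lam))

instance : IsProbabilityMeasure clockLaw := by unfold clockLaw; infer_instance

instance (lam : ℝ≥0∞) : IsProbabilityMeasure (instrLaw lam) := by unfold instrLaw; infer_instance

instance (lam : ℝ≥0∞) (μ : ℝ≥0) : IsProbabilityMeasure (siteLaw lam μ) := by
  unfold siteLaw; infer_instance

instance (lam : ℝ≥0∞) (μ : ℝ≥0) : IsProbabilityMeasure (noiseLaw lam μ) := by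
  unfold noiseLaw; infer_instance

theorem ae_isClock : ∀ᵐ e ∂clockLaw, IsClock e := by
  have h1 := ae_frequently_mem_of_injective (expMeasure 1) measurableSet_Ioi
    (expMeasure_Ioi_ne_zero 1) (f := fun n : ℕ => n) fun _ _ h => h
  have h2 : ∀ᵐ e ∂clockLaw, ∀ j : ℕ, 0 < e j := ae_all_iff.2 fun j =>
    (measurePreserving_eval_infinitePi (fun _ : ℕ => expMeasure 1) j).quasiMeasurePreserving.ae
      ae_pos_expMeasure
  unfold clockLaw at h2 ⊢
  filter_upwards [h1, h2] with e h1 h2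
  exact isClock_of_frequently h2 h1

theorem instructionLaw_true (lam : ℝ≥0∞) : instructionLaw lam {true} = jumpProb lam := by
  simp [instructionLaw]

theorem jumpProb_ne_zero (lam : ℝ≥0∞) : jumpProb lam ≠ 0 := by
  unfold jumpProb
  split_ifs with h <;> simp [h]

theorem ae_jumpsOften (lam : ℝ≥0∞) : ∀ᵐ b ∂instrLaw lam, JumpsOften b := by
  have h1 := ae_frequently_mem_of_injective (instructionLaw lam) (measurableSet_singleton true)
    (by rw [instructionLaw_true]; exact jumpProb_ne_zero lam) (f := fun n : ℕ => n) fun _ _ h => h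
  unfold instrLaw
  filter_upwards [h1] with b h1
  exact jumpsOften_of_frequently h1

theorem measurable_sites : Measurable sites := by
  unfold sites clocks instr
  fun_prop

theorem map_sites (lam : ℝ≥0∞) (μ : ℝ≥0) :
    (noiseLaw lam μ).map sites = Measure.infinitePi fun _ : ℤ => siteLaw lam μ := by
  have hE : (Measure.infinitePi fun _ : ℤ × ℕ => expMeasure 1).map
      (MeasurableEquiv.curry ℤ ℕ ℝ) = Measure.infinitePi fun _ : ℤ => clockLaw :=
    Measure.infinitePi_map_curry (fun (_ : ℤ) (_ : ℕ) => expMeasure 1)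
  have hI : (Measure.infinitePi fun _ : ℤ × ℕ => instructionLaw lam).map
      (MeasurableEquiv.curry ℤ ℕ Bool) = Measure.infinitePi fun _ : ℤ => instrLaw lam :=
    Measure.infinitePi_map_curry (fun (_ : ℤ) (_ : ℕ) => instructionLaw lam)
  have h1 := infinitePi_prod_map_zip (fun _ : ℤ => clockLaw) (fun _ : ℤ => instrLaw lam)
  have h2 := infinitePi_prod_map_zip (fun _ : ℤ => poissonMeasure μ)
    (fun _ : ℤ => clockLaw.prod (instrLaw lam))
  rw [← h1, ← hE, ← hI, Measure.map_prod_map _ _ (MeasurableEquiv.measurable _)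
    (MeasurableEquiv.measurable _), Measure.map_map (by fun_prop) (by fun_prop)] at h2
  have hid : Measure.infinitePi (fun _ : ℤ => poissonMeasure μ) =
      (Measure.infinitePi fun _ : ℤ => poissonMeasure μ).map id := Measure.map_id.symm
  rw [hid, Measure.map_prod_map _ _ measurable_id (by fun_prop),
    Measure.map_map (by fun_prop) (by fun_prop)] at h2
  exact h2

/-- Almost sure properties of the noise, sorted by sites. -/
theorem ae_of_ae_sites {lam : ℝ≥0∞} {μ : ℝ≥0} {p : (ℤ → SiteNoise) → Prop}
    (h : ∀ᵐ σ ∂Measure.infinitePi (fun _ : ℤ => siteLaw lam μ), p σ) :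
    ∀ᵐ ω ∂noiseLaw lam μ, p (sites ω) := by
  rw [← map_sites] at h
  exact ae_of_ae_map measurable_sites.aemeasurable h

theorem ae_forall_site {lam : ℝ≥0∞} {μ : ℝ≥0} {p : SiteNoise → Prop}
    (h : ∀ᵐ s ∂siteLaw lam μ, p s) :
    ∀ᵐ σ ∂Measure.infinitePi (fun _ : ℤ => siteLaw lam μ), ∀ x, p (σ x) :=
  ae_all_iff.2 fun x =>
    (measurePreserving_eval_infinitePi (fun _ : ℤ => siteLaw lam μ) x).quasiMeasurePreserving.ae h

theorem ae_site_isClock (lam : ℝ≥0∞) (μ : ℝ≥0) : ∀ᵐ s ∂siteLaw lam μ, IsClock s.2.1 :=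
  Measure.quasiMeasurePreserving_snd.ae (Measure.quasiMeasurePreserving_fst.ae ae_isClock)

theorem ae_site_jumpsOften (lam : ℝ≥0∞) (μ : ℝ≥0) : ∀ᵐ s ∂siteLaw lam μ, JumpsOften s.2.2 :=
  Measure.quasiMeasurePreserving_snd.ae (Measure.quasiMeasurePreserving_snd.ae (ae_jumpsOften lam))

theorem siteLaw_first_clock (lam : ℝ≥0∞) (μ : ℝ≥0) {A : Set ℝ} (hA : MeasurableSet A) :
    siteLaw lam μ {s | s.2.1 0 ∈ A} = expMeasure 1 A := by
  have h : {s : SiteNoise | s.2.1 0 ∈ A} = Set.univ ×ˢ (((fun e : ℕ → ℝ => e 0) ⁻¹' A) ×ˢ Set.univ) := by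
    ext s
    simp
  rw [h, siteLaw, Measure.prod_prod, Measure.prod_prod, measure_univ, measure_univ, one_mul, mul_one,
    ← Measure.map_apply (measurable_pi_apply 0) hA]
  exact congrArg (· A) (Measure.infinitePi_map_eval (fun _ : ℕ => expMeasure 1) 0)

theorem ae_exists_long (lam : ℝ≥0∞) (μ : ℝ≥0) :
    ∀ᵐ σ ∂Measure.infinitePi (fun _ : ℤ => siteLaw lam μ),
      ∀ (M : ℝ) (x : ℤ), ∃ y ≥ x, M < (σ y).2.1 0 := by
  have h : ∀ k : ℕ, ∀ᵐ σ ∂Measure.infinitePi (fun _ : ℤ => siteLaw lam μ),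
      ∃ᶠ n : ℕ in atTop, σ n ∈ {s : SiteNoise | s.2.1 0 ∈ Set.Ioi (k : ℝ)} := fun k =>
    ae_frequently_mem_of_injective _ (measurableSet_Ioi.preimage (by fun_prop))
      (by
        have := siteLaw_first_clock lam μ (measurableSet_Ioi (a := (k : ℝ)))
        exact this.trans_ne (expMeasure_Ioi_ne_zero _))
      (f := fun n : ℕ => (n : ℤ)) Nat.cast_injective
  filter_upwards [ae_all_iff.2 h] with σ hσ M x
  obtain ⟨k, hk⟩ := exists_nat_gt M
  obtain ⟨n, hn, hlt⟩ := frequently_atTop.1 (hσ k) x.toNat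
  exact ⟨n, by have := Int.self_le_toNat x; omega, hk.trans hlt⟩

/-- Given `X`, the atomless variable `Y` would have to take one prescribed value. -/
theorem measure_add_eq_zero {Ω : Type*} [MeasurableSpace Ω] {P : Measure Ω}
    [IsProbabilityMeasure P] {X Y : Ω → ℝ} (hX : Measurable X) (hY : Measurable Y)
    (h : IndepFun X Y P) (hat : ∀ a, P (Y ⁻¹' {a}) = 0) : P {ω | X ω + Y ω = 0} = 0 := by
  have hs : MeasurableSet {p : ℝ × ℝ | p.1 + p.2 = 0} :=
    (measurableSet_singleton (0 : ℝ)).preimage (by fun_prop : Measurable fun p : ℝ × ℝ => p.1 + p.2)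
  have h1 : {ω | X ω + Y ω = 0} = (fun ω => (X ω, Y ω)) ⁻¹' {p : ℝ × ℝ | p.1 + p.2 = 0} := rfl
  rw [h1, ← Measure.map_apply (hX.prodMk hY) hs,
    h.map_prod_eq_prod_map_map hX.aemeasurable hY.aemeasurable, Measure.prod_apply hs]
  refine lintegral_eq_zero_of_ae_eq_zero (ae_of_all _ fun x => ?_)
  have h2 : Prod.mk x ⁻¹' {p : ℝ × ℝ | p.1 + p.2 = 0} = {-x} := by
    ext y
    simp only [Set.mem_preimage, Set.mem_ofPred_eq, Set.mem_singleton_iff]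
    constructor <;> intro h <;> linarith
  change P.map Y (Prod.mk x ⁻¹' {p : ℝ × ℝ | p.1 + p.2 = 0}) = 0
  rw [h2, Measure.map_apply hY (measurableSet_singleton _)]
  exact hat _

/-- Independent exponential variables are almost surely linearly independent over `ℚ`. -/
theorem ae_linearIndependent {ι : Type*} [Countable ι] :
    ∀ᵐ e ∂Measure.infinitePi (fun _ : ι => expMeasure 1), LinearIndependent ℚ e := by
  classical
  have h : ∀ l : ι →₀ ℚ, ∀ᵐ e ∂Measure.infinitePi (fun _ : ι => expMeasure 1),
      Finsupp.linearCombination ℚ e l = 0 → l = 0 := fun l => by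
    by_cases hl : l = 0
    · exact ae_of_all _ fun _ _ => hl
    -- A term with nonzero coefficient is atomless and independent of the sum of the others.
    obtain ⟨i, hi⟩ := Finsupp.support_nonempty_iff.2 hl
    have hli : (l i : ℝ) ≠ 0 := by exact_mod_cast Finsupp.mem_support_iff.1 hi
    have hmeas : ∀ j, Measurable fun e : ι → ℝ => (l j : ℝ) * e j := fun j => by fun_prop
    have hind : iIndepFun (fun j (e : ι → ℝ) => (l j : ℝ) * e j)
        (Measure.infinitePi fun _ : ι => expMeasure 1) :=
      iIndepFun_infinitePi (X := fun j x => (l j : ℝ) * x) fun j => by fun_prop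
    have h0 := measure_add_eq_zero (by fun_prop) (hmeas i)
      (hind.indepFun_finsetSum_of_notMem hmeas (Finset.notMem_erase i l.support)) fun a => by
        have : (fun e : ι → ℝ => (l i : ℝ) * e i) ⁻¹' {a} =
            (fun e : ι → ℝ => e i) ⁻¹' {a / l i} := by
          ext e
          simp only [Set.mem_preimage, Set.mem_singleton_iff]
          rw [eq_div_iff hli, mul_comm]
        rw [this, ← Measure.map_apply (measurable_pi_apply i) (measurableSet_singleton _)]
        rw [show (fun e : ι → ℝ => e i) = Function.eval i from rfl, Measure.infinitePi_map_eval]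
        exact measure_singleton _
    filter_upwards [measure_eq_zero_iff_ae_notMem.1 h0] with e he hsum
    refine absurd ?_ he
    change (∑ j ∈ l.support.erase i, fun e : ι → ℝ => (l j : ℝ) * e j) e + (l i : ℝ) * e i = 0
    rw [Finset.sum_apply, Finset.sum_erase_add _ _ hi, ← hsum, Finsupp.linearCombination_apply,
      Finsupp.sum]
    simp only [Rat.smul_def]
  filter_upwards [ae_all_iff.2 h] with e he
  exact linearIndependent_iff.2 he

theorem ae_isGeneric (lam : ℝ≥0∞) (μ : ℝ≥0) : ∀ᵐ ω ∂noiseLaw lam μ, IsGeneric ω := by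
  have h1 := ae_of_ae_sites (ae_forall_site (ae_site_isClock lam μ))
  have h2 := ae_of_ae_sites (ae_forall_site (ae_site_jumpsOften lam μ))
  have h3 := ae_of_ae_sites (ae_exists_long lam μ)
  have h4 : ∀ᵐ ω ∂noiseLaw lam μ, LinearIndependent ℚ ω.2.1 := by
    unfold noiseLaw
    exact Measure.quasiMeasurePreserving_snd.ae
      (Measure.quasiMeasurePreserving_fst.ae ae_linearIndependent)
  filter_upwards [h1, h2, h3, h4] with ω h1 h2 h3 h4
  exact ⟨h1, h4, h3, h2⟩

/-! ### Measurability and independence for the recursions from site to site -/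

theorem measurable_sInf_nat {Ω : Type*} [MeasurableSpace Ω] {p : ℕ → Ω → Prop}
    (hp : ∀ j, MeasurableSet {ω | p j ω}) : Measurable fun ω => sInf {j | p j ω} := by
  refine measurable_to_countable' fun n => ?_
  -- The second set accounts for `sInf ∅ = 0`.
  have h : (fun ω => sInf {j | p j ω}) ⁻¹' {n} =
      ({ω | p n ω} ∩ ⋂ j ∈ Finset.range n, {ω | p j ω}ᶜ) ∪ ({_ω | n = 0} ∩ ⋂ j, {ω | p j ω}ᶜ) := by
    ext ω
    simp only [Set.mem_preimage, Set.mem_singleton_iff, Set.mem_union, Set.mem_inter_iff,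
      Set.mem_iInter, Set.mem_compl_iff, Finset.mem_range, Set.mem_ofPred_eq]
    constructor
    · rintro rfl
      rcases Set.eq_empty_or_nonempty {j | p j ω} with he | he
      · refine Or.inr ⟨by rw [he, Nat.sInf_empty], fun j hj => ?_⟩
        exact (Set.eq_empty_iff_forall_notMem.1 he) j hj
      · exact Or.inl ⟨Nat.sInf_mem he, fun j hj => Nat.notMem_of_lt_sInf hj⟩
    · rintro (⟨h1, h2⟩ | ⟨rfl, h2⟩)
      · refine le_antisymm (Nat.sInf_le h1) (not_lt.1 fun hlt => ?_)
        exact h2 _ hlt (Nat.sInf_mem (s := {j | p j ω}) ⟨n, h1⟩)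
      · rw [Set.eq_empty_of_forall_notMem (s := {j | p j ω}) h2, Nat.sInf_empty]
  rw [h]
  exact ((hp n).inter (Finset.measurableSet_biInter _ fun j _ => (hp j).compl)).union
    ((MeasurableSet.const _).inter (MeasurableSet.iInter fun j => (hp j).compl))

/-- The σ-algebra of the noise at `x`. -/
abbrev siteAlgebra (x : ℤ) : MeasurableSpace (ℤ → SiteNoise) :=
  MeasurableSpace.comap (fun σ => σ x) inferInstance

/-- The σ-algebra of the noise at the sites to the left of `x`. -/
abbrev leftAlgebra (x : ℤ) : MeasurableSpace (ℤ → SiteNoise) :=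
  ⨆ y ∈ Set.Iio x, siteAlgebra y

theorem siteAlgebra_le (x : ℤ) : siteAlgebra x ≤ MeasurableSpace.pi :=
  (measurable_pi_apply x).comap_le

theorem leftAlgebra_le (x : ℤ) : leftAlgebra x ≤ MeasurableSpace.pi :=
  iSup₂_le fun y _ => siteAlgebra_le y

theorem leftAlgebra_mono {x y : ℤ} (h : x ≤ y) : leftAlgebra x ≤ leftAlgebra y :=
  biSup_mono fun _ hz => lt_of_lt_of_le hz h

theorem siteAlgebra_le_leftAlgebra {x y : ℤ} (h : x < y) : siteAlgebra x ≤ leftAlgebra y :=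
  le_iSup₂_of_le x h le_rfl

theorem iIndep_siteAlgebra (ν : Measure SiteNoise) [IsProbabilityMeasure ν] :
    iIndep siteAlgebra (Measure.infinitePi fun _ : ℤ => ν) :=
  iIndepFun_infinitePi (P := fun _ : ℤ => ν) (X := fun _ x => x) fun _ => measurable_id

section Chain

variable {X : Type*} [MeasurableSpace X] {F : X → SiteNoise → X}

theorem measurable_chain (hF : Measurable fun p : X × SiteNoise => F p.1 p.2) (z : X) (y : ℤ)
    (n : ℕ) : Measurable[leftAlgebra (y + n)] fun σ => chain F z σ y n := by
  induction n with
  | zero => exact @measurable_const _ _ _ (leftAlgebra (y + (0 : ℕ))) _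
  | succ n ih =>
    have h1 : Measurable[leftAlgebra (y + (n + 1 : ℕ))] fun σ => chain F z σ y n :=
      ih.mono (leftAlgebra_mono (by push_cast; omega)) le_rfl
    have h2 : Measurable[leftAlgebra (y + (n + 1 : ℕ))] fun σ : ℤ → SiteNoise => σ (y + n) :=
      (comap_measurable _).mono (siteAlgebra_le_leftAlgebra (by push_cast; omega)) le_rfl
    exact hF.comp (h1.prodMk h2)

theorem measurable_chain' (hF : Measurable fun p : X × SiteNoise => F p.1 p.2) (z : X) (y : ℤ)
    (n : ℕ) : Measurable fun σ => chain F z σ y n :=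
  (measurable_chain hF z y n).mono (leftAlgebra_le _) le_rfl

/-- The state of the recursion and the noise at the next site are independent. -/
theorem lintegral_chain (ν : Measure SiteNoise) [IsProbabilityMeasure ν]
    (hF : Measurable fun p : X × SiteNoise => F p.1 p.2) (z : X) (y : ℤ) (n : ℕ)
    {g : X × SiteNoise → ℝ≥0∞} (hg : Measurable g) :
    ∫⁻ σ, g (chain F z σ y n, σ (y + n)) ∂(Measure.infinitePi fun _ : ℤ => ν) =
      ∫⁻ σ, ∫⁻ s, g (chain F z σ y n, s) ∂ν ∂(Measure.infinitePi fun _ : ℤ => ν) := by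
  set P := Measure.infinitePi fun _ : ℤ => ν with hP
  have hind : IndepFun (fun σ => chain F z σ y n) (fun σ : ℤ → SiteNoise => σ (y + n)) P := by
    have h1 := indep_iSup_of_disjoint siteAlgebra_le (iIndep_siteAlgebra ν)
      (S := Set.Iio (y + n)) (T := {y + (n : ℤ)}) (by simp)
    rw [iSup_singleton] at h1
    exact indep_of_indep_of_le_left h1 (measurable_chain hF z y n).comap_le
  have h1 := measurable_chain' hF z y n
  have h2 : Measurable fun σ : ℤ → SiteNoise => σ (y + n) := measurable_pi_apply _
  have hmap := hind.map_prod_eq_prod_map_map h1.aemeasurable h2.aemeasurable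
  have hν : P.map (fun σ : ℤ → SiteNoise => σ (y + n)) = ν :=
    Measure.infinitePi_map_eval (fun _ : ℤ => ν) (y + n)
  rw [← lintegral_map (f := g) (g := fun σ => (chain F z σ y n, σ (y + n))) hg (h1.prodMk h2),
    hmap, hν, lintegral_prod _ hg.aemeasurable,
    lintegral_map (Measurable.lintegral_prod_right' hg) h1]

theorem measure_chain (ν : Measure SiteNoise) [IsProbabilityMeasure ν]
    (hF : Measurable fun p : X × SiteNoise => F p.1 p.2) (z : X) (y : ℤ) (n : ℕ)
    {G : Set (X × SiteNoise)} (hG : MeasurableSet G) :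
    (Measure.infinitePi fun _ : ℤ => ν) {σ | (chain F z σ y n, σ (y + n)) ∈ G} =
      ∫⁻ σ, ν {s | (chain F z σ y n, s) ∈ G} ∂(Measure.infinitePi fun _ : ℤ => ν) := by
  have h := lintegral_chain ν hF z y n (measurable_one.indicator hG : Measurable (G.indicator 1))
  have hm : Measurable fun σ : ℤ → SiteNoise => (chain F z σ y n, σ (y + n)) :=
    (measurable_chain' hF z y n).prodMk (measurable_pi_apply _)
  have h1 : ∀ σ, ∫⁻ s, G.indicator 1 (chain F z σ y n, s) ∂ν = ν {s | (chain F z σ y n, s) ∈ G} :=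
    fun σ => lintegral_indicator_one (measurable_prodMk_left hG)
  have h2 : ∫⁻ σ, G.indicator 1 (chain F z σ y n, σ (y + n)) ∂(Measure.infinitePi fun _ : ℤ => ν) =
      (Measure.infinitePi fun _ : ℤ => ν) {σ | (chain F z σ y n, σ (y + n)) ∈ G} :=
    lintegral_indicator_one (hm hG)
  simp_rw [h1] at h
  rw [← h2, h]

end Chain

theorem chain_succ_left {X : Type*} (F : X → SiteNoise → X) (z : X) (σ : ℤ → SiteNoise) (y : ℤ)
    (n : ℕ) : chain F z σ y (n + 1) = chain F (F z (σ y)) σ (y + 1) n := by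
  induction n with
  | zero => simp [chain]
  | succ n ih =>
    rw [chain, ih, chain]
    congr 2
    push_cast
    ring

/-- Starting one site further left replaces the minimal state at the old starting point by a larger
one, and monotone steps preserve the order. -/
theorem chain_mono_left {X : Type*} [Preorder X] {F : X → SiteNoise → X} {σ : ℤ → SiteNoise}
    (hF : ∀ x, Monotone fun w => F w (σ x)) {z : X} (hz : ∀ w, z ≤ w) (x : ℤ) :
    Monotone fun n : ℕ => chain F z σ (x - n) n := by
  have hmono : ∀ (n : ℕ) (y : ℤ) (w w' : X), w ≤ w' → chain F w σ y n ≤ chain F w' σ y n := by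
    intro n y w w' hw
    induction n with
    | zero => exact hw
    | succ n ih => exact hF _ ih
  refine monotone_nat_of_le_succ fun n => ?_
  rw [chain_succ_left]
  have : x - ((n + 1 : ℕ) : ℤ) + 1 = x - n := by push_cast; ring
  rw [this]
  exact hmono n _ _ _ (hz _)

/-! ### The number of rings in a given internal time -/

theorem measurable_clockSum (n : ℕ) : Measurable fun e : ℕ → ℝ => clockSum e n := by
  unfold clockSum
  fun_prop

theorem measurable_ringCount : Measurable fun p : (ℕ → ℝ) × ℝ => ringCount p.1 p.2 :=
  measurable_sInf_nat fun j =>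
    measurableSet_lt measurable_snd ((measurable_clockSum (j + 1)).comp measurable_fst)

/-- The renewal equation of a Poisson clock: a waiting time `s ≤ u` accounts for one ring and leaves
time `u - s`, with mean `u - s`, for the others. -/
theorem lintegral_expMeasure_eq {u : ℝ} (hu : 0 ≤ u) :
    ∫⁻ s, (Set.Iic u).indicator (fun s => ENNReal.ofReal (1 + u - s)) s ∂expMeasure 1 =
      ENNReal.ofReal u := by
  have hpdf : expMeasure 1 = volume.withDensity (exponentialPDF 1) := rfl
  have hmp : Measurable (exponentialPDF 1) := (measurable_exponentialPDFReal 1).ennreal_ofReal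
  rw [hpdf, lintegral_withDensity_eq_lintegral_mul _ hmp
    (Measurable.indicator (by fun_prop) measurableSet_Iic)]
  have hfun : ∀ s, (exponentialPDF 1 * (Set.Iic u).indicator
      fun s => ENNReal.ofReal (1 + u - s)) s =
      (Set.Icc 0 u).indicator (fun s => ENNReal.ofReal ((1 + u - s) * Real.exp (-s))) s := fun s => by
    rw [Pi.mul_apply]
    by_cases h0 : 0 ≤ s
    · by_cases h1 : s ≤ u
      · rw [Set.indicator_of_mem (Set.mem_Iic.2 h1), Set.indicator_of_mem (Set.mem_Icc.2 ⟨h0, h1⟩),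
          exponentialPDF_of_nonneg h0, mul_comm, ← ENNReal.ofReal_mul (by linarith)]
        simp
      · rw [Set.indicator_of_notMem (by simpa using h1), mul_zero, Set.indicator_of_notMem]
        exact fun h => h1 h.2
    · rw [exponentialPDF_of_neg (not_le.1 h0), zero_mul, Set.indicator_of_notMem]
      exact fun h => h0 h.1
  simp_rw [hfun]
  rw [lintegral_indicator measurableSet_Icc]
  have hcont : Continuous fun s : ℝ => (1 + u - s) * Real.exp (-s) := by fun_prop
  rw [← ofReal_integral_eq_lintegral_ofReal (hcont.integrableOn_Icc)
    (ae_restrict_of_forall_mem measurableSet_Icc fun s hs =>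
      mul_nonneg (by linarith [hs.2]) (Real.exp_pos _).le),
    integral_Icc_eq_integral_Ioc, ← intervalIntegral.integral_of_le hu,
    intervalIntegral.integral_eq_sub_of_hasDerivAt (f := fun s => -((u - s) * Real.exp (-s)))
      (fun s _ => ?_) (hcont.intervalIntegrable _ _)]
  · simp
  · have h1 : HasDerivAt (fun s : ℝ => u - s) (-1) s := (hasDerivAt_id s).const_sub u
    have h2 : HasDerivAt (fun s : ℝ => Real.exp (-s)) (Real.exp (-s) * (-1)) s :=
      (hasDerivAt_neg s).exp
    refine ((h1.mul h2).neg.congr_deriv ?_)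
    ring

theorem clockLaw_clockSum_succ (n : ℕ) (u : ℝ) :
    clockLaw {e | clockSum e (n + 1) ≤ u} =
      ∫⁻ s, clockLaw {e | clockSum e n ≤ u - s} ∂expMeasure 1 := by
  have hind : IndepFun (∑ j ∈ Finset.range n, fun e : ℕ → ℝ => e j) (fun e : ℕ → ℝ => e n)
      clockLaw :=
    (iIndepFun_infinitePi (P := fun _ : ℕ => expMeasure 1) (X := fun _ x => x)
      fun _ => measurable_id).indepFun_finsetSum_of_notMem (fun j => measurable_pi_apply j)
        (by simp)
  have hsum : (∑ j ∈ Finset.range n, fun e : ℕ → ℝ => e j) = fun e => clockSum e n := by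
    ext e
    simp [clockSum]
  rw [hsum] at hind
  have h1 := measurable_clockSum n
  have h2 : Measurable fun e : ℕ → ℝ => e n := measurable_pi_apply n
  have hs : MeasurableSet {p : ℝ × ℝ | p.1 + p.2 ≤ u} := measurableSet_le (by fun_prop) (by fun_prop)
  have hset : {e | clockSum e (n + 1) ≤ u} =
      (fun e => (clockSum e n, e n)) ⁻¹' {p : ℝ × ℝ | p.1 + p.2 ≤ u} := by
    ext e
    simp [clockSum_succ]
  have hmap : clockLaw.map (fun e : ℕ → ℝ => e n) = expMeasure 1 :=
    Measure.infinitePi_map_eval (fun _ : ℕ => expMeasure 1) n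
  rw [hset, ← Measure.map_apply (h1.prodMk h2) hs,
    hind.map_prod_eq_prod_map_map h1.aemeasurable h2.aemeasurable, hmap,
    Measure.prod_apply_symm hs]
  refine lintegral_congr fun s => ?_
  rw [Measure.map_apply h1 (measurable_prodMk_right hs)]
  congr 1
  ext e
  simp [le_sub_iff_add_le]

/-- Truncated renewal argument: splitting off one waiting time and applying the induction hypothesis
at `u - s` produces the integrand of `lintegral_expMeasure_eq`. Negative `u` must be allowed since
`u - s` may be negative. -/
theorem sum_clockLaw_le (n : ℕ) (u : ℝ) :
    ∑ j ∈ Finset.range n, clockLaw {e | clockSum e (j + 1) ≤ u} ≤ ENNReal.ofReal u := by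
  induction n generalizing u with
  | zero => simp
  | succ n ih =>
    have hm : ∀ j, Measurable fun s : ℝ => clockLaw {e | clockSum e j ≤ u - s} := fun j => by
      have hs : MeasurableSet {p : ℝ × (ℕ → ℝ) | clockSum p.2 j ≤ u - p.1} :=
        measurableSet_le ((measurable_clockSum j).comp measurable_snd) (by fun_prop)
      exact measurable_measure_prodMk_left hs
    simp_rw [clockLaw_clockSum_succ]
    rw [← lintegral_finsetSum _ fun j _ => hm j]
    have hbound : ∀ s, ∑ j ∈ Finset.range (n + 1), clockLaw {e | clockSum e j ≤ u - s} ≤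
        (Set.Iic u).indicator (fun s => ENNReal.ofReal (1 + u - s)) s := fun s => by
      rw [Finset.sum_range_succ']
      by_cases hs : s ≤ u
      · rw [Set.indicator_of_mem (Set.mem_Iic.2 hs), show 1 + u - s = (u - s) + 1 by ring,
          ENNReal.ofReal_add (by linarith) zero_le_one, ENNReal.ofReal_one]
        exact add_le_add (ih (u - s)) prob_le_one
      · have h0 : {e : ℕ → ℝ | clockSum e 0 ≤ u - s} = ∅ := by
          ext e
          simp only [clockSum_zero, Set.mem_ofPred_eq, Set.mem_empty_iff_false, iff_false]
          linarith
        have h1 := ih (u - s)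
        rw [ENNReal.ofReal_of_nonpos (by linarith)] at h1
        rw [h0, measure_empty, add_zero]
        exact h1.trans zero_le
    refine (lintegral_mono hbound).trans ?_
    rcases le_or_gt 0 u with hu | hu
    · rw [lintegral_expMeasure_eq hu]
    · refine le_of_eq_of_le (lintegral_eq_zero_of_ae_eq_zero ?_) zero_le
      filter_upwards [ae_pos_expMeasure] with s hs
      rw [Set.indicator_of_notMem (by simp only [Set.mem_Iic]; linarith)]
      rfl

/-- The ring count is dominated by the sum of the indicators that ring `j + 1` has come by `u`. -/
theorem lintegral_ringCount_le (u : ℝ) :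
    ∫⁻ e, (ringCount e u : ℝ≥0∞) ∂clockLaw ≤ ENNReal.ofReal u := by
  have hle : ∀ e : ℕ → ℝ, (ringCount e u : ℝ≥0∞) ≤
      ∑' j : ℕ, {e : ℕ → ℝ | clockSum e (j + 1) ≤ u}.indicator 1 e := fun e => by
    refine le_trans (le_of_eq ?_) (ENNReal.sum_le_tsum (Finset.range (ringCount e u)))
    have h1 : ∀ j ∈ Finset.range (ringCount e u),
        {e : ℕ → ℝ | clockSum e (j + 1) ≤ u}.indicator (1 : (ℕ → ℝ) → ℝ≥0∞) e = 1 := fun j hj => by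
      have hlt : j < sInf {j | u < clockSum e (j + 1)} := Finset.mem_range.1 hj
      have h2 : ¬ u < clockSum e (j + 1) :=
        Nat.notMem_of_lt_sInf (s := {j | u < clockSum e (j + 1)}) hlt
      exact Set.indicator_of_mem (Set.mem_ofPred_eq ▸ not_lt.1 h2) _
    rw [Finset.sum_congr rfl h1]
    simp
  have hms : ∀ j, MeasurableSet {e : ℕ → ℝ | clockSum e (j + 1) ≤ u} := fun j =>
    measurableSet_le (measurable_clockSum _) measurable_const
  refine (lintegral_mono hle).trans ?_
  rw [lintegral_tsum fun j => (measurable_one.indicator (hms j)).aemeasurable]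
  simp_rw [lintegral_indicator_one (hms _)]
  rw [ENNReal.tsum_eq_iSup_nat]
  exact iSup_le fun n => sum_clockLaw_le n u

/-! ### Blocks -/

theorem lintegral_pow_poissonMeasure (μ : ℝ≥0) {s : ℝ} (hs : 0 ≤ s) :
    ∫⁻ k, ENNReal.ofReal (s ^ k) ∂poissonMeasure μ = ENNReal.ofReal (Real.exp (μ * (s - 1))) := by
  have hsum : HasSum (fun n : ℕ => Real.exp (-μ) * ((μ * s) ^ n / n.factorial))
      (Real.exp (-μ) * Real.exp (μ * s)) := by
    refine HasSum.mul_left _ ?_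
    rw [Real.exp_eq_exp_ℝ]
    exact NormedSpace.expSeries_div_hasSum_exp (μ * s : ℝ)
  have hnn : ∀ n : ℕ, 0 ≤ Real.exp (-μ) * ((μ * s) ^ n / n.factorial) := fun n => by
    have : 0 ≤ (μ : ℝ) := μ.2
    positivity
  have hterm : ∀ n : ℕ, ENNReal.ofReal (Real.exp (-μ) * μ ^ n / n.factorial) *
      ENNReal.ofReal (s ^ n) = ENNReal.ofReal (Real.exp (-μ) * ((μ * s) ^ n / n.factorial)) :=
    fun n => by
      have : 0 ≤ (μ : ℝ) := μ.2
      rw [← ENNReal.ofReal_mul (by positivity)]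
      congr 1
      rw [mul_pow]
      ring
  have hexp : Real.exp (μ * (s - 1)) = Real.exp (-μ) * Real.exp (μ * s) := by
    rw [← Real.exp_add]
    ring_nf
  unfold poissonMeasure
  rw [lintegral_sum_measure]
  simp_rw [lintegral_smul_measure, lintegral_dirac, smul_eq_mul, hterm]
  rw [← ENNReal.ofReal_tsum_of_nonneg hnn hsum.summable, hsum.tsum_eq, hexp]

/-! ### Means of the crude bounds -/

/-- The mean of the Poisson distribution. -/
noncomputable def poissonMean (μ : ℝ≥0) : ℝ≥0∞ := ∫⁻ k, (k : ℝ≥0∞) ∂poissonMeasure μ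

theorem poissonMean_ne_top (μ : ℝ≥0) : poissonMean μ ≠ ⊤ := by
  have h := lintegral_pow_poissonMeasure μ (s := 2) zero_le_two
  refine ne_top_of_le_ne_top (b := ENNReal.ofReal (Real.exp (μ * (2 - 1)))) ENNReal.ofReal_ne_top ?_
  rw [← h]
  refine lintegral_mono fun k => ?_
  rw [← ENNReal.ofReal_natCast]
  exact ENNReal.ofReal_le_ofReal (by exact_mod_cast Nat.lt_two_pow_self.le)

theorem measurable_crudeTime (i : ℕ) :
    Measurable fun p : (ℕ → ℕ) × ℕ => crudeTime p.1 p.2 i := by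
  have h : ∀ l, Measurable fun p : (ℕ → ℕ) × ℕ => ((p.2 + p.1 l : ℕ) : ℝ) / 2 := fun l => by
    have h1 : Measurable fun p : (ℕ → ℕ) × ℕ => p.1 l :=
      (measurable_pi_apply l).comp measurable_fst
    have h2 : Measurable fun p : (ℕ → ℕ) × ℕ => p.2 + p.1 l := measurable_snd.add h1
    exact (measurable_of_countable fun k : ℕ => (k : ℝ) / 2).comp h2
  exact Finset.measurable_sum _ fun l _ => h l

theorem measurable_crudeTime' (i : ℕ) :
    Measurable fun p : (ℕ → ℕ) × SiteNoise => crudeTime p.1 p.2.1 i := by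
  have h : Measurable fun p : (ℕ → ℕ) × SiteNoise => (p.1, p.2.1) := by fun_prop
  have := (measurable_crudeTime i).comp h
  unfold Function.comp at this
  exact this

theorem measurable_crudeStep : Measurable fun p : (ℕ → ℕ) × SiteNoise => crudeStep p.1 p.2 :=
  measurable_pi_lambda _ fun i => measurable_ringCount.comp
    (measurable_snd.snd.fst.prodMk (measurable_crudeTime' i))

theorem ofReal_crudeTime (α : ℕ → ℕ) (n i : ℕ) : ENNReal.ofReal (crudeTime α n i) =
    ∑ l ∈ Finset.range (i + 1), ((n : ℝ≥0∞) + α l) * 2⁻¹ := by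
  unfold crudeTime
  rw [ENNReal.ofReal_sum_of_nonneg fun _ _ => by positivity]
  refine Finset.sum_congr rfl fun l _ => ?_
  rw [ENNReal.ofReal_div_of_pos two_pos, ENNReal.ofReal_natCast, div_eq_mul_inv]
  simp

theorem lintegral_crudeTime (μ : ℝ≥0) (α : ℕ → ℕ) (i : ℕ) :
    ∫⁻ k, ENNReal.ofReal (crudeTime α k i) ∂poissonMeasure μ =
      ∑ l ∈ Finset.range (i + 1), (poissonMean μ + α l) * 2⁻¹ := by
  simp_rw [ofReal_crudeTime]
  rw [lintegral_finsetSum _ fun l _ => measurable_of_countable _]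
  refine Finset.sum_congr rfl fun l _ => ?_
  rw [lintegral_mul_const _ (measurable_of_countable _),
    lintegral_add_right _ measurable_const, lintegral_const, measure_univ, mul_one]
  rfl

theorem lintegral_site_fst {lam : ℝ≥0∞} {μ : ℝ≥0} (f : ℕ → ℝ≥0∞) :
    ∫⁻ s, f s.1 ∂siteLaw lam μ = ∫⁻ k, f k ∂poissonMeasure μ :=
  measurePreserving_fst.lintegral_comp (measurable_of_countable f)

theorem lintegral_crudeStep_le (lam : ℝ≥0∞) (μ : ℝ≥0) (α : ℕ → ℕ) (i : ℕ) :
    ∫⁻ s, (crudeStep α s i : ℝ≥0∞) ∂siteLaw lam μ ≤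
      ∑ l ∈ Finset.range (i + 1), (poissonMean μ + α l) * 2⁻¹ := by
  have hm : Measurable fun s : SiteNoise => (crudeStep α s i : ℝ≥0∞) :=
    (measurable_of_countable fun k : ℕ => (k : ℝ≥0∞)).comp
      ((measurable_pi_apply i).comp (measurable_crudeStep.comp measurable_prodMk_left))
  rw [← lintegral_crudeTime, siteLaw, lintegral_prod _ hm.aemeasurable]
  refine lintegral_mono fun k => ?_
  have hm' : Measurable fun e : ℕ → ℝ => (ringCount e (crudeTime α k i) : ℝ≥0∞) :=
    (measurable_of_countable fun k : ℕ => (k : ℝ≥0∞)).comp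
      (measurable_ringCount.comp measurable_prodMk_right)
  exact ((measurePreserving_fst (μ := clockLaw) (ν := instrLaw lam)).lintegral_comp hm').trans_le
    (lintegral_ringCount_le _)

/-- Because of the factor `2⁻¹` from the slice length, the bounds `(2 ^ (l + 1) - 1) * m` reproduce
themselves from site to site. The form with `+ m` avoids subtraction in `ℝ≥0∞`. -/
theorem sum_two_pow_add (i : ℕ) (m : ℝ≥0∞) :
    ∑ l ∈ Finset.range (i + 1), 2 ^ (l + 1) * m * 2⁻¹ + m = 2 ^ (i + 1) * m := by
  have h2 : (2 : ℝ≥0∞) * 2⁻¹ = 1 := ENNReal.mul_inv_cancel two_ne_zero ENNReal.ofNat_ne_top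
  have hterm : ∀ l : ℕ, 2 ^ (l + 1) * m * 2⁻¹ = 2 ^ l * m := fun l => by
    rw [pow_succ, mul_right_comm, mul_assoc (2 ^ l), h2, mul_one]
  simp_rw [hterm]
  induction i with
  | zero =>
    rw [zero_add, Finset.sum_range_one, pow_zero, one_mul, pow_one, two_mul]
  | succ i ih =>
    rw [Finset.sum_range_succ, add_right_comm, ih, ← add_mul, ← two_mul, ← pow_succ']

section Mean

variable (lam : ℝ≥0∞) (μ : ℝ≥0) (y : ℤ)

/-- The law of the noise, sorted by sites. -/
noncomputable abbrev sitesLaw (lam : ℝ≥0∞) (μ : ℝ≥0) : Measure (ℤ → SiteNoise) :=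
  Measure.infinitePi fun _ : ℤ => siteLaw lam μ

theorem lintegral_sum_chain_le (n i : ℕ)
    (h : ∀ l, ∫⁻ σ, (chain crudeStep (fun _ => 0) σ y n l : ℝ≥0∞) ∂sitesLaw lam μ +
      poissonMean μ ≤ 2 ^ (l + 1) * poissonMean μ) :
    ∫⁻ σ, ∑ l ∈ Finset.range (i + 1),
      (poissonMean μ + (chain crudeStep (fun _ => 0) σ y n l : ℝ≥0∞)) * 2⁻¹ ∂sitesLaw lam μ +
        poissonMean μ ≤ 2 ^ (i + 1) * poissonMean μ := by
  have hm : ∀ l, Measurable fun σ => (chain crudeStep (fun _ => 0) σ y n l : ℝ≥0∞) := fun l =>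
    (measurable_of_countable fun k : ℕ => (k : ℝ≥0∞)).comp
      ((measurable_pi_apply l).comp (measurable_chain' measurable_crudeStep _ y n))
  rw [lintegral_finsetSum _ fun l _ => ((hm l).const_add _).mul_const _,
    ← sum_two_pow_add i (poissonMean μ)]
  refine add_le_add (Finset.sum_le_sum fun l _ => ?_) le_rfl
  rw [lintegral_mul_const _ ((hm l).const_add _), lintegral_add_left measurable_const,
    lintegral_const, measure_univ, mul_one, add_comm]
  gcongr
  exact h l

/-- What matters is uniformity in `n`, that is, in how far to the left particles may start. The
current slice of the left neighbour enters with weight one half only, which keeps the recursion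
bounded. -/
theorem lintegral_chain_crudeStep_le (n i : ℕ) :
    ∫⁻ σ, (chain crudeStep (fun _ => 0) σ y n i : ℝ≥0∞) ∂sitesLaw lam μ + poissonMean μ ≤
      2 ^ (i + 1) * poissonMean μ := by
  induction n generalizing i with
  | zero =>
    simp only [chain, Nat.cast_zero, lintegral_zero, zero_add]
    exact le_mul_of_one_le_left' (one_le_pow₀ one_le_two)
  | succ n ih =>
    refine le_trans (add_le_add ?_ le_rfl) (lintegral_sum_chain_le lam μ y n i ih)
    have hm : Measurable fun p : (ℕ → ℕ) × SiteNoise => (crudeStep p.1 p.2 i : ℝ≥0∞) :=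
      (measurable_of_countable fun k : ℕ => (k : ℝ≥0∞)).comp
        ((measurable_pi_apply i).comp measurable_crudeStep)
    refine (lintegral_chain (siteLaw lam μ) measurable_crudeStep (fun _ => 0) y n hm).trans_le ?_
    exact lintegral_mono fun σ => lintegral_crudeStep_le lam μ _ i

theorem lintegral_chain_crudeTime_le (n i : ℕ) :
    ∫⁻ σ, ENNReal.ofReal (crudeTime (chain crudeStep (fun _ => 0) σ y n) (σ (y + n)).1 i)
      ∂sitesLaw lam μ ≤ 2 ^ (i + 1) * poissonMean μ := by
  refine le_trans ?_ ((le_self_add).trans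
    (lintegral_sum_chain_le lam μ y n i (lintegral_chain_crudeStep_le lam μ y n)))
  refine (lintegral_chain (siteLaw lam μ) measurable_crudeStep (fun _ => 0) y n
    (measurable_crudeTime' i).ennreal_ofReal).trans_le ?_
  refine lintegral_mono fun σ => ?_
  refine (lintegral_site_fst (fun k => ENNReal.ofReal (crudeTime _ k i))).trans_le ?_
  rw [lintegral_crudeTime]

/-- With probability bounded from below, the first ring at a site comes after the crude bound for
its internal time. -/
theorem exists_le_measure_crudeTime_lt (i : ℕ) : ∃ p ≠ 0, ∀ (y : ℤ) (n : ℕ),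
    p ≤ sitesLaw lam μ {σ | crudeTime (chain crudeStep (fun _ => 0) σ y n) (σ (y + n)).1 i <
      (σ (y + n)).2.1 0} := by
  set C := 2 ^ (i + 1) * poissonMean μ with hC
  have hCtop : C ≠ ⊤ :=
    ENNReal.mul_ne_top (ENNReal.pow_ne_top ENNReal.ofNat_ne_top) (poissonMean_ne_top μ)
  -- By Markov's inequality the crude bound, of mean at most `C`, exceeds `M` with probability at
  -- most one half; the `+ 1` makes `M` positive.
  set M : ℝ := 2 * C.toReal + 1 with hM
  have hMpos : 0 < M := by positivity
  refine ⟨2⁻¹ * expMeasure 1 (Set.Ioi M), mul_ne_zero (by simp) (expMeasure_Ioi_ne_zero M),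
    fun y n => ?_⟩
  set G : Set ((ℕ → ℕ) × SiteNoise) := {p | crudeTime p.1 p.2.1 i ≤ M} with hG
  have hGm : MeasurableSet G := measurableSet_le (measurable_crudeTime' i) measurable_const
  set G' : Set ((ℕ → ℕ) × SiteNoise) := {p | M < p.2.2.1 0} with hG'
  have hGm' : MeasurableSet G' := measurableSet_lt measurable_const (by fun_prop)
  -- The crude bound for the internal time uses the initial particles of the site and the sites to
  -- its left, but not the site's own clock.
  have hprod : ∀ α : ℕ → ℕ, siteLaw lam μ {s | (α, s) ∈ G ∩ G'} =
      siteLaw lam μ {s | (α, s) ∈ G} * expMeasure 1 (Set.Ioi M) := fun α => by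
    have h1 : {s : SiteNoise | (α, s) ∈ G ∩ G'} =
        {k | crudeTime α k i ≤ M} ×ˢ ({e : ℕ → ℝ | e 0 ∈ Set.Ioi M} ×ˢ Set.univ) := by
      ext s
      simp [hG, hG']
    have h2 : {s : SiteNoise | (α, s) ∈ G} = {k | crudeTime α k i ≤ M} ×ˢ Set.univ := by
      ext s
      simp [hG]
    have h3 : clockLaw {e : ℕ → ℝ | e 0 ∈ Set.Ioi M} = expMeasure 1 (Set.Ioi M) :=
      (measurePreserving_eval_infinitePi (fun _ : ℕ => expMeasure 1) 0).measure_preimage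
        measurableSet_Ioi.nullMeasurableSet
    rw [h1, h2, siteLaw, Measure.prod_prod, Measure.prod_prod, Measure.prod_prod, h3,
      measure_univ, measure_univ, mul_one, mul_one]
  have hhalf : 2⁻¹ ≤ sitesLaw lam μ
      {σ | (chain crudeStep (fun _ => 0) σ y n, σ (y + n)) ∈ G} := by
    have hm : Measurable fun σ : ℤ → SiteNoise =>
        (chain crudeStep (fun _ => 0) σ y n, σ (y + n)) :=
      (measurable_chain' measurable_crudeStep _ y n).prodMk (measurable_pi_apply _)
    have hcompl : sitesLaw lam μ {σ | (chain crudeStep (fun _ => 0) σ y n, σ (y + n)) ∈ G}ᶜ ≤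
        2⁻¹ := by
      have hsub : {σ | (chain crudeStep (fun _ => 0) σ y n, σ (y + n)) ∈ G}ᶜ ⊆
          {σ | ENNReal.ofReal M ≤ ENNReal.ofReal
            (crudeTime (chain crudeStep (fun _ => 0) σ y n) (σ (y + n)).1 i)} := fun σ hσ => by
        have hσ : ¬ crudeTime (chain crudeStep (fun _ => 0) σ y n) (σ (y + n)).1 i ≤ M := hσ
        exact ENNReal.ofReal_le_ofReal (not_le.1 hσ).le
      refine (measure_mono hsub).trans ((meas_ge_le_lintegral_div
        ((measurable_crudeTime' i).comp hm).ennreal_ofReal.aemeasurable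
        (by simpa using hMpos) ENNReal.ofReal_ne_top).trans ?_)
      refine (ENNReal.div_le_div_right (lintegral_chain_crudeTime_le lam μ y n i) _).trans ?_
      rw [← hC, ENNReal.div_le_iff (by simpa using hMpos) ENNReal.ofReal_ne_top,
        ← ENNReal.ofReal_toReal hCtop, show (2 : ℝ≥0∞)⁻¹ = ENNReal.ofReal 2⁻¹ by
          rw [ENNReal.ofReal_inv_of_pos two_pos]; simp, ← ENNReal.ofReal_mul (by norm_num)]
      refine ENNReal.ofReal_le_ofReal ?_
      rw [hM]
      linarith
    have h1 := prob_add_prob_compl (μ := sitesLaw lam μ) (hm hGm)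
    have h2 : (1 : ℝ≥0∞) ≤ sitesLaw lam μ
        {σ | (chain crudeStep (fun _ => 0) σ y n, σ (y + n)) ∈ G} + 2⁻¹ := by
      rw [← h1]
      exact add_le_add le_rfl hcompl
    rw [← ENNReal.inv_two_add_inv_two] at h2
    exact (ENNReal.add_le_add_iff_right (by simp)).1 h2
  calc 2⁻¹ * expMeasure 1 (Set.Ioi M)
      ≤ sitesLaw lam μ {σ | (chain crudeStep (fun _ => 0) σ y n, σ (y + n)) ∈ G} *
        expMeasure 1 (Set.Ioi M) := by gcongr
    _ = sitesLaw lam μ {σ | (chain crudeStep (fun _ => 0) σ y n, σ (y + n)) ∈ G ∩ G'} := by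
      rw [measure_chain _ measurable_crudeStep _ _ _ hGm,
        measure_chain _ measurable_crudeStep _ _ _ (hGm.inter hGm')]
      simp_rw [hprod]
      rw [lintegral_mul_const']
      exact measure_ne_top _ _
    _ ≤ _ := measure_mono fun σ hσ => by
      have h1 : crudeTime (chain crudeStep (fun _ => 0) σ y n) (σ (y + n)).1 i ≤ M := hσ.1
      have h2 : M < (σ (y + n)).2.1 0 := hσ.2
      exact h1.trans_lt h2

end Mean

/-- The first ring at `y` comes after the crude bounds for the internal time of `y` at the end of
the `i`-th time slice. -/
def IsBlock (i : ℕ) (σ : ℤ → SiteNoise) (y : ℤ) : Prop :=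
  ∀ n : ℕ, crudeTime (chain crudeStep (fun _ => 0) σ (y - n) n) (σ y).1 i < (σ y).2.1 0

theorem measurableSet_crudeTime_lt (i : ℕ) (y : ℤ) (n : ℕ) :
    MeasurableSet[leftAlgebra (y + 1)] {σ : ℤ → SiteNoise |
      crudeTime (chain crudeStep (fun _ => 0) σ (y - n) n) (σ y).1 i < (σ y).2.1 0} := by
  have h1 : Measurable[leftAlgebra (y + 1)] fun σ => chain crudeStep (fun _ => 0) σ (y - n) n :=
    (measurable_chain measurable_crudeStep _ (y - n) n).mono (leftAlgebra_mono (by omega)) le_rfl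
  have h2 : Measurable[leftAlgebra (y + 1)] fun σ : ℤ → SiteNoise => σ y :=
    (comap_measurable _).mono (siteAlgebra_le_leftAlgebra (by omega)) le_rfl
  have hset : MeasurableSet {p : (ℕ → ℕ) × SiteNoise | crudeTime p.1 p.2.1 i < p.2.2.1 0} :=
    measurableSet_lt (measurable_crudeTime' i) (by fun_prop)
  exact (h1.prodMk h2) hset

theorem measurableSet_isBlock (i : ℕ) (y : ℤ) :
    MeasurableSet[leftAlgebra (y + 1)] {σ : ℤ → SiteNoise | IsBlock i σ y} := by
  have : {σ : ℤ → SiteNoise | IsBlock i σ y} = ⋂ n : ℕ, {σ : ℤ → SiteNoise |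
      crudeTime (chain crudeStep (fun _ => 0) σ (y - n) n) (σ y).1 i < (σ y).2.1 0} := by
    ext σ
    simp [IsBlock]
  rw [this]
  exact @MeasurableSet.iInter _ _ (leftAlgebra (y + 1)) _ _ fun n => measurableSet_crudeTime_lt i y n

theorem crudeTime_mono {α α' : ℕ → ℕ} (h : α ≤ α') (n i : ℕ) :
    crudeTime α n i ≤ crudeTime α' n i := by
  refine Finset.sum_le_sum fun l _ => ?_
  have : ((n + α l : ℕ) : ℝ) ≤ (n + α' l : ℕ) := by exact_mod_cast Nat.add_le_add_left (h l) n
  linarith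

theorem crudeTime_nonneg (α : ℕ → ℕ) (n i : ℕ) : 0 ≤ crudeTime α n i :=
  Finset.sum_nonneg fun _ _ => by positivity

/-- More sites on the left can only raise the crude bound, so the events for the various `n` are
almost surely decreasing and their common lower bound passes to the intersection. -/
theorem exists_le_measure_isBlock (lam : ℝ≥0∞) (μ : ℝ≥0) (i : ℕ) :
    ∃ p ≠ 0, ∀ y : ℤ, p ≤ sitesLaw lam μ {σ | IsBlock i σ y} := by
  obtain ⟨p, hp, h⟩ := exists_le_measure_crudeTime_lt lam μ i
  refine ⟨p, hp, fun y => ?_⟩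
  set B : ℕ → Set (ℤ → SiteNoise) := fun n => {σ : ℤ → SiteNoise |
    crudeTime (chain crudeStep (fun _ => 0) σ (y - n) n) (σ y).1 i < (σ y).2.1 0} with hB
  have hBm : ∀ n, MeasurableSet (B n) := fun n => leftAlgebra_le _ _ (measurableSet_crudeTime_lt i y n)
  have hBp : ∀ n, p ≤ sitesLaw lam μ (B n) := fun n => by
    have := h (y - n) n
    simpa only [sub_add_cancel] using this
  have hae : ∀ n, B n =ᵐ[sitesLaw lam μ] ⋂ m ≤ n, B m := fun n => by
    filter_upwards [ae_forall_site (ae_site_isClock lam μ)] with σ hσ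
    refine propext ⟨fun hn => Set.mem_iInter₂.2 fun m hm => ?_, fun hn => Set.mem_iInter₂.1 hn n le_rfl⟩
    refine lt_of_le_of_lt (crudeTime_mono ?_ _ _) (show _ < _ from hn)
    exact chain_mono_left (F := crudeStep) (z := fun _ => 0) (fun x w w' hw j =>
      (hσ x).ringCount_mono (crudeTime_nonneg _ _ _) (crudeTime_mono hw _ _))
        (fun w j => Nat.zero_le _) y hm
  have hset : {σ : ℤ → SiteNoise | IsBlock i σ y} = ⋂ n, ⋂ m ≤ n, B m := by
    ext σ
    simp only [Set.mem_iInter, hB, IsBlock, Set.mem_ofPred_eq]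
    exact ⟨fun h n m _ => h m, fun h n => h n n le_rfl⟩
  rw [hset, Antitone.measure_iInter]
  · exact le_iInf fun n => (hBp n).trans_eq (measure_congr (hae n))
  · intro m n hmn
    exact Set.biInter_mono (fun k hk => le_trans hk hmn) fun _ _ => le_rfl
  · exact fun n => (MeasurableSet.biInter (Set.to_countable _) fun m _ => hBm m).nullMeasurableSet
  · exact ⟨0, measure_ne_top _ _⟩

/-- By the zero-one law, there are almost surely blocks arbitrarily far to the left. -/
theorem ae_exists_isBlock (lam : ℝ≥0∞) (μ : ℝ≥0) :
    ∀ᵐ σ ∂sitesLaw lam μ, ∀ (i : ℕ) (x : ℤ), ∃ y < x, IsBlock i σ y := by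
  have key : ∀ i : ℕ, ∀ᵐ σ ∂sitesLaw lam μ, ∀ N : ℕ, ∃ k ≥ N, IsBlock i σ (-(k : ℤ)) := fun i => by
    obtain ⟨p, hp, hle⟩ := exists_le_measure_isBlock lam μ i
    set U : ℕ → Set (ℤ → SiteNoise) := fun N => ⋃ k ≥ N, {σ | IsBlock i σ (-(k : ℤ))} with hU
    have hanti : Antitone U := fun M N hMN =>
      Set.biUnion_mono (fun k hk => le_trans hMN hk) fun _ _ => le_rfl
    have hUm : ∀ a : ℤ, ∀ N : ℕ, -(N : ℤ) ≤ a - 1 → MeasurableSet[leftAlgebra a] (U N) :=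
      fun a N hN => @MeasurableSet.biUnion _ _ (leftAlgebra a) _ _ (Set.to_countable _) fun k hk =>
        leftAlgebra_mono (by have : N ≤ k := hk; omega) _ (measurableSet_isBlock i (-(k : ℤ)))
    have hUm' : ∀ N, MeasurableSet (U N) := fun N =>
      leftAlgebra_le _ _ (hUm (-(N : ℤ) + 1) N (by omega))
    -- A block at `y` is decided by the noise at `y` and to its left, so finitely many of the sets
    -- `U N` may be dropped to make the event depend only on sites up to `a`.
    have htail : MeasurableSet[limsup siteAlgebra atBot] (⋂ N, U N) := by
      have hlim : limsup siteAlgebra atBot = ⨅ a : ℤ, ⨆ b ∈ Set.Iic a, siteAlgebra b := by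
        rw [(atBot_basis (α := ℤ)).limsup_eq_iInf_iSup]
        exact iInf_congr fun a => iInf_pos trivial
      rw [hlim, MeasurableSpace.measurableSet_iInf]
      intro a
      have hN : ∀ N : ℕ, -((N + a.natAbs + 1 : ℕ) : ℤ) ≤ a + 1 - 1 := fun N => by omega
      have hset : ⋂ N, U N = ⋂ N, U (N + a.natAbs + 1) := by
        refine le_antisymm (Set.subset_iInter fun N => Set.iInter_subset _ _)
          (Set.subset_iInter fun N => (Set.iInter_subset _ N).trans (hanti (by omega)))
      rw [hset]
      refine @MeasurableSet.iInter _ _ (⨆ b ∈ Set.Iic a, siteAlgebra b) _ _ fun N => ?_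
      have h1 : leftAlgebra (a + 1) ≤ ⨆ b ∈ Set.Iic a, siteAlgebra b :=
        biSup_mono fun b hb => Int.lt_add_one_iff.1 hb
      exact h1 _ (hUm (a + 1) _ (hN N))
    have h01 := measure_zero_or_one_of_measurableSet_limsup_atBot siteAlgebra_le
      (iIndep_siteAlgebra (siteLaw lam μ)) htail
    have hpos : p ≤ sitesLaw lam μ (⋂ N, U N) := by
      rw [hanti.measure_iInter (fun N => (hUm' N).nullMeasurableSet) ⟨0, measure_ne_top _ _⟩]
      exact le_iInf fun N => (hle (-(N : ℤ))).trans
        (measure_mono (Set.subset_biUnion_of_mem (u := fun k : ℕ => {σ | IsBlock i σ (-(k : ℤ))})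
          (show N ≥ N from le_rfl)))
    have hone : sitesLaw lam μ (⋂ N, U N) = 1 :=
      h01.resolve_left fun h0 => hp (le_antisymm (hpos.trans_eq h0) zero_le)
    have hae : ∀ᵐ σ ∂sitesLaw lam μ, σ ∈ ⋂ N, U N :=
      (prob_compl_eq_zero_iff (MeasurableSet.iInter hUm')).2 hone
    filter_upwards [hae] with σ hσ N
    have := Set.mem_iInter.1 hσ N
    simpa [hU] using this
  filter_upwards [ae_all_iff.2 key] with σ hσ i x
  obtain ⟨k, hk, hb⟩ := hσ i (x.natAbs + 1)
  exact ⟨-k, by omega, hb⟩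

theorem ae_hasBlocks (lam : ℝ≥0∞) (μ : ℝ≥0) : ∀ᵐ ω ∂noiseLaw lam μ, HasBlocks lam ω := by
  filter_upwards [ae_isGeneric lam μ, ae_of_ae_sites (ae_exists_isBlock lam μ)] with ω hω h
  exact hasBlocks_of_crude hω h

/-! ### The law of the outflow of a site -/

/-- The probability that the last particle at a site falls asleep there. -/
noncomputable def sleepProb (lam : ℝ≥0∞) : ℝ :=
  open scoped Classical in if lam = ⊤ then 1 else lam.toReal / (1 + lam.toReal)

theorem sleepProb_pos {lam : ℝ≥0∞} (hlam : 0 < lam) : 0 < sleepProb lam := by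
  unfold sleepProb
  split_ifs with h
  · exact one_pos
  · have := ENNReal.toReal_pos hlam.ne' h
    positivity

theorem sleepProb_nonneg (lam : ℝ≥0∞) : 0 ≤ sleepProb lam := by
  unfold sleepProb
  split_ifs <;> positivity

theorem sleepProb_le_one (lam : ℝ≥0∞) : sleepProb lam ≤ 1 := by
  unfold sleepProb
  split_ifs with h
  · exact le_rfl
  · rw [div_le_one (by positivity)]
    linarith

theorem jumpProb_eq {lam : ℝ≥0∞} (h : lam ≠ ⊤) :
    jumpProb lam = ENNReal.ofReal (1 - sleepProb lam) := by
  have h1 : (1 + lam) = ENNReal.ofReal (1 + lam.toReal) := by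
    rw [ENNReal.ofReal_add zero_le_one ENNReal.toReal_nonneg, ENNReal.ofReal_one,
      ENNReal.ofReal_toReal h]
  have h2 : (0 : ℝ) < 1 + lam.toReal := by positivity
  rw [jumpProb, if_neg h, sleepProb, if_neg h, h1, ← ENNReal.ofReal_inv_of_pos h2]
  congr 1
  field_simp
  ring

/-- The number of instructions that contain the first `c` jumps. -/
noncomputable def jumpIndex (b : ℕ → Bool) (c : ℕ) : ℕ := sInf {r | c ≤ jumps b r}

theorem jumps_lt_of_lt_jumpIndex {b : ℕ → Bool} {c r : ℕ} (h : r < jumpIndex b c) :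
    jumps b r < c :=
  not_le.1 (Nat.notMem_of_lt_sInf (s := {r | c ≤ jumps b r}) h)

theorem jumps_jumpIndex {b : ℕ → Bool} (hb : JumpsOften b) (c : ℕ) :
    jumps b (jumpIndex b c) = c := by
  refine le_antisymm ?_ (Nat.sInf_mem (s := {r | c ≤ jumps b r}) (hb c))
  rcases Nat.eq_zero_or_eq_succ_pred (jumpIndex b c) with h | h
  · rw [h, jumps_zero]
    exact Nat.zero_le _
  · have hlt := jumps_lt_of_lt_jumpIndex (b := b) (c := c) (r := (jumpIndex b c).pred) (by omega)
    rw [h, jumps_succ]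
    split_ifs <;> omega

theorem last_jumpIndex {b : ℕ → Bool} (hb : JumpsOften b) {c : ℕ} (h : 0 < jumpIndex b c) :
    b (jumpIndex b c - 1) = true := by
  by_contra hf
  have h1 := jumps_succ b (jumpIndex b c - 1)
  rw [Nat.sub_add_cancel h, if_neg hf, jumps_jumpIndex hb] at h1
  have := jumps_lt_of_lt_jumpIndex (b := b) (c := c) (r := jumpIndex b c - 1) (by omega)
  omega

theorem activeAt_pos_of_two_le {lam : ℝ≥0∞} {b : ℕ → Bool} {a r : ℕ} (h : jumps b r + 2 ≤ a) :
    0 < activeAt lam b a r := by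
  unfold activeAt siteState
  rw [if_neg fun h' => by omega]
  simp only [SiteState.numActive]
  omega

theorem outflow_zero (lam : ℝ≥0∞) (b : ℕ → Bool) : outflow lam b 0 = 0 := by
  have : settleRings lam b 0 = 0 :=
    Nat.sInf_eq_zero.2 (Or.inl (activeAt_eq_zero_of_le lam b (Nat.zero_le _)))
  rw [outflow, this, jumps_zero]

/-- The last particle sleeps as soon as it is alone. -/
theorem outflow_succ_top {b : ℕ → Bool} (hb : JumpsOften b) (k : ℕ) : outflow ⊤ b (k + 1) = k := by
  have : settleRings ⊤ b (k + 1) = jumpIndex b k := by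
    refine le_antisymm (Nat.sInf_le ?_) (not_lt.1 fun hlt => ?_)
    · have := jumps_jumpIndex hb k
      simp [activeAt, siteState, this, SiteState.numActive]
    · have h1 := jumps_lt_of_lt_jumpIndex hlt
      have h2 := activeAt_pos_of_two_le (lam := ⊤) (b := b) (a := k + 1) (by omega :
        jumps b (settleRings ⊤ b (k + 1)) + 2 ≤ k + 1)
      rw [activeAt_settleRings hb] at h2
      exact lt_irrefl _ h2
  rw [outflow, this, jumps_jumpIndex hb]

/-- Until `k` particles have left, at least two are present and the site is unstable. The remaining
one is then awake, because the preceding instruction, if any, was a jump; the next instruction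
decides whether it leaves. -/
theorem outflow_succ {lam : ℝ≥0∞} (hlam : lam ≠ ⊤) {b : ℕ → Bool} (hb : JumpsOften b) (k : ℕ) :
    outflow lam b (k + 1) = k + if b (jumpIndex b k) = true then 1 else 0 := by
  have hj := jumps_jumpIndex hb k
  have : settleRings lam b (k + 1) = jumpIndex b k + 1 := by
    refine le_antisymm (Nat.sInf_le ?_) (Nat.succ_le_of_lt (not_le.1 fun hle => ?_))
    · rcases Bool.eq_false_or_eq_true (b (jumpIndex b k)) with h | h
      · exact activeAt_eq_zero_of_le lam b (by rw [jumps_succ, h, hj]; simp)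
      · have h1 : jumps b (jumpIndex b k + 1) = k := by rw [jumps_succ, h, hj]; simp
        simp [activeAt, siteState, h1, h, SiteState.numActive]
    · have h0 := activeAt_settleRings (lam := lam) hb (k + 1)
      rcases hle.lt_or_eq with hlt | heq
      · have h1 := jumps_lt_of_lt_jumpIndex hlt
        have h2 := activeAt_pos_of_two_le (lam := lam) (b := b) (a := k + 1) (by omega :
          jumps b (settleRings lam b (k + 1)) + 2 ≤ k + 1)
        rw [h0] at h2
        exact lt_irrefl _ h2
      · rw [heq] at h0
        unfold activeAt siteState at h0
        rw [if_neg] at h0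
        · simp [SiteState.numActive, hj] at h0
        · rintro ⟨-, h | ⟨h1, h2⟩⟩
          · exact hlam h
          · rw [last_jumpIndex hb h1] at h2
            exact absurd h2 (by simp)
  rw [outflow, this, jumps_succ, hj]

theorem measurable_jumps {m : MeasurableSpace (ℕ → Bool)} {r : ℕ}
    (h : ∀ j < r, Measurable[m] fun b : ℕ → Bool => b j) : Measurable[m] fun b => jumps b r := by
  induction r with
  | zero => simp only [jumps_zero]; exact measurable_const
  | succ r ih =>
    simp_rw [jumps_succ]
    have h1 := ih fun j hj => h j (by omega)
    have h2 : Measurable[m] fun b : ℕ → Bool => if b r = true then 1 else 0 :=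
      (measurable_of_countable fun x : Bool => if x = true then 1 else 0).comp (h r (by omega))
    exact h1.add h2

theorem measurable_outflow (lam : ℝ≥0∞) (k : ℕ) : Measurable fun b => outflow lam b k := by
  have hj : ∀ r, Measurable fun b : ℕ → Bool => jumps b r := fun r =>
    measurable_jumps fun j _ => measurable_pi_apply j
  have ha : ∀ r, MeasurableSet {b | activeAt lam b k r = 0} := fun r => by
    have h1 : Measurable fun b : ℕ → Bool => (jumps b r, b (r - 1)) :=
      (hj r).prodMk (measurable_pi_apply _)
    classical
    have h2 := (measurable_of_countable fun p : ℕ × Bool =>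
      (if k - p.1 = 1 ∧ (lam = ⊤ ∨ (0 < r ∧ p.2 = false)) then SiteState.asleep
        else .active (k - p.1)).numActive).comp h1
    have h3 : Measurable fun b => activeAt lam b k r := by
      convert h2 using 2
      unfold activeAt siteState Function.comp
      congr!
    exact h3 (measurableSet_singleton 0)
  have hs : Measurable fun b => settleRings lam b k := measurable_sInf_nat ha
  have hp : Measurable fun p : (ℕ → Bool) × ℕ => jumps p.1 p.2 :=
    measurable_from_prod_countable_left fun r => hj r
  exact hp.comp (measurable_id.prodMk hs)

theorem measurable_outStep (lam : ℝ≥0∞) :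
    Measurable fun p : ℕ × SiteNoise => outStep lam p.1 p.2 := by
  have hp : Measurable fun p : (ℕ → Bool) × ℕ => outflow lam p.1 p.2 :=
    measurable_from_prod_countable_left fun k => measurable_outflow lam k
  have h1 : Measurable fun p : ℕ × SiteNoise => (p.2.2.2, p.2.1 + p.1) := by fun_prop
  have := hp.comp h1
  unfold Function.comp at this
  exact this

/-- The instruction after the first `c` jumps is a jump with probability `jumpProb lam`. -/
theorem instrLaw_jumpIndex (lam : ℝ≥0∞) (c : ℕ) :
    instrLaw lam {b | b (jumpIndex b c) = true} = jumpProb lam := by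
  set alg : ℕ → MeasurableSpace (ℕ → Bool) :=
    fun j => MeasurableSpace.comap (fun b => b j) inferInstance with halg
  have hle : ∀ j, alg j ≤ MeasurableSpace.pi := fun j => (measurable_pi_apply j).comap_le
  have hind : iIndep alg (instrLaw lam) :=
    iIndepFun_infinitePi (P := fun _ : ℕ => instructionLaw lam) (X := fun _ x => x)
      fun _ => measurable_id
  -- The event that the first `c` jumps take exactly `j` instructions. It is decided by the
  -- instructions before `j`, so instruction `j` is independent of it.
  set N : ℕ → Set (ℕ → Bool) := fun j => {b | c ≤ jumps b j ∧ ∀ i < j, jumps b i < c} with hN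
  have hNm : ∀ j, MeasurableSet[⨆ i ∈ Set.Iio j, alg i] (N j) := fun j => by
    have hm : ∀ i ≤ j, Measurable[⨆ i ∈ Set.Iio j, alg i] fun b : ℕ → Bool => jumps b i :=
      fun i hi => measurable_jumps (m := ⨆ i ∈ Set.Iio j, alg i) fun l hl =>
        (comap_measurable _).mono (le_iSup₂_of_le l (lt_of_lt_of_le hl hi) le_rfl) le_rfl
    have hset : N j = (fun b => jumps b j) ⁻¹' Set.Ici c ∩
        ⋂ i ∈ Finset.range j, (fun b => jumps b i) ⁻¹' Set.Iio c := by
      ext b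
      simp [hN]
    rw [hset]
    exact @MeasurableSet.inter _ (⨆ i ∈ Set.Iio j, alg i) _ _ (hm j le_rfl measurableSet_Ici)
      (@Finset.measurableSet_biInter _ _ (⨆ i ∈ Set.Iio j, alg i) _ _ fun i hi =>
        hm i (Finset.mem_range.1 hi).le measurableSet_Iio)
  have hNm' : ∀ j, MeasurableSet (N j) := fun j => iSup₂_le (fun i _ => hle i) _ (hNm j)
  have hT : ∀ j, MeasurableSet {b : ℕ → Bool | b j = true} := fun j => by
    have h : Measurable fun b : ℕ → Bool => b j := measurable_pi_apply j
    exact h (measurableSet_singleton true)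
  have hTp : ∀ j, instrLaw lam {b : ℕ → Bool | b j = true} = jumpProb lam := fun j => by
    rw [← instructionLaw_true]
    exact (measurePreserving_eval_infinitePi (fun _ : ℕ => instructionLaw lam) j).measure_preimage
      (measurableSet_singleton true).nullMeasurableSet
  have hprod : ∀ j, instrLaw lam (N j ∩ {b | b j = true}) = instrLaw lam (N j) * jumpProb lam :=
    fun j => by
      have h1 := indep_iSup_of_disjoint hle hind (S := Set.Iio j) (T := {j}) (by simp)
      rw [iSup_singleton] at h1
      have h2 : instrLaw lam (N j ∩ {b | b j = true}) = _ :=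
        (Indep_iff _ _ _).1 h1 _ _ (hNm j) ⟨{true}, measurableSet_singleton true, rfl⟩
      rw [h2]
      exact congrArg _ (hTp j)
  have hdisj : Pairwise (Function.onFun Disjoint N) := fun i j hij => by
    refine Set.disjoint_left.2 fun b hi hj => ?_
    rcases lt_or_gt_of_ne hij with h | h
    · exact absurd (hj.2 i h) (not_lt.2 hi.1)
    · exact absurd (hi.2 j h) (not_lt.2 hj.1)
  have hmem : ∀ b, JumpsOften b → b ∈ N (jumpIndex b c) := fun b hb =>
    ⟨(jumps_jumpIndex hb c).ge, fun i hi => jumps_lt_of_lt_jumpIndex hi⟩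
  have hA : {b | b (jumpIndex b c) = true} =ᵐ[instrLaw lam] ⋃ j, N j ∩ {b | b j = true} := by
    filter_upwards [ae_jumpsOften lam] with b hb
    refine propext ⟨fun h => Set.mem_iUnion.2 ⟨_, hmem b hb, h⟩, fun h => ?_⟩
    obtain ⟨j, hj, hbj⟩ := Set.mem_iUnion.1 h
    have : jumpIndex b c = j := by
      by_contra hne
      exact Set.disjoint_left.1 (hdisj hne) (hmem b hb) hj
    change b (jumpIndex b c) = true
    rw [this]
    exact hbj
  have hone : ∑' j, instrLaw lam (N j) = 1 := by
    rw [← measure_iUnion hdisj hNm', ← measure_univ (μ := instrLaw lam)]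
    refine measure_congr ?_
    filter_upwards [ae_jumpsOften lam] with b hb
    exact propext ⟨fun _ => trivial, fun _ => Set.mem_iUnion.2 ⟨_, hmem b hb⟩⟩
  rw [measure_congr hA, measure_iUnion (fun i j hij => (hdisj hij).mono Set.inter_subset_left
    Set.inter_subset_left) fun j => (hNm' j).inter (hT j)]
  simp_rw [hprod]
  rw [ENNReal.tsum_mul_right, hone, one_mul]

/-- Of `k + 1` particles that arrive at a site, one stays with probability `sleepProb lam`, and
otherwise all leave. -/
theorem lintegral_outflow_succ (lam : ℝ≥0∞) (k : ℕ) (g : ℕ → ℝ≥0∞) :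
    ∫⁻ b, g (outflow lam b (k + 1)) ∂instrLaw lam =
      ENNReal.ofReal (sleepProb lam) * g k + ENNReal.ofReal (1 - sleepProb lam) * g (k + 1) := by
  rcases eq_or_ne lam ⊤ with rfl | hlam
  · have h : ∀ᵐ b ∂instrLaw ⊤, g (outflow ⊤ b (k + 1)) = g k := by
      filter_upwards [ae_jumpsOften ⊤] with b hb
      rw [outflow_succ_top hb]
    rw [lintegral_congr_ae h, lintegral_const, measure_univ]
    simp [sleepProb]
  · have hz : ENNReal.ofReal (1 - sleepProb lam) ≤ 1 := by
      rw [← jumpProb_eq hlam]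
      exact jumpProb_le_one lam
    have hz' : ENNReal.ofReal (sleepProb lam) = 1 - ENNReal.ofReal (1 - sleepProb lam) := by
      rw [← ENNReal.ofReal_one, ← ENNReal.ofReal_sub _ (by linarith [sleepProb_le_one lam])]
      ring_nf
    have hm : Measurable fun b => outflow lam b (k + 1) := measurable_outflow lam (k + 1)
    have hae : ∀ᵐ b ∂instrLaw lam, (outflow lam b (k + 1) = k + 1 ↔ b (jumpIndex b k) = true) ∧
        (outflow lam b (k + 1) = k ∨ outflow lam b (k + 1) = k + 1) := by
      filter_upwards [ae_jumpsOften lam] with b hb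
      rw [outflow_succ hlam hb]
      split_ifs with h <;> simp [h]
    set A : Set (ℕ → Bool) := {b | outflow lam b (k + 1) = k + 1} with hA
    have hAm : MeasurableSet A := hm (measurableSet_singleton _)
    have hAp : instrLaw lam A = ENNReal.ofReal (1 - sleepProb lam) := by
      rw [← jumpProb_eq hlam, ← instrLaw_jumpIndex lam k]
      refine measure_congr ?_
      filter_upwards [hae] with b hb
      exact propext hb.1
    have hAc : instrLaw lam Aᶜ = ENNReal.ofReal (sleepProb lam) := by
      rw [prob_compl_eq_one_sub hAm, hAp, hz']
    rw [← lintegral_add_compl _ hAm, add_comm]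
    have h1 : ∫⁻ b in A, g (outflow lam b (k + 1)) ∂instrLaw lam =
        ∫⁻ _ in A, g (k + 1) ∂instrLaw lam :=
      setLIntegral_congr_fun hAm fun b hb => by
        have hb : outflow lam b (k + 1) = k + 1 := hb
        simp only [hb]
    have h2 : ∫⁻ b in Aᶜ, g (outflow lam b (k + 1)) ∂instrLaw lam =
        ∫⁻ _ in Aᶜ, g k ∂instrLaw lam :=
      setLIntegral_congr_fun_ae hAm.compl (by
        filter_upwards [hae] with b hb hbA
        rw [hb.2.resolve_right hbA])
    rw [h1, h2, setLIntegral_const, setLIntegral_const, hAp, hAc, mul_comm (g k),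
      mul_comm (g (k + 1))]

/-- The mean of `g` at the number of particles that leave a site at which `k` particles arrive. -/
noncomputable def outMean (lam : ℝ≥0∞) (g : ℕ → ℝ≥0∞) : ℕ → ℝ≥0∞
  | 0 => g 0
  | k + 1 => ENNReal.ofReal (sleepProb lam) * g k + ENNReal.ofReal (1 - sleepProb lam) * g (k + 1)

theorem lintegral_outStep (lam : ℝ≥0∞) (μ : ℝ≥0) (w : ℕ) (g : ℕ → ℝ≥0∞) :
    ∫⁻ s, g (outStep lam w s) ∂siteLaw lam μ =
      ∫⁻ k, outMean lam g (k + w) ∂poissonMeasure μ := by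
  have hm : Measurable fun s : SiteNoise => g (outStep lam w s) :=
    (measurable_of_countable g).comp ((measurable_outStep lam).comp measurable_prodMk_left)
  rw [siteLaw, lintegral_prod _ hm.aemeasurable]
  refine lintegral_congr fun k => ?_
  have hm' : Measurable fun b : ℕ → Bool => g (outflow lam b (k + w)) :=
    (measurable_of_countable g).comp (measurable_outflow lam (k + w))
  have h1 : ∫⁻ p, g (outStep lam w (k, p)) ∂(clockLaw.prod (instrLaw lam)) =
      ∫⁻ b, g (outflow lam b (k + w)) ∂instrLaw lam :=
    (measurePreserving_snd (μ := clockLaw) (ν := instrLaw lam)).lintegral_comp hm'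
  rw [h1]
  rcases hk : k + w with _ | n
  · simp [outflow_zero, outMean]
  · exact lintegral_outflow_succ lam n g

/-! ### The number of particles that a long interval sends out to the right -/

/-- The mean of `g` at the number of particles that leave the interval of `n` sites that starts
at `y`, in the stabilization of this interval. -/
noncomputable def chainMean (lam : ℝ≥0∞) (μ : ℝ≥0) (g : ℕ → ℝ≥0∞) (y : ℤ) (n : ℕ) : ℝ≥0∞ :=
  ∫⁻ σ, g (chain (outStep lam) 0 σ y n) ∂sitesLaw lam μ

section

variable (lam : ℝ≥0∞) (μ : ℝ≥0)

theorem measurable_comp_chain_outStep (g : ℕ → ℝ≥0∞) (y : ℤ) (n : ℕ) :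
    Measurable fun σ => g (chain (outStep lam) 0 σ y n) :=
  (measurable_of_countable g).comp (measurable_chain' (measurable_outStep lam) 0 y n)

theorem chainMean_zero (g : ℕ → ℝ≥0∞) (y : ℤ) : chainMean lam μ g y 0 = g 0 := by
  simp [chainMean, chain]

theorem chainMean_succ (g : ℕ → ℝ≥0∞) (y : ℤ) (n : ℕ) :
    chainMean lam μ g y (n + 1) =
      chainMean lam μ (fun w => ∫⁻ k, outMean lam g (k + w) ∂poissonMeasure μ) y n := by
  have h := lintegral_chain (siteLaw lam μ) (measurable_outStep lam) 0 y n
    ((measurable_of_countable g).comp (measurable_outStep lam))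
  unfold chainMean
  simp_rw [← lintegral_outStep]
  exact h

/-- Only the law of a single site enters the recursion `chainMean_succ`. This translation invariance
joins the two viewpoints: the recursion extends an interval to the right, monotonicity in `n`
extends it to the left. -/
theorem chainMean_eq (g : ℕ → ℝ≥0∞) (y y' : ℤ) (n : ℕ) :
    chainMean lam μ g y n = chainMean lam μ g y' n := by
  induction n generalizing g with
  | zero => simp_rw [chainMean_zero]
  | succ n ih => rw [chainMean_succ, chainMean_succ, ih]

theorem ae_chain_outStep_monotone : ∀ᵐ σ ∂sitesLaw lam μ, ∀ x : ℤ,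
    Monotone fun n : ℕ => chain (outStep lam) 0 σ (x - n) n := by
  filter_upwards [ae_forall_site (ae_site_jumpsOften lam μ)] with σ hσ x
  exact chain_mono_left (fun x w w' h => outflow_mono (hσ x) (Nat.add_le_add_left h _))
    (fun w => Nat.zero_le w) x

theorem lintegral_pow_add_poissonMeasure {s : ℝ} (hs : 0 ≤ s) (w : ℕ) :
    ∫⁻ k, ENNReal.ofReal (s ^ (k + w)) ∂poissonMeasure μ =
      ENNReal.ofReal (Real.exp (μ * (s - 1))) * ENNReal.ofReal (s ^ w) := by
  simp_rw [pow_add, ENNReal.ofReal_mul (pow_nonneg hs _)]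
  rw [lintegral_mul_const _ (measurable_of_countable _), lintegral_pow_poissonMeasure μ hs]

/-! ### Subcritical densities -/

/-- For `m > 0` the mean equals the second term, since one particle stays with probability
`sleepProb lam`; the `1` pays for the empty site. -/
theorem outMean_pow_le {s : ℝ} (hs : 0 < s) (m : ℕ) :
    outMean lam (fun m => ENNReal.ofReal (s ^ m)) m ≤
      1 + ENNReal.ofReal (1 - sleepProb lam + sleepProb lam / s) * ENNReal.ofReal (s ^ m) := by
  have h0 := sleepProb_nonneg lam
  have h1 := sleepProb_le_one lam
  cases m with
  | zero => simp [outMean]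
  | succ k =>
    refine le_trans (le_of_eq ?_) le_add_self
    simp only [outMean]
    rw [← ENNReal.ofReal_mul h0, ← ENNReal.ofReal_mul (by linarith),
      ← ENNReal.ofReal_add (by positivity) (mul_nonneg (by linarith) (by positivity)),
      ← ENNReal.ofReal_mul (add_nonneg (by linarith) (by positivity))]
    congr 1
    field_simp
    ring

theorem chainMean_pow_succ_le {s : ℝ} (hs : 0 < s) (y : ℤ) (n : ℕ) :
    chainMean lam μ (fun m => ENNReal.ofReal (s ^ m)) y (n + 1) ≤
      1 + ENNReal.ofReal (Real.exp (μ * (s - 1)) * (1 - sleepProb lam + sleepProb lam / s)) *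
        chainMean lam μ (fun m => ENNReal.ofReal (s ^ m)) y n := by
  have hw : ∀ w : ℕ, ∫⁻ k, outMean lam (fun m => ENNReal.ofReal (s ^ m)) (k + w) ∂poissonMeasure μ ≤
      1 + ENNReal.ofReal (Real.exp (μ * (s - 1)) * (1 - sleepProb lam + sleepProb lam / s)) *
        ENNReal.ofReal (s ^ w) := fun w => by
    refine (lintegral_mono fun k => outMean_pow_le lam hs (k + w)).trans (le_of_eq ?_)
    rw [lintegral_add_left measurable_const, lintegral_const, measure_univ, one_mul,
      lintegral_const_mul _ (measurable_of_countable _), lintegral_pow_add_poissonMeasure μ hs.le,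
      ENNReal.ofReal_mul (Real.exp_pos _).le]
    ring
  rw [chainMean_succ]
  unfold chainMean
  refine (lintegral_mono fun σ => hw _).trans (le_of_eq ?_)
  rw [lintegral_add_left measurable_const, lintegral_const, measure_univ, one_mul,
    lintegral_const_mul _ (measurable_comp_chain_outStep lam (fun m => ENNReal.ofReal (s ^ m)) y n)]

theorem exists_contraction {z : ℝ} (hz : 0 < z) (h : (μ : ℝ) < z) :
    ∃ s : ℝ, 1 < s ∧ Real.exp (μ * (s - 1)) * (1 - z + z / s) < 1 := by
  have hμ : (0 : ℝ) ≤ μ := μ.2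
  -- Then `z / s` is the midpoint of `μ` and `z`, and the factor is at most `exp ((μ - z / s) * (s -
  -- 1))`, with negative exponent.
  refine ⟨2 * z / (z + μ), by rw [lt_div_iff₀ (by linarith)]; linarith, ?_⟩
  set s : ℝ := 2 * z / (z + μ) with hs
  have hs1 : 1 < s := by rw [hs, lt_div_iff₀ (by linarith)]; linarith
  have hzs : z / s = (z + μ) / 2 := by rw [hs]; field_simp
  have h1 : 1 - z + z / s ≤ Real.exp (z / s - z) := by
    have := Real.add_one_le_exp (z / s - z)
    linarith
  refine (mul_le_mul_of_nonneg_left h1 (Real.exp_pos _).le).trans_lt ?_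
  rw [← Real.exp_add, Real.exp_lt_one_iff]
  have h2 : z / s - z = -(z / s) * (s - 1) := by field_simp; ring
  rw [h2, ← add_mul]
  refine mul_neg_of_neg_of_pos ?_ (by linarith)
  rw [hzs]
  linarith

variable {lam μ}

/-- The means of `s ^ W` satisfy `a (n + 1) ≤ 1 + φ * a n` with `φ < 1`, so they stay below `1 / (1
- φ)`. For a fixed right end the outflow increases with `n`, and monotone convergence makes its
supremum almost surely finite. -/
theorem ae_chain_bounded (hlam : 0 < lam) (h : (μ : ℝ) < sleepProb lam) :
    ∀ᵐ σ ∂sitesLaw lam μ, ∀ x : ℤ, ∃ B, ∀ n : ℕ, chain (outStep lam) 0 σ (x - n) n ≤ B := by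
  obtain ⟨s, hs, hφ⟩ := exists_contraction μ (sleepProb_pos hlam) h
  set φ : ℝ := Real.exp (μ * (s - 1)) * (1 - sleepProb lam + sleepProb lam / s) with hφd
  have hφ0 : 0 ≤ φ := mul_nonneg (Real.exp_pos _).le (add_nonneg
    (by linarith [sleepProb_le_one lam]) (div_nonneg (sleepProb_pos hlam).le (by linarith)))
  have hbound : ∀ (y : ℤ) (n : ℕ), chainMean lam μ (fun m => ENNReal.ofReal (s ^ m)) y n ≤
      ENNReal.ofReal (1 / (1 - φ)) := fun y n => by
    induction n with
    | zero =>
      rw [chainMean_zero, pow_zero]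
      exact ENNReal.ofReal_le_ofReal (by rw [le_div_iff₀ (by linarith)]; linarith)
    | succ n ih =>
      refine (chainMean_pow_succ_le lam μ (by linarith) y n).trans ?_
      rw [← hφd]
      refine (add_le_add le_rfl (mul_le_mul_right ih _)).trans (le_of_eq ?_)
      rw [← ENNReal.ofReal_mul hφ0, ← ENNReal.ofReal_one,
        ← ENNReal.ofReal_add zero_le_one (mul_nonneg hφ0 (by
          exact div_nonneg zero_le_one (by linarith)))]
      congr 1
      have : 1 - φ ≠ 0 := by linarith
      field_simp
      ring
  have hfin : ∀ x : ℤ, ∀ᵐ σ ∂sitesLaw lam μ,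
      ⨆ n : ℕ, ENNReal.ofReal (s ^ chain (outStep lam) 0 σ (x - n) n) < ⊤ := fun x => by
    have hm : ∀ n : ℕ, Measurable fun σ =>
        ENNReal.ofReal (s ^ chain (outStep lam) 0 σ (x - n) n) := fun n =>
      measurable_comp_chain_outStep lam (fun m => ENNReal.ofReal (s ^ m)) (x - n) n
    refine ae_lt_top (Measurable.iSup hm) ?_
    rw [lintegral_iSup' (fun n => (hm n).aemeasurable)]
    · exact ne_top_of_le_ne_top ENNReal.ofReal_ne_top (iSup_le fun n => hbound (x - n) n)
    · filter_upwards [ae_chain_outStep_monotone lam μ] with σ hσ m n hmn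
      exact ENNReal.ofReal_le_ofReal (pow_le_pow_right₀ hs.le (hσ x hmn))
  filter_upwards [ae_all_iff.2 hfin] with σ hσ x
  obtain ⟨B, hB⟩ := pow_unbounded_of_one_lt
    (⨆ n : ℕ, ENNReal.ofReal (s ^ chain (outStep lam) 0 σ (x - n) n)).toReal hs
  refine ⟨B, fun n => le_of_not_gt fun hn => ?_⟩
  have h1 : s ^ chain (outStep lam) 0 σ (x - n) n ≤
      (⨆ n : ℕ, ENNReal.ofReal (s ^ chain (outStep lam) 0 σ (x - n) n)).toReal := by
    rw [← ENNReal.ofReal_le_iff_le_toReal (hσ x).ne]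
    exact le_iSup (fun n : ℕ => ENNReal.ofReal (s ^ chain (outStep lam) 0 σ (x - n) n)) n
  exact absurd (hB.trans_le ((pow_le_pow_right₀ hs.le hn.le).trans h1)) (lt_irrefl _)

theorem ae_locallyFixates (hlam : 0 < lam) (h : (μ : ℝ) < sleepProb lam) :
    ∀ᵐ ω ∂noiseLaw lam μ, LocallyFixates (process lam ω) := by
  filter_upwards [ae_isGeneric lam μ, ae_of_ae_sites (ae_chain_bounded hlam h)] with ω hω hc
  exact locallyFixates_of_bounded hω (bounded_of_chain hω hc)

/-! ### Critical and supercritical densities -/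

variable (lam μ)

/-- Keeping one particle multiplies `(1 + h)⁻¹ ^ m` by `1 + h`. At an empty site none can be kept,
and `0 ^ m`, the indicator of `m = 0`, corrects for this. -/
theorem outMean_inv_pow {h : ℝ} (hh : 0 < h) (m : ℕ) :
    outMean lam (fun m => ENNReal.ofReal ((1 + h)⁻¹ ^ m)) m +
        ENNReal.ofReal (sleepProb lam * h) * ENNReal.ofReal (0 ^ m) =
      ENNReal.ofReal (1 + sleepProb lam * h) * ENNReal.ofReal ((1 + h)⁻¹ ^ m) := by
  have h0 := sleepProb_nonneg lam
  have h1 := sleepProb_le_one lam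
  cases m with
  | zero =>
    simp only [outMean, pow_zero, ENNReal.ofReal_one, mul_one]
    rw [ENNReal.ofReal_add zero_le_one (by positivity), ENNReal.ofReal_one]
  | succ k =>
    simp only [outMean]
    rw [zero_pow k.succ_ne_zero, ENNReal.ofReal_zero, mul_zero, add_zero,
      ← ENNReal.ofReal_mul h0, ← ENNReal.ofReal_mul (by linarith),
      ← ENNReal.ofReal_add (by positivity) (mul_nonneg (by linarith) (by positivity)),
      ← ENNReal.ofReal_mul (by positivity)]
    congr 1
    rw [pow_succ]
    field_simp
    ring

/-- The correction term requires that nothing enters the last site and, with probability `exp (-μ)`,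
that nothing starts there. -/
theorem chainMean_inv_pow_succ {h : ℝ} (hh : 0 < h) (y : ℤ) (n : ℕ) :
    chainMean lam μ (fun m => ENNReal.ofReal ((1 + h)⁻¹ ^ m)) y (n + 1) +
        ENNReal.ofReal (sleepProb lam * h * Real.exp (-μ)) *
          chainMean lam μ (fun m => ENNReal.ofReal (0 ^ m)) y n =
      ENNReal.ofReal ((1 + sleepProb lam * h) * Real.exp (μ * ((1 + h)⁻¹ - 1))) *
        chainMean lam μ (fun m => ENNReal.ofReal ((1 + h)⁻¹ ^ m)) y n := by
  have h0 := sleepProb_nonneg lam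
  have hw : ∀ w : ℕ,
      ∫⁻ k, outMean lam (fun m => ENNReal.ofReal ((1 + h)⁻¹ ^ m)) (k + w) ∂poissonMeasure μ +
        ENNReal.ofReal (sleepProb lam * h * Real.exp (-μ)) * ENNReal.ofReal (0 ^ w) =
      ENNReal.ofReal ((1 + sleepProb lam * h) * Real.exp (μ * ((1 + h)⁻¹ - 1))) *
        ENNReal.ofReal ((1 + h)⁻¹ ^ w) := fun w => by
    have h1 := lintegral_congr (μ := poissonMeasure μ) fun k => outMean_inv_pow lam hh (k + w)
    rw [lintegral_add_left (measurable_of_countable _),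
      lintegral_const_mul _ (measurable_of_countable _),
      lintegral_const_mul _ (measurable_of_countable _), lintegral_pow_add_poissonMeasure μ le_rfl,
      lintegral_pow_add_poissonMeasure μ (by positivity)] at h1
    rw [ENNReal.ofReal_mul (p := 1 + sleepProb lam * h) (by positivity),
      ENNReal.ofReal_mul (p := sleepProb lam * h) (by positivity), mul_assoc, mul_assoc, ← h1,
      zero_sub, mul_neg_one]
  rw [chainMean_succ]
  unfold chainMean
  rw [← lintegral_const_mul _
      (measurable_comp_chain_outStep lam (fun m => ENNReal.ofReal (0 ^ m)) y n),
    ← lintegral_const_mul _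
      (measurable_comp_chain_outStep lam (fun m => ENNReal.ofReal ((1 + h)⁻¹ ^ m)) y n),
    ← lintegral_add_left (measurable_comp_chain_outStep lam
      (fun w => ∫⁻ k, outMean lam (fun m => ENNReal.ofReal ((1 + h)⁻¹ ^ m)) (k + w)
        ∂poissonMeasure μ) y n)]
  exact lintegral_congr fun σ => hw _

/-- The probability generating function at `r` of the number of particles that leave an interval
of `n` sites. -/
noncomputable def genFun (r : ℝ) (n : ℕ) : ℝ :=
  (chainMean lam μ (fun m => ENNReal.ofReal (r ^ m)) 0 n).toReal

theorem chainMean_pow_le_one {r : ℝ} (hr0 : 0 ≤ r) (hr1 : r ≤ 1) (y : ℤ) (n : ℕ) :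
    chainMean lam μ (fun m => ENNReal.ofReal (r ^ m)) y n ≤ 1 := by
  refine (lintegral_mono fun σ => ?_).trans_eq (lintegral_one.trans measure_univ)
  rw [← ENNReal.ofReal_one]
  exact ENNReal.ofReal_le_ofReal (pow_le_one₀ hr0 hr1)

theorem genFun_nonneg (r : ℝ) (n : ℕ) : 0 ≤ genFun lam μ r n := ENNReal.toReal_nonneg

theorem genFun_le_one {r : ℝ} (hr0 : 0 ≤ r) (hr1 : r ≤ 1) (n : ℕ) : genFun lam μ r n ≤ 1 :=
  ENNReal.toReal_le_of_le_ofReal zero_le_one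
    (by simpa using chainMean_pow_le_one lam μ hr0 hr1 0 n)

theorem genFun_antitone {r : ℝ} (hr0 : 0 ≤ r) (hr1 : r ≤ 1) : Antitone (genFun lam μ r) := by
  intro m n hmn
  refine ENNReal.toReal_mono
    (ne_top_of_le_ne_top ENNReal.one_ne_top (chainMean_pow_le_one lam μ hr0 hr1 0 m)) ?_
  rw [chainMean_eq lam μ _ 0 (0 - (m : ℤ)) m, chainMean_eq lam μ _ 0 (0 - (n : ℤ)) n]
  refine lintegral_mono_ae ?_
  filter_upwards [ae_chain_outStep_monotone lam μ] with σ hσ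
  exact ENNReal.ofReal_le_ofReal (pow_le_pow_of_le_one hr0 hr1 (hσ 0 hmn))

theorem tendsto_genFun {r : ℝ} (hr0 : 0 ≤ r) (hr1 : r ≤ 1) :
    Tendsto (genFun lam μ r) atTop (nhds (⨅ n, genFun lam μ r n)) :=
  tendsto_atTop_ciInf (genFun_antitone lam μ hr0 hr1)
    ⟨0, Set.forall_mem_range.2 fun n => genFun_nonneg lam μ r n⟩

theorem genFun_succ {h : ℝ} (hh : 0 < h) (n : ℕ) :
    genFun lam μ (1 + h)⁻¹ (n + 1) + sleepProb lam * h * Real.exp (-μ) * genFun lam μ 0 n =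
      (1 + sleepProb lam * h) * Real.exp (μ * ((1 + h)⁻¹ - 1)) * genFun lam μ (1 + h)⁻¹ n := by
  have h0 := sleepProb_nonneg lam
  have hr1 : (1 + h)⁻¹ ≤ 1 := inv_le_one_of_one_le₀ (by linarith)
  have h1 := congrArg ENNReal.toReal (chainMean_inv_pow_succ lam μ hh 0 n)
  rw [ENNReal.toReal_add (ne_top_of_le_ne_top ENNReal.one_ne_top
      (chainMean_pow_le_one lam μ (by positivity) hr1 0 (n + 1)))
    (ENNReal.mul_ne_top ENNReal.ofReal_ne_top (ne_top_of_le_ne_top ENNReal.one_ne_top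
      (chainMean_pow_le_one lam μ le_rfl zero_le_one 0 n))), ENNReal.toReal_mul,
    ENNReal.toReal_mul, ENNReal.toReal_ofReal (by positivity),
    ENNReal.toReal_ofReal (by positivity)] at h1
  exact h1

/-- The limit of `genFun_succ`: both generating functions converge to their infima because they
decrease in `n`. -/
theorem iInf_genFun_eq {h : ℝ} (hh : 0 < h) :
    sleepProb lam * h * Real.exp (-μ) * ⨅ n, genFun lam μ 0 n =
      ((1 + sleepProb lam * h) * Real.exp (μ * ((1 + h)⁻¹ - 1)) - 1) *
        ⨅ n, genFun lam μ (1 + h)⁻¹ n := by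
  have hr1 : (1 + h)⁻¹ ≤ 1 := inv_le_one_of_one_le₀ (by linarith)
  have h1 := tendsto_genFun lam μ (r := (1 + h)⁻¹) (by positivity) hr1
  have h2 := tendsto_genFun lam μ le_rfl zero_le_one
  have h3 := tendsto_nhds_unique
    ((((tendsto_add_atTop_iff_nat 1).2 h1).add
      (h2.const_mul (sleepProb lam * h * Real.exp (-μ)))).congr fun n => genFun_succ lam μ hh n)
    (h1.const_mul ((1 + sleepProb lam * h) * Real.exp (μ * ((1 + h)⁻¹ - 1))))
  linarith

theorem iInf_genFun_le_one {r : ℝ} (hr0 : 0 ≤ r) (hr1 : r ≤ 1) : ⨅ n, genFun lam μ r n ≤ 1 :=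
  (ciInf_le ⟨0, Set.forall_mem_range.2 fun n => genFun_nonneg lam μ r n⟩ 0).trans
    (genFun_le_one lam μ hr0 hr1 0)

variable {lam μ}

/-- To first order in `h` the left side is `(z - μ) * h ≤ 0`, so only a second-order term remains.
Equality `z = μ` is harmless, which is why the critical density is covered. -/
theorem growth_le {z h : ℝ} (hz0 : 0 ≤ z) (hz1 : z ≤ 1) (hzμ : z ≤ μ) (hh : 0 < h)
    (hh2 : h ≤ 1 / 2) : (1 + z * h) * Real.exp (μ * ((1 + h)⁻¹ - 1)) - 1 ≤ 2 * h ^ 2 := by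
  have h1 : (1 + h)⁻¹ - 1 = -(h / (1 + h)) := by field_simp; ring
  have h2 : (μ : ℝ) * ((1 + h)⁻¹ - 1) ≤ z * ((1 + h)⁻¹ - 1) := by
    rw [h1]
    have : 0 ≤ h / (1 + h) := by positivity
    nlinarith
  have h3 : (1 + z * h) * Real.exp (μ * ((1 + h)⁻¹ - 1)) ≤ Real.exp (h ^ 2) := by
    refine (mul_le_mul ((add_comm _ _).trans_le (Real.add_one_le_exp (z * h)))
      (Real.exp_le_exp.2 h2) (Real.exp_pos _).le (Real.exp_pos _).le).trans ?_
    rw [← Real.exp_add, Real.exp_le_exp]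
    have h4 : z * h + z * ((1 + h)⁻¹ - 1) = z * (h ^ 2 / (1 + h)) := by field_simp; ring
    rw [h4]
    have h5 : h ^ 2 / (1 + h) ≤ h ^ 2 := div_le_self (by positivity) (by linarith)
    have h6 : 0 ≤ h ^ 2 / (1 + h) := by positivity
    nlinarith
  have h7 : h ^ 2 ≤ 1 / 2 := by nlinarith
  have h8 := Real.exp_bound_div_one_sub_of_interval (x := h ^ 2) (by positivity) (by linarith)
  have h9 : 1 / (1 - h ^ 2) ≤ 1 + 2 * h ^ 2 := by
    rw [div_le_iff₀ (by linarith)]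
    nlinarith [sq_nonneg h]
  linarith

/-- In `iInf_genFun_eq` the left side is linear in `h` and the right side at most `2 * h ^ 2`; small
`h` leaves no room for a positive limit. -/
theorem iInf_genFun_zero (hlam : 0 < lam) (hμ : sleepProb lam ≤ μ) :
    ⨅ n, genFun lam μ 0 n = 0 := by
  have hz := sleepProb_pos hlam
  set L := ⨅ n, genFun lam μ 0 n with hL
  have hL0 : 0 ≤ L := Real.iInf_nonneg fun n => genFun_nonneg lam μ 0 n
  refine le_antisymm (le_of_not_gt fun hpos => ?_) hL0
  set a : ℝ := sleepProb lam * Real.exp (-μ) * L with ha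
  have ha0 : 0 < a := by positivity
  have key : ∀ h : ℝ, 0 < h → h ≤ 1 / 2 → a ≤ 2 * h := fun h hh hh2 => by
    have h1 := iInf_genFun_eq lam μ hh
    have h2 := growth_le hz.le (sleepProb_le_one lam) hμ hh hh2
    have h3 := iInf_genFun_le_one lam μ (r := (1 + h)⁻¹) (by positivity)
      (inv_le_one_of_one_le₀ (by linarith))
    have h4 : 0 ≤ ⨅ n, genFun lam μ (1 + h)⁻¹ n :=
      Real.iInf_nonneg fun n => genFun_nonneg lam μ _ n
    have h5 : h * a ≤ h * (2 * h) := by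
      calc h * a = sleepProb lam * h * Real.exp (-μ) * L := by rw [ha]; ring
        _ ≤ 2 * h ^ 2 * ⨅ n, genFun lam μ (1 + h)⁻¹ n := by
          rw [hL, h1]
          exact mul_le_mul_of_nonneg_right h2 h4
        _ ≤ 2 * h ^ 2 * 1 := mul_le_mul_of_nonneg_left h3 (by positivity)
        _ = h * (2 * h) := by ring
    exact le_of_mul_le_mul_left h5 hh
  have h1 := key (min (1 / 2) (a / 4)) (by positivity) (min_le_left _ _)
  have h2 := min_le_right (1 / 2) (a / 4)
  linarith

/-- Now the left side of `iInf_genFun_eq` vanishes, so a single `h` whose growth factor exceeds `1`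
suffices. -/
theorem exists_iInf_genFun_eq_zero (hlam : 0 < lam) (hμ : sleepProb lam ≤ μ) :
    ∃ r : ℝ, 0 < r ∧ r ≤ 1 ∧ ⨅ n, genFun lam μ r n = 0 := by
  have hz := sleepProb_pos hlam
  -- Chosen so that the growth factor is at least `(1 + exp μ) * exp (-μ) = 1 + exp (-μ)`.
  set h : ℝ := Real.exp μ / sleepProb lam with hh
  have hh0 : 0 < h := by positivity
  refine ⟨(1 + h)⁻¹, by positivity, inv_le_one_of_one_le₀ (by linarith), ?_⟩
  have h1 := iInf_genFun_eq lam μ hh0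
  rw [iInf_genFun_zero hlam hμ, mul_zero] at h1
  refine (mul_eq_zero.1 h1.symm).resolve_left (ne_of_gt ?_)
  have h2 : 1 + sleepProb lam * h = 1 + Real.exp μ := by rw [hh]; field_simp
  have h3 : Real.exp (-μ) ≤ Real.exp (μ * ((1 + h)⁻¹ - 1)) := by
    rw [Real.exp_le_exp]
    have : 0 ≤ (μ : ℝ) * (1 + h)⁻¹ := mul_nonneg μ.2 (by positivity)
    linarith
  have h4 : (1 + Real.exp μ) * Real.exp (-μ) = Real.exp (-μ) + 1 := by
    rw [add_mul, ← Real.exp_add]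
    simp
  have h5 := mul_le_mul_of_nonneg_left h3 (by positivity : 0 ≤ 1 + Real.exp μ)
  rw [h2]
  have := Real.exp_pos (-(μ : ℝ))
  linarith

/-- If the outflow never reaches `M`, then `r ^ W ≥ r ^ M` for every length, whereas the mean of `r
^ W` tends to `0`; Markov's inequality gives probability zero. -/
theorem ae_chain_unbounded (hlam : 0 < lam) (hμ : sleepProb lam ≤ μ) :
    ∀ᵐ σ ∂sitesLaw lam μ, ∀ M : ℕ, ∃ n : ℕ, M ≤ chain (outStep lam) 0 σ (-n) (n + 1) := by
  obtain ⟨r, hr0, hr1, hr⟩ := exists_iInf_genFun_eq_zero hlam hμ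
  rw [ae_all_iff]
  intro M
  set p := sitesLaw lam μ {σ | ¬ ∃ n : ℕ, M ≤ chain (outStep lam) 0 σ (-n) (n + 1)} with hp
  have hle : ∀ n : ℕ, ENNReal.ofReal (r ^ M) * p ≤ ENNReal.ofReal (genFun lam μ r (n + 1)) :=
    fun n => by
      rw [genFun, ENNReal.ofReal_toReal (ne_top_of_le_ne_top ENNReal.one_ne_top
        (chainMean_pow_le_one lam μ hr0.le hr1 0 (n + 1))), chainMean_eq lam μ _ 0 (-(n : ℤ))]
      refine le_trans (mul_le_mul_right (measure_mono fun σ hσ => ?_) _)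
        (mul_meas_ge_le_lintegral (measurable_comp_chain_outStep lam
          (fun m => ENNReal.ofReal (r ^ m)) (-(n : ℤ)) (n + 1)) (ENNReal.ofReal (r ^ M)))
      exact ENNReal.ofReal_le_ofReal (pow_le_pow_of_le_one hr0.le hr1
        (not_le.1 fun hM => hσ ⟨n, hM⟩).le)
  have hlim : Tendsto (fun n => ENNReal.ofReal (genFun lam μ r (n + 1))) atTop (nhds 0) := by
    have h1 := (tendsto_add_atTop_iff_nat 1).2 (tendsto_genFun lam μ hr0.le hr1)
    rw [hr] at h1
    simpa using ENNReal.tendsto_ofReal h1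
  have h0 : ENNReal.ofReal (r ^ M) * p = 0 :=
    le_antisymm (ge_of_tendsto' hlim hle) zero_le
  exact (mul_eq_zero.1 h0).resolve_left (ENNReal.ofReal_pos.2 (pow_pos hr0 M)).ne'

theorem ae_not_locallyFixates (hlam : 0 < lam) (hμ : sleepProb lam ≤ μ) :
    ∀ᵐ ω ∂noiseLaw lam μ, ¬ LocallyFixates (process lam ω) := by
  filter_upwards [ae_isGeneric lam μ, ae_hasBlocks lam μ,
    ae_of_ae_sites (ae_chain_unbounded hlam hμ)] with ω hω hb hc
  exact not_locallyFixates_of_unbounded hω hb 0 (unbounded_of_chain hω hc)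

/-! ### The value of the critical density -/

theorem criticalDensity_eq (hlam : 0 < lam) :
    criticalDensity lam = ENNReal.ofReal (sleepProb lam) := by
  refine le_antisymm (iSup₂_le fun μ hμ => ?_) (le_of_forall_lt fun c hc => ?_)
  · by_contra hlt
    rw [not_le, ENNReal.ofReal_lt_coe_iff (sleepProb_pos hlam).le] at hlt
    have h2 : ∀ᵐ ω ∂noiseLaw lam μ, False := by
      filter_upwards [hμ, ae_not_locallyFixates hlam hlt.le] with ω h3 h4 using h4 h3
    obtain ⟨ω, hω⟩ := h2.exists
    exact hω
  · obtain ⟨d, hcd, hd⟩ := exists_between hc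
    lift d to ℝ≥0 using (hd.trans_le le_top).ne
    refine hcd.trans_le (le_iSup₂_of_le d (ae_locallyFixates hlam ?_) le_rfl)
    exact ENNReal.coe_lt_ofReal.1 hd

theorem sleepProb_eq_div (h : lam ≠ ⊤) : ENNReal.ofReal (sleepProb lam) = lam / (1 + lam) := by
  lift lam to ℝ≥0 using h
  have h1 : (0 : ℝ) < 1 + lam := by positivity
  simp only [sleepProb, ENNReal.coe_ne_top, if_false, ENNReal.coe_toReal]
  rw [ENNReal.ofReal_div_of_pos h1, ENNReal.ofReal_add zero_le_one (NNReal.coe_nonneg lam)]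
  simp

end

end ARW

theorem mainTheorem1 (lam : ℝ≥0∞) (hlam : 0 < lam) :
    (∀ μ : ℝ≥0, ∀ᵐ ω ∂ARW.noiseLaw lam μ, ARW.WellDefined lam ω) ∧
    (lam ≠ ⊤ → ARW.criticalDensity lam = lam / (1 + lam)) ∧
    (lam = ⊤ → ARW.criticalDensity lam = 1) ∧
    (∀ μ : ℝ≥0, (μ : ℝ≥0∞) < ARW.criticalDensity lam →
      ∀ᵐ ω ∂ARW.noiseLaw lam μ, ARW.LocallyFixates (ARW.process lam ω)) ∧
    (∀ μ : ℝ≥0, ARW.criticalDensity lam < (μ : ℝ≥0∞) →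
      ∀ᵐ ω ∂ARW.noiseLaw lam μ, ¬ ARW.LocallyFixates (ARW.process lam ω)) ∧
    (∀ μ : ℝ≥0, (μ : ℝ≥0∞) = ARW.criticalDensity lam →
      ∀ᵐ ω ∂ARW.noiseLaw lam μ, ¬ ARW.LocallyFixates (ARW.process lam ω)) := by
  have hnot : ∀ μ : ℝ≥0, ARW.criticalDensity lam ≤ (μ : ℝ≥0∞) →
      ∀ᵐ ω ∂ARW.noiseLaw lam μ, ¬ ARW.LocallyFixates (ARW.process lam ω) := fun μ hμ => by
    refine ARW.ae_not_locallyFixates hlam ?_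
    rw [ARW.criticalDensity_eq hlam, ← ENNReal.ofReal_coe_nnreal] at hμ
    exact (ENNReal.ofReal_le_ofReal_iff (NNReal.coe_nonneg μ)).1 hμ
  refine ⟨fun μ => ?_, fun h => ?_, fun h => ?_, fun μ hμ => ?_, fun μ hμ => hnot μ hμ.le,
    fun μ hμ => hnot μ hμ.ge⟩
  · filter_upwards [ARW.ae_isGeneric lam μ, ARW.ae_hasBlocks lam μ] with ω hω hb
    exact ARW.wellDefined_of_hasBlocks hω hb
  · rw [ARW.criticalDensity_eq hlam, ARW.sleepProb_eq_div h]
  · rw [ARW.criticalDensity_eq hlam]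
    simp [ARW.sleepProb, h]
  · refine ARW.ae_locallyFixates hlam ?_
    rwa [ARW.criticalDensity_eq hlam, ← ENNReal.ofReal_coe_nnreal,
      ENNReal.ofReal_lt_ofReal_iff (ARW.sleepProb_pos hlam)] at hμ
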